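/- **Setup.** Let $n,\ell\ge 1$. Let $\mathfrak h_n^*=\{\lambda=\sum_{i=1}^n\lambda_i\epsilon_i\in\mathbb C^n:\sum_i\lambda_i=0\}$ be the dual of the Cartan subalgebra $\mathfrak h_n$ of diagonal matrices in $\mathfrak{sl}_n=\mathfrak n_+\oplus\mathfrak h_n\oplus\mathfrak n_-$ (over $\mathbb C$, with $\mathfrak n_\pm$ the strictly upper/lower triangular matrices), let $\rho=\frac12\sum_{i<j}(\epsilon_i-\epsilon_j)$, and let $P_n$ (resp. $P_n^+$) be the set of $\lambda\in\mathfrak h_n^*$ with $\lambda_i-\lambda_{i+1}\in\mathbb Z$ (resp. $\mathbb Z_{\ge0}$) for all $i$. Let $V_n=\mathbb C^n$ be the vector representation and let $P(V_n^{\otimes\ell})$ be the set of weights of $V_n^{\otimes\ell}$. Let $M(\mu)$ be the Verma module with highest weight $\mu$. The degenerate affine Hecke algebra $H_\ell$ is the algebra generated by $\mathbb C[\mathfrak S_\ell]$ and commuting elements $\epsilon^\vee_1,\dots,\epsilon^\vee_\ell$, with the relations $s_i\epsilon_j^\vee-\epsilon^\vee_{s_i(j)}s_i=-(\delta_{i,j}-\delta_{i+1,j})$,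 where $s_i=(i\ i{+}1)$; $H_0=\mathbb C$. For an $\mathfrak{sl}_n$-module $X$, number the factors of $X\otimes V_n^{\otimes\ell}$ by $0,1,\dots,\ell$, and let $\Omega_{ij}$ denote the action in the factors $i$ and $j$ of the canonical element $\Omega\in\mathfrak{sl}_n\otimes\mathfrak{sl}_n$ of the form $(x|y)=\operatorname{tr}(xy)$. Let $\mathfrak S_\ell$ act on $X\otimes V_n^{\otimes \ell}$ by permuting the factors of $V_n^{\otimes\ell}$ and let $\epsilon_i^\vee$ act by $$y_i=\Omega_{0i}+\sum_{1\le j<i}\Big(\Omega_{ji}+\frac1n\Big)+\frac{n-1}2 .$$ This is an action of $H_\ell$ that commutes with $\mathfrak{sl}_n$. For $\lambda\in\mathfrak h_n^*$ let $F_\lambda(X)$ be the $H_\ell$-module given by the weight space $$F_\lambda(X)=\big((X\otimes V_n^{\otimes\ell})/\mathfrak n_-(X\otimes V_n^{\otimes\ell})\big)_\lambda .$$ For $a\in\mathbb C$ and $m\ge0$ let $\mathbb C_{[a,a+m-1]}$ be the one-dimensional $H_m$-module on which $\mathfrak S_m$ acts trivially and $\epsilon_i^\vee$ acts by $a+i-1$.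 If $\lambda-\mu\in P(V_n^{\otimes\ell})$, there are unique integers $\ell_1,\dots,\ell_n\ge0$ with $\sum_i\ell_i=\ell$ and $\lambda-\mu\equiv\sum_i\ell_i\epsilon_i$ modulo $\mathbb C(\epsilon_1+\dots+\epsilon_n)$. Put $\mu'_i=(\mu+\rho)_i$ and $$\mathcal M(\lambda,\mu)=H_\ell\otimes_{H_{\ell_1}\otimes\cdots\otimes H_{\ell_n}}\big(\mathbb C_{[\mu_1',\mu_1'+\ell_1-1]}\otimes\cdots\otimes\mathbb C_{[\mu_n',\mu_n'+\ell_n-1]}\big).$$ **Theorem.** Let $\lambda,\mu\in P_n$. 1. If $\lambda-\mu\in P(V_n^{\otimes\ell})$, then $F_\lambda(M(\mu))\cong\mathcal M(\lambda,\mu)$ as $H_\ell$-modules. 2. If $\lambda-\mu\notin P(V_n^{\otimes\ell})$, then $F_\lambda(M(\mu))=0$. 3. If $\lambda+\rho\in P_n^+$ and $\lambda-\mu\in P(V_n^{\otimes\ell})$, then $F_\lambda(M(\mu))$ has a unique simple quotient, i.e. there is exactly one $H_\ell$-submodule $N$ such that $F_\lambda(M(\mu))/N$ is simple. -/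

import Mathlib

open scoped TensorProduct

attribute [local instance] LieRing.ofAssociativeRing

namespace ArakawaSuzuki

noncomputable section

/-- The Lie algebra `sl_n` of traceless complex `n × n` matrices. -/
abbrev SL (n : ℕ) : LieSubalgebra ℂ (Matrix (Fin n) (Fin n) ℂ) :=
  LieAlgebra.SpecialLinear.sl (Fin n) ℂ

theorem mem_SL {n : ℕ} {A : Matrix (Fin n) (Fin n) ℂ} : A ∈ SL n ↔ A.trace = 0 := Iff.rfl

/-- The Cartan subalgebra of diagonal matrices. -/
def cartan (n : ℕ) : Submodule ℂ (SL n) where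
  carrier := {x | ∀ i j, i ≠ j → x.1 i j = 0}
  add_mem' hx hy i j h := by simp [hx i j h, hy i j h]
  zero_mem' := by simp
  smul_mem' c x hx i j h := by simp [hx i j h]

/-- The strictly upper triangular matrices `n_+`. -/
def nPlus (n : ℕ) : Submodule ℂ (SL n) where
  carrier := {x | ∀ i j, j ≤ i → x.1 i j = 0}
  add_mem' hx hy i j h := by simp [hx i j h, hy i j h]
  zero_mem' := by simp
  smul_mem' c x hx i j h := by simp [hx i j h]

/-- The strictly lower triangular matrices `n_-`. -/
def nMinus (n : ℕ) : Submodule ℂ (SL n) where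
  carrier := {x | ∀ i j, i ≤ j → x.1 i j = 0}
  add_mem' hx hy i j h := by simp [hx i j h, hy i j h]
  zero_mem' := by simp
  smul_mem' c x hx i j h := by simp [hx i j h]

/-- `h_n^*`: tuples `(lam_1, …, lam_n)` of complex numbers (coordinates with respect to
`ε_1, …, ε_n`) with sum zero. -/
def CartanDual (n : ℕ) : Submodule ℂ (Fin n → ℂ) where
  carrier := {lam | ∑ i, lam i = 0}
  add_mem' {a b} ha hb := by
    simp only [Set.mem_ofPred_eq, Pi.add_apply, Finset.sum_add_distrib] at *
    rw [ha, hb, add_zero]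
  zero_mem' := by simp
  smul_mem' c x hx := by
    simp only [Set.mem_ofPred_eq, Pi.smul_apply, smul_eq_mul, ← Finset.mul_sum] at *
    rw [hx, mul_zero]

/-- The pairing `⟨lam, h⟩` of `lam ∈ h_n^*` with a diagonal matrix `h` of trace zero. -/
def pairing {n : ℕ} (lam : CartanDual n) (h : SL n) : ℂ := ∑ i, lam.1 i * h.1 i i

/-- The root `α_{ij} = ε_i - ε_j`. -/
def root {n : ℕ} (i j : Fin n) : CartanDual n :=
  ⟨Pi.single i 1 - Pi.single j 1, by
    change ∑ k, ((Pi.single i 1 - Pi.single j 1 : Fin n → ℂ) k) = 0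
    simp⟩

/-- Half the sum of the positive roots. -/
def rho (n : ℕ) : CartanDual n :=
  (1 / 2 : ℂ) • ∑ p ∈ Finset.univ.filter (fun p : Fin n × Fin n => p.1 < p.2), root p.1 p.2

/-- The weight lattice `P_n`. -/
def integralWeights (n : ℕ) : Set (CartanDual n) :=
  {lam | ∀ i j : Fin n, (j : ℕ) = i + 1 → ∃ m : ℤ, lam.1 i - lam.1 j = m}

/-- The dominant integral weights `P_n^+`. -/
def dominantIntegralWeights (n : ℕ) : Set (CartanDual n) :=
  {lam | ∀ i j : Fin n, (j : ℕ) = i + 1 → ∃ m : ℕ, lam.1 i - lam.1 j = m}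

/-- The weights `P(X)` of an `sl_n`-module `X`. -/
def weights {n : ℕ} (X : Type*) [AddCommGroup X] [Module ℂ X] [LieRingModule (SL n) X] :
    Set (CartanDual n) :=
  {lam | ∃ v : X, v ≠ 0 ∧ ∀ h ∈ cartan n, ⁅h, v⁆ = pairing lam h • v}

/-! ### Verma modules -/

/-- The left ideal of `U(sl_n)` generated by `n_+` and the elements `h - ⟨mu, h⟩`, `h ∈ h_n`. -/
def vermaIdeal {n : ℕ} (mu : CartanDual n) :
    Submodule (UniversalEnvelopingAlgebra ℂ (SL n)) (UniversalEnvelopingAlgebra ℂ (SL n)) :=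
  Submodule.span _
    ({u | ∃ x ∈ nPlus n, u = UniversalEnvelopingAlgebra.ι ℂ x} ∪
     {u | ∃ h ∈ cartan n, u = UniversalEnvelopingAlgebra.ι ℂ h - algebraMap ℂ _ (pairing mu h)})

/-- The Verma module `M(mu)` with highest weight `mu`. -/
def Verma {n : ℕ} (mu : CartanDual n) : Type :=
  UniversalEnvelopingAlgebra ℂ (SL n) ⧸ vermaIdeal mu

namespace Verma

variable {n : ℕ} (mu : CartanDual n)

instance : AddCommGroup (Verma mu) :=
  inferInstanceAs (AddCommGroup (UniversalEnvelopingAlgebra ℂ (SL n) ⧸ vermaIdeal mu))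

instance : Module ℂ (Verma mu) :=
  inferInstanceAs (Module ℂ (UniversalEnvelopingAlgebra ℂ (SL n) ⧸ vermaIdeal mu))

instance : Module (UniversalEnvelopingAlgebra ℂ (SL n)) (Verma mu) :=
  inferInstanceAs (Module (UniversalEnvelopingAlgebra ℂ (SL n))
    (UniversalEnvelopingAlgebra ℂ (SL n) ⧸ vermaIdeal mu))

instance : IsScalarTower ℂ (UniversalEnvelopingAlgebra ℂ (SL n)) (Verma mu) :=
  inferInstanceAs (IsScalarTower ℂ (UniversalEnvelopingAlgebra ℂ (SL n))
    (UniversalEnvelopingAlgebra ℂ (SL n) ⧸ vermaIdeal mu))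

instance : LieRingModule (SL n) (Verma mu) where
  bracket x m := UniversalEnvelopingAlgebra.ι ℂ x • m
  add_lie x y m := by simp [add_smul]
  lie_add x m m' := by simp
  leibniz_lie x y m := by
    simp [LieRing.of_associative_ring_bracket, sub_smul, mul_smul]

instance : LieModule ℂ (SL n) (Verma mu) where
  smul_lie c x m := by
    change UniversalEnvelopingAlgebra.ι ℂ (c • x) • m = c • UniversalEnvelopingAlgebra.ι ℂ x • m
    rw [map_smul, smul_assoc]
  lie_smul c x m := by
    change UniversalEnvelopingAlgebra.ι ℂ x • c • m = c • UniversalEnvelopingAlgebra.ι ℂ x • m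
    rw [smul_algebra_smul_comm]

end Verma

/-! ### Degenerate affine Hecke algebras -/

/-- Generator of the free algebra attached to `w ∈ W_l`. -/
def genW {l : ℕ} (w : Equiv.Perm (Fin l)) : FreeAlgebra ℂ (Equiv.Perm (Fin l) ⊕ Fin l) :=
  FreeAlgebra.ι ℂ (Sum.inl w)

/-- Generator of the free algebra attached to `ε_i^∨ ∈ t_l`. -/
def genE {l : ℕ} (i : Fin l) : FreeAlgebra ℂ (Equiv.Perm (Fin l) ⊕ Fin l) :=
  FreeAlgebra.ι ℂ (Sum.inr i)

/-- `⟨ε_i - ε_i', ε_j^∨⟩`. -/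
def rootCoeff {l : ℕ} (i i' j : Fin l) : ℂ :=
  (if j = i then 1 else 0) - (if j = i' then 1 else 0)

/-- The defining relations of `H_l`: those of the group algebra `ℂ[W_l]`, those of the symmetric
algebra `S(t_l)`, and `s_α ξ - s_α(ξ) s_α = -⟨α, ξ⟩` for the simple roots `α = ε_i - ε_{i+1}`
and the basis vectors `ξ = ε_j^∨` of `t_l`. -/
inductive HeckeRel (l : ℕ) :
    FreeAlgebra ℂ (Equiv.Perm (Fin l) ⊕ Fin l) → FreeAlgebra ℂ (Equiv.Perm (Fin l) ⊕ Fin l) → Prop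
  | one : HeckeRel l (genW 1) 1
  | mul (w w' : Equiv.Perm (Fin l)) : HeckeRel l (genW (w * w')) (genW w * genW w')
  | comm (i j : Fin l) : HeckeRel l (genE i * genE j) (genE j * genE i)
  | cross (i k : Fin l) (h : (k : ℕ) = i + 1) (j : Fin l) :
      HeckeRel l (genW (Equiv.swap i k) * genE j - genE (Equiv.swap i k j) * genW (Equiv.swap i k))
        (algebraMap ℂ _ (-rootCoeff i k j))

/-- The degenerate affine Hecke algebra `H_l` of `GL_l`. By the Poincaré–Birkhoff–Witt property,
multiplication `ℂ[W_l] ⊗ S(t_l) → H_l` is a linear isomorphism. For `l = 0` it is `ℂ`. -/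
def Hecke (l : ℕ) : Type := RingQuot (HeckeRel l)

namespace Hecke

variable {l : ℕ}

instance : Ring (Hecke l) := inferInstanceAs (Ring (RingQuot (HeckeRel l)))

instance : Algebra ℂ (Hecke l) := inferInstanceAs (Algebra ℂ (RingQuot (HeckeRel l)))

/-- The quotient map from the free algebra. -/
def mk (l : ℕ) : FreeAlgebra ℂ (Equiv.Perm (Fin l) ⊕ Fin l) →ₐ[ℂ] Hecke l :=
  RingQuot.mkAlgHom ℂ (HeckeRel l)

/-- The image of `w ∈ W_l` in `H_l`. -/
def w (σ : Equiv.Perm (Fin l)) : Hecke l := mk l (genW σ)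

/-- The image of `ε_i^∨` in `H_l`. -/
def eps (i : Fin l) : Hecke l := mk l (genE i)

theorem w_one : w (1 : Equiv.Perm (Fin l)) = 1 := by
  have := RingQuot.mkAlgHom_rel ℂ (HeckeRel.one (l := l))
  rw [map_one] at this
  exact this

theorem w_mul (σ τ : Equiv.Perm (Fin l)) : w (σ * τ) = w σ * w τ := by
  have := RingQuot.mkAlgHom_rel ℂ (HeckeRel.mul σ τ)
  rw [map_mul] at this
  exact this

theorem eps_comm (i j : Fin l) : eps i * eps j = eps j * eps i := by
  have := RingQuot.mkAlgHom_rel ℂ (HeckeRel.comm i j)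
  rw [map_mul, map_mul] at this
  exact this

theorem cross (i i' : Fin l) (h : (i' : ℕ) = i + 1) (j : Fin l) :
    w (Equiv.swap i i') * eps j - eps (Equiv.swap i i' j) * w (Equiv.swap i i') =
      algebraMap ℂ _ (-rootCoeff i i' j) := by
  have := RingQuot.mkAlgHom_rel ℂ (HeckeRel.cross i i' h j)
  rw [map_sub, map_mul, map_mul, AlgHom.commutes] at this
  exact this

/-- The universal property of `H_l`. -/
def lift {A : Type*} [Ring A] [Algebra ℂ A] (f : Equiv.Perm (Fin l) →* A) (x : Fin l → A)
    (hx : ∀ i j, x i * x j = x j * x i)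
    (hc : ∀ i i' : Fin l, (i' : ℕ) = i + 1 → ∀ j,
      f (Equiv.swap i i') * x j - x (Equiv.swap i i' j) * f (Equiv.swap i i') =
        algebraMap ℂ A (-rootCoeff i i' j)) : Hecke l →ₐ[ℂ] A :=
  RingQuot.liftAlgHom ℂ ⟨FreeAlgebra.lift ℂ (Sum.elim f x), by
    intro a b hab
    induction hab with
    | one => simp [genW]
    | mul w w' => simp [genW]
    | comm i j => simpa [genE] using hx i j
    | cross i i' h j =>
      rw [AlgHom.commutes]
      simpa only [genW, genE, map_sub, map_mul, FreeAlgebra.lift_ι_apply, Sum.elim_inl,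
        Sum.elim_inr] using hc i i' h j⟩

section lift

variable {A : Type*} [Ring A] [Algebra ℂ A] (f : Equiv.Perm (Fin l) →* A) (x : Fin l → A)
    (hx : ∀ i j, x i * x j = x j * x i)
    (hc : ∀ i i' : Fin l, (i' : ℕ) = i + 1 → ∀ j,
      f (Equiv.swap i i') * x j - x (Equiv.swap i i' j) * f (Equiv.swap i i') =
        algebraMap ℂ A (-rootCoeff i i' j))

theorem lift_w (σ : Equiv.Perm (Fin l)) : lift f x hx hc (w σ) = f σ := by
  change RingQuot.liftAlgHom ℂ _ (RingQuot.mkAlgHom ℂ (HeckeRel l) (genW σ)) = _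
  rw [RingQuot.liftAlgHom_mkAlgHom_apply]
  simp [genW]

theorem lift_eps (i : Fin l) : lift f x hx hc (eps i) = x i := by
  change RingQuot.liftAlgHom ℂ _ (RingQuot.mkAlgHom ℂ (HeckeRel l) (genE i)) = _
  rw [RingQuot.liftAlgHom_mkAlgHom_apply]
  simp [genE]

end lift

/-- `H_l` is generated by `W_l` and the `ε_i^∨`. -/
theorem adjoin_eq_top (l : ℕ) :
    Algebra.adjoin ℂ (Set.range (w (l := l)) ∪ Set.range (eps (l := l))) = ⊤ := by
  rw [eq_top_iff]
  rintro a -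
  obtain ⟨b, rfl⟩ := RingQuot.mkAlgHom_surjective ℂ (HeckeRel l) a
  change mk l b ∈ _
  induction b using FreeAlgebra.induction with
  | grade0 r => rw [AlgHom.commutes]; exact Subalgebra.algebraMap_mem _ _
  | grade1 s =>
    rcases s with s | s
    · exact Algebra.subset_adjoin (Or.inl ⟨s, rfl⟩)
    · exact Algebra.subset_adjoin (Or.inr ⟨s, rfl⟩)
  | mul a b ha hb => rw [map_mul]; exact mul_mem ha hb
  | add a b ha hb => rw [map_add]; exact add_mem ha hb

/-- The one-dimensional representation `ℂ_{[a, a + l - 1]}` of `H_l`, as a character: each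
`w ∈ W_l` acts as `1` and `ε_i^∨` acts as `a + i - 1` for `i = 1, …, l`. -/
def segmentChar (l : ℕ) (a : ℂ) : Hecke l →ₐ[ℂ] ℂ :=
  lift 1 (fun i => a + (i : ℕ)) (fun _ _ => mul_comm _ _) (by
    intro i i' h j
    have hne : i ≠ i' := by rintro rfl; omega
    simp only [MonoidHom.one_apply, one_mul, mul_one, Algebra.algebraMap_self, RingHom.id_apply,
      rootCoeff]
    by_cases h1 : j = i
    · subst h1; simp [hne, h]
    · by_cases h2 : j = i'
      · subst h2; simp [h1, h]
      · simp [h1, h2, Equiv.swap_apply_of_ne_of_ne h1 h2])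

end Hecke

/-! ### Parabolic subalgebras and standard modules -/

namespace Hecke

theorem viaEmbedding_swap {m l : ℕ} (e : Fin m ↪ Fin l) (i i' : Fin m) :
    (Equiv.swap i i').viaEmbedding e = Equiv.swap (e i) (e i') := by
  ext x
  by_cases hx : x ∈ Set.range e
  · obtain ⟨y, rfl⟩ := hx
    rw [Equiv.Perm.viaEmbedding_apply, e.injective.swap_apply]
  · rw [Equiv.Perm.viaEmbedding_apply_of_notMem _ _ _ hx, Equiv.swap_apply_of_ne_of_ne]
    · rintro rfl; exact hx ⟨_, rfl⟩
    · rintro rfl; exact hx ⟨_, rfl⟩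

/-- The homomorphism `H_m → H_l` induced by an order-preserving inclusion of `{1, …, m}` into
`{1, …, l}` as an interval. -/
def blockHom {m l : ℕ} (e : Fin m ↪ Fin l)
    (he : ∀ i i' : Fin m, (i' : ℕ) = i + 1 → (e i' : ℕ) = e i + 1) : Hecke m →ₐ[ℂ] Hecke l :=
  lift
    { toFun := fun σ => w (σ.viaEmbedding e)
      map_one' := by
        change w (Equiv.Perm.viaEmbeddingHom e 1) = 1
        rw [map_one, w_one]
      map_mul' := fun σ τ => by
        change w (Equiv.Perm.viaEmbeddingHom e (σ * τ)) = _
        rw [map_mul, w_mul]; rfl }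
    (fun i => eps (e i)) (fun i j => eps_comm _ _) (by
      intro i i' h j
      have h1 := viaEmbedding_swap e i i'
      have h2 := cross (e i) (e i') (he i i' h) (e j)
      have h3 : e (Equiv.swap i i' j) = Equiv.swap (e i) (e i') (e j) :=
        (e.injective.swap_apply _ _ _).symm
      simp only [MonoidHom.coe_mk, OneHom.coe_mk, h1, h3]
      rw [h2]
      simp [rootCoeff])

section blockHom

variable {m l : ℕ} (e : Fin m ↪ Fin l)
    (he : ∀ i i' : Fin m, (i' : ℕ) = i + 1 → (e i' : ℕ) = e i + 1)

theorem blockHom_w (σ : Equiv.Perm (Fin m)) : blockHom e he (w σ) = w (σ.viaEmbedding e) := by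
  unfold blockHom
  rw [lift_w]
  rfl

theorem blockHom_eps (j : Fin m) : blockHom e he (eps j) = eps (e j) := by
  unfold blockHom
  rw [lift_eps]

theorem commute_blockHom_w_eps (σ : Equiv.Perm (Fin m)) (x : Fin l) (hx : x ∉ Set.range e) :
    Commute (blockHom e he (w σ)) (eps x) := by
  cases m with
  | zero =>
    rw [Subsingleton.elim σ 1, w_one, map_one]
    exact Commute.one_left _
  | succ m =>
    have hσ : σ ∈ Submonoid.closure
        (Set.range fun i : Fin m => Equiv.swap i.castSucc i.succ) := by
      rw [Equiv.Perm.mclosure_swap_castSucc_succ]; trivial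
    induction hσ using Submonoid.closure_induction with
    | mem y hy =>
      obtain ⟨i, rfl⟩ := hy
      have h1 : (Equiv.swap i.castSucc i.succ).viaEmbedding e =
          Equiv.swap (e i.castSucc) (e i.succ) := viaEmbedding_swap e _ _
      have h2 := cross (e i.castSucc) (e i.succ) (he _ _ (by simp)) x
      have h3 : x ≠ e i.castSucc := by rintro rfl; exact hx ⟨_, rfl⟩
      have h4 : x ≠ e i.succ := by rintro rfl; exact hx ⟨_, rfl⟩
      rw [Equiv.swap_apply_of_ne_of_ne h3 h4] at h2
      simp only [rootCoeff, h3, h4, if_false, sub_zero, neg_zero, map_zero] at h2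
      rw [blockHom_w, h1]
      exact sub_eq_zero.mp h2
    | one => rw [w_one, map_one]; exact Commute.one_left _
    | mul y z _ _ hy hz => rw [w_mul, map_mul]; exact hy.mul_left hz

end blockHom

end Hecke

/-- A segment `[a, b]`, given by `a` and its length `b - a + 1 ∈ ℤ_{≥ 0}`. -/
structure Segment where
  /-- the left end -/
  a : ℂ
  /-- the length `b - a + 1` -/
  len : ℕ

section Standard

variable {k l : ℕ} (Δ : Fin k → Segment) (hΔ : ∑ i, (Δ i).len = l)

/-- The inclusion of the `i`-th of the `k` consecutive blocks of sizes `l_1, …, l_k` into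
`{1, …, l}`, where `l = l_1 + ⋯ + l_k`. -/
def blockIncl (i : Fin k) : Fin (Δ i).len ↪ Fin l where
  toFun j := Fin.cast hΔ (finSigmaFinEquiv ⟨i, j⟩)
  inj' j j' h := by
    have := finSigmaFinEquiv.injective (Fin.cast_injective hΔ h)
    simpa using this

theorem blockIncl_val (i : Fin k) (j : Fin (Δ i).len) :
    (blockIncl Δ hΔ i j : ℕ) =
      ∑ i' : Fin i, (Δ (Fin.castLE i.2.le i')).len + j := by
  change ((Fin.cast hΔ (finSigmaFinEquiv ⟨i, j⟩) : Fin l) : ℕ) = _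
  simp

theorem blockIncl_ne {i i' : Fin k} (h : i ≠ i') (j : Fin (Δ i).len) (j' : Fin (Δ i').len) :
    blockIncl Δ hΔ i j ≠ blockIncl Δ hΔ i' j' := by
  intro he
  have := finSigmaFinEquiv.injective (Fin.cast_injective hΔ he)
  exact h (congrArg Sigma.fst this)

/-- The homomorphism from `H_{l_i}` to `H_l` for the `i`-th block. -/
def factorHom (i : Fin k) : Hecke (Δ i).len →ₐ[ℂ] Hecke l :=
  Hecke.blockHom (blockIncl Δ hΔ i) (fun j j' h => by
    rw [blockIncl_val, blockIncl_val, h]; rfl)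

theorem factorHom_w (i : Fin k) (σ : Equiv.Perm (Fin (Δ i).len)) :
    factorHom Δ hΔ i (Hecke.w σ) = Hecke.w (σ.viaEmbedding (blockIncl Δ hΔ i)) :=
  Hecke.blockHom_w _ _ σ

theorem factorHom_eps (i : Fin k) (j : Fin (Δ i).len) :
    factorHom Δ hΔ i (Hecke.eps j) = Hecke.eps (blockIncl Δ hΔ i j) :=
  Hecke.blockHom_eps _ _ j

theorem commute_w_w {i i' : Fin k} (h : i ≠ i') (σ : Equiv.Perm (Fin (Δ i).len))
    (τ : Equiv.Perm (Fin (Δ i').len)) :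
    Commute (factorHom Δ hΔ i (Hecke.w σ)) (factorHom Δ hΔ i' (Hecke.w τ)) := by
  rw [factorHom_w, factorHom_w, commute_iff_eq, ← Hecke.w_mul, ← Hecke.w_mul]
  congr 1
  refine Equiv.Perm.Disjoint.commute ?_
  intro x
  by_cases hx : x ∈ Set.range (blockIncl Δ hΔ i)
  · right
    apply Equiv.Perm.viaEmbedding_apply_of_notMem
    rintro ⟨j', rfl⟩
    obtain ⟨j, hj⟩ := hx
    exact blockIncl_ne Δ hΔ h j j' hj
  · left
    exact Equiv.Perm.viaEmbedding_apply_of_notMem _ _ _ hx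

theorem commute_w_eps {i i' : Fin k} (h : i ≠ i') (σ : Equiv.Perm (Fin (Δ i).len))
    (j' : Fin (Δ i').len) :
    Commute (factorHom Δ hΔ i (Hecke.w σ)) (factorHom Δ hΔ i' (Hecke.eps j')) := by
  rw [factorHom_eps]
  refine Hecke.commute_blockHom_w_eps _ _ σ _ ?_
  rintro ⟨j, hj⟩
  exact blockIncl_ne Δ hΔ h j j' hj

theorem commute_factorHom {i i' : Fin k} (h : i ≠ i') (a : Hecke (Δ i).len)
    (b : Hecke (Δ i').len) : Commute (factorHom Δ hΔ i a) (factorHom Δ hΔ i' b) := by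
  have key : ∀ {i i' : Fin k} (h : i ≠ i') (S : Set (Hecke (Δ i).len))
      (_ : Algebra.adjoin ℂ S = ⊤) (c : Hecke l)
      (_ : ∀ s ∈ S, Commute (factorHom Δ hΔ i s) c) (a : Hecke (Δ i).len),
      Commute (factorHom Δ hΔ i a) c := by
    intro i i' h S hS c hc a
    have ha : a ∈ Algebra.adjoin ℂ S := by rw [hS]; trivial
    induction ha using Algebra.adjoin_induction with
    | mem x hx => exact hc x hx
    | algebraMap r => rw [AlgHom.commutes]; exact Algebra.commutes r c
    | add x y _ _ hx hy => rw [map_add]; exact hx.add_left hy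
    | mul x y _ _ hx hy => rw [map_mul]; exact hx.mul_left hy
  refine key h _ (Hecke.adjoin_eq_top _) _ ?_ a
  intro s hs
  refine (key h.symm _ (Hecke.adjoin_eq_top _) _ ?_ b).symm
  intro t ht
  rcases hs with ⟨σ, rfl⟩ | ⟨j, rfl⟩ <;> rcases ht with ⟨τ, rfl⟩ | ⟨j', rfl⟩
  · exact (commute_w_w Δ hΔ h σ τ).symm
  · exact (commute_w_eps Δ hΔ h σ j').symm
  · exact commute_w_eps Δ hΔ h.symm τ j
  · rw [factorHom_eps, factorHom_eps]; exact Hecke.eps_comm _ _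

theorem list_prod_mul {A : Type*} [Monoid A] {k : ℕ} (f g : Fin k → A)
    (h : ∀ i j, i ≠ j → Commute (g i) (f j)) :
    (List.ofFn fun i => f i * g i).prod = (List.ofFn f).prod * (List.ofFn g).prod := by
  induction k with
  | zero => simp
  | succ k ih =>
    have h0 : Commute (g 0) (List.ofFn fun i : Fin k => f i.succ).prod := by
      apply Commute.list_prod_right
      intro x hx
      obtain ⟨i, rfl⟩ := List.mem_ofFn.mp hx
      exact h _ _ (Fin.succ_ne_zero i).symm
    simp only [List.ofFn_succ, List.prod_cons]
    rw [ih (fun i => f i.succ) (fun i => g i.succ)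
      (fun i j hij => h _ _ (fun e => hij (Fin.succ_injective _ e)))]
    rw [mul_assoc, mul_assoc, ← mul_assoc (g 0), h0.eq, mul_assoc]

/-- The homomorphism `H_{l_1} ⊗ ⋯ ⊗ H_{l_k} → H_l`, `a_1 ⊗ ⋯ ⊗ a_k ↦ a_1 ⋯ a_k`, which identifies
the tensor product with a (parabolic) subalgebra of `H_l`. -/
def parabolicHom : (⨂[ℂ] i, Hecke (Δ i).len) →ₐ[ℂ] Hecke l :=
  PiTensorProduct.liftAlgHom
    ((MultilinearMap.mkPiAlgebraFin ℂ k (Hecke l)).compLinearMap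
      (fun i => (factorHom Δ hΔ i).toLinearMap))
    (by simp) (by
      intro x y
      simp only [MultilinearMap.compLinearMap_apply, MultilinearMap.mkPiAlgebraFin_apply,
        AlgHom.toLinearMap_apply, Pi.mul_apply, map_mul]
      exact list_prod_mul _ _ (fun i j h => commute_factorHom Δ hΔ h _ _))

/-- The one-dimensional representation `ℂ_{[a_1,b_1]} ⊗ ⋯ ⊗ ℂ_{[a_k,b_k]}` of
`H_{l_1} ⊗ ⋯ ⊗ H_{l_k}`, as a character. -/
def parabolicChar : (⨂[ℂ] i, Hecke (Δ i).len) →ₐ[ℂ] ℂ :=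
  PiTensorProduct.liftAlgHom
    ((MultilinearMap.mkPiAlgebra ℂ (Fin k) ℂ).compLinearMap
      (fun i => (Hecke.segmentChar (Δ i).len (Δ i).a).toLinearMap))
    (by simp) (by
      intro x y
      simp [Finset.prod_mul_distrib])

end Standard

/-- For algebra homomorphisms `φ : A → B` and `χ : A → ℂ`, the left ideal of `B` generated by the
elements `φ a - χ a`, so that the quotient of `B` by it is the induced module `B ⊗_A ℂ_χ`. -/
def inductionIdeal {A B : Type*} [Ring A] [Algebra ℂ A] [Ring B] [Algebra ℂ B]
    (φ : A →ₐ[ℂ] B) (χ : A →ₐ[ℂ] ℂ) : Submodule B B :=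
  Submodule.span B (Set.range fun a => φ a - algebraMap ℂ B (χ a))

/-- The module `M(Δ) = H_l ⊗_{H_{l_1} ⊗ ⋯ ⊗ H_{l_k}} (ℂ_{[a_1,b_1]} ⊗ ⋯ ⊗ ℂ_{[a_k,b_k]})` attached
to a sequence of segments `Δ` of total length `l`. -/
abbrev SegmentModule {k l : ℕ} (Δ : Fin k → Segment) (hΔ : ∑ i, (Δ i).len = l) : Type :=
  Hecke l ⧸ inductionIdeal (parabolicHom Δ hΔ) (parabolicChar Δ)


/-! ### The Casimir tensor -/

section Casimir

variable {n : ℕ}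

/-- `E_ab` for `a ≠ b`, and `E_aa - (1/n) I` for `a = b`. -/
def traceless (a b : Fin n) : SL n :=
  ⟨Matrix.single a b 1 - (if a = b then (1 / n : ℂ) else 0) • 1, by
    have hn : (n : ℂ) ≠ 0 := by
      have := a.pos
      exact_mod_cast this.ne'
    rw [mem_SL, Matrix.trace_sub, Matrix.trace_smul, Matrix.trace_one, Fintype.card_fin]
    by_cases h : a = b
    · subst h; simp [hn]
    · simp [h]⟩

theorem traceless_apply (a b i j : Fin n) :
    (traceless a b).1 i j = (if a = i ∧ b = j then 1 else 0) -
      if a = b ∧ i = j then (1 / n : ℂ) else 0 := by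
  simp only [traceless, Matrix.sub_apply, Matrix.single_apply, Matrix.smul_apply, Matrix.one_apply,
    smul_eq_mul]
  by_cases h : a = b <;> by_cases hij : i = j <;> simp [h, hij]

/-- The simple coroot `h_i = E_ii - E_{i+1,i+1}`. -/
def coroot (i : Fin (n - 1)) : SL n :=
  traceless ⟨i, by omega⟩ ⟨i, by omega⟩ - traceless ⟨i + 1, by omega⟩ ⟨i + 1, by omega⟩

/-- The dual basis `h^i` of the basis `h_i` of `h_n` with respect to the trace form. -/
def dualCoroot (i : Fin (n - 1)) : SL n :=
  ∑ a ∈ Finset.univ.filter (fun a : Fin n => (a : ℕ) ≤ i), traceless a a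

theorem trace_traceless_mul (a b : Fin n) :
    ((traceless a a).1 * (traceless b b).1).trace = (if a = b then 1 else 0) - 1 / n := by
  have hn : (n : ℂ) ≠ 0 := by
    have := a.pos
    exact_mod_cast this.ne'
  have h1 : (Matrix.single b b (1 : ℂ) : Matrix (Fin n) (Fin n) ℂ).trace = 1 := by simp
  have h3 : (Matrix.single a a (1 : ℂ) : Matrix (Fin n) (Fin n) ℂ).trace = 1 := by simp
  have h2 : ((Matrix.single a a (1 : ℂ) : Matrix (Fin n) (Fin n) ℂ) * Matrix.single b b 1).trace =
      if a = b then 1 else 0 := by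
    by_cases h : a = b
    · subst h; simp
    · simp [h]
  simp only [traceless, if_true, sub_mul, mul_sub, Matrix.trace_sub, smul_mul_assoc,
    mul_smul_comm, one_mul, mul_one, Matrix.trace_smul, h1, h2, h3, Matrix.trace_one,
    Fintype.card_fin, smul_eq_mul]
  field_simp
  ring

/-- `(h^i | h_j) = δ_ij`. -/
theorem trace_dualCoroot_mul_coroot (i j : Fin (n - 1)) :
    ((dualCoroot i).1 * (coroot j).1).trace = if i = j then 1 else 0 := by
  have h1 : (dualCoroot i).1 =
      ∑ a ∈ Finset.univ.filter (fun a : Fin n => (a : ℕ) ≤ i), (traceless a a).1 :=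
    map_sum (SL n).toSubmodule.subtype _ _
  have h2 : (coroot j).1 = (traceless ⟨j, by omega⟩ ⟨j, by omega⟩ : SL n).1 -
    (traceless ⟨j + 1, by omega⟩ ⟨j + 1, by omega⟩ : SL n).1 := rfl
  rw [h1, h2, Finset.sum_mul, Matrix.trace_sum]
  simp only [mul_sub, Matrix.trace_sub, trace_traceless_mul, sub_sub_sub_cancel_right]
  rw [Finset.sum_sub_distrib, Finset.sum_ite_eq', Finset.sum_ite_eq']
  simp only [Finset.mem_filter, Finset.mem_univ, true_and]
  by_cases h : i = j
  · subst h; simp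
  · have : (i : ℕ) ≠ j := fun e => h (Fin.ext e)
    rcases lt_or_gt_of_ne this with hlt | hgt
    · rw [if_neg (by omega), if_neg (by omega), if_neg h]; simp
    · rw [if_pos (by omega), if_pos (by omega), if_neg h]; simp

/-- The element
`Ω = ∑_i h^i ⊗ h_i + ∑_{α > 0} (e_α ⊗ e_{-α} + e_{-α} ⊗ e_α)` of `sl_n ⊗ sl_n`, where
`e_{ε_i - ε_j} = E_ij`. -/
def casimir (n : ℕ) : SL n ⊗[ℂ] SL n :=
  ∑ i : Fin (n - 1), dualCoroot i ⊗ₜ[ℂ] coroot i +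
    ∑ p ∈ Finset.univ.filter (fun p : Fin n × Fin n => p.1 < p.2),
      (traceless p.1 p.2 ⊗ₜ[ℂ] traceless p.2 p.1 + traceless p.2 p.1 ⊗ₜ[ℂ] traceless p.1 p.2)

theorem sum_traceless : ∑ a : Fin n, traceless a a = 0 := by
  apply Subtype.ext
  have h1 : (∑ a : Fin n, traceless a a).1 = ∑ a : Fin n, (traceless a a).1 :=
    map_sum (SL n).toSubmodule.subtype _ _
  rw [h1]
  ext i j
  have hn : (n : ℂ) ≠ 0 := by
    have := i.pos
    exact_mod_cast this.ne'
  rw [Matrix.sum_apply]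
  simp only [traceless_apply, true_and, Finset.sum_sub_distrib]
  by_cases h : i = j
  · subst h; simp [hn]
  · have : ∀ x, ¬ (x = i ∧ x = j) := by rintro x ⟨rfl, rfl⟩; exact h rfl
    simp [h, this]

theorem casimir_diag : ∑ i : Fin (n - 1), dualCoroot i ⊗ₜ[ℂ] coroot i =
    ∑ a : Fin n, traceless a a ⊗ₜ[ℂ] traceless a a := by
  cases n with
  | zero => rfl
  | succ m =>
    have tele : ∀ a : Fin (m + 1),
        (∑ i : Fin (m + 1 - 1), if (a : ℕ) ≤ i then coroot i else 0) =
          (traceless a a - traceless (Fin.last m) (Fin.last m) : SL (m + 1)) := by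
      intro a
      let F : ℕ → SL (m + 1) := fun k =>
        if h : k < m + 1 then traceless ⟨k, h⟩ ⟨k, h⟩ else 0
      have hF : ∀ i : Fin (m + 1 - 1), (coroot i : SL (m + 1)) = F i - F (i + 1) := by
        intro i
        have h1 : (i : ℕ) < m + 1 := by omega
        have h2 : (i : ℕ) + 1 < m + 1 := by omega
        simp only [F, h1, h2, dif_pos, coroot]
      have hs : (∑ i : Fin (m + 1 - 1), if (a : ℕ) ≤ i then coroot i else 0) =
          ∑ k ∈ Finset.Ico (a : ℕ) m, (F k - F (k + 1)) := by
        simp only [hF]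
        rw [Fin.sum_univ_eq_sum_range (fun k => if (a : ℕ) ≤ k then F k - F (k + 1) else 0),
          ← Finset.sum_filter]
        congr 1
        ext k
        simp only [Finset.mem_filter, Finset.mem_range, Finset.mem_Ico]
        omega
      have ht := Finset.sum_Ico_sub F (Nat.lt_succ_iff.mp a.2)
      have hneg : ∑ k ∈ Finset.Ico (a : ℕ) m, (F k - F (k + 1)) = F a - F m := by
        rw [← neg_sub (F m), ← ht, ← Finset.sum_neg_distrib]
        exact Finset.sum_congr rfl (fun k _ => (neg_sub _ _).symm)
      rw [hs, hneg]
      simp only [F, a.2, Nat.lt_succ_self, dif_pos, Fin.last]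
    calc ∑ i : Fin (m + 1 - 1), dualCoroot i ⊗ₜ[ℂ] coroot i
        = ∑ i : Fin (m + 1 - 1), ∑ a : Fin (m + 1),
            traceless a a ⊗ₜ[ℂ] (if (a : ℕ) ≤ i then coroot i else 0) := by
          refine Finset.sum_congr rfl fun i _ => ?_
          rw [dualCoroot, TensorProduct.sum_tmul, Finset.sum_filter]
          refine Finset.sum_congr rfl fun a _ => ?_
          split_ifs <;> simp
      _ = ∑ a : Fin (m + 1), traceless a a ⊗ₜ[ℂ]
            (traceless a a - traceless (Fin.last m) (Fin.last m)) := by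
          rw [Finset.sum_comm]
          refine Finset.sum_congr rfl fun a _ => ?_
          rw [← TensorProduct.tmul_sum, tele]
      _ = _ := by
          simp only [TensorProduct.tmul_sub, Finset.sum_sub_distrib]
          rw [← TensorProduct.sum_tmul, sum_traceless, TensorProduct.zero_tmul, sub_zero]

theorem casimir_eq (n : ℕ) :
    casimir n = ∑ a : Fin n, ∑ b : Fin n, traceless a b ⊗ₜ[ℂ] traceless b a := by
  let F : Fin n × Fin n → SL n ⊗[ℂ] SL n := fun p => traceless p.1 p.2 ⊗ₜ[ℂ] traceless p.2 p.1
  have h1 : ∑ a : Fin n, ∑ b : Fin n, traceless a b ⊗ₜ[ℂ] traceless b a = ∑ p, F p :=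
    (Fintype.sum_prod_type F).symm
  have h2 : ∑ p ∈ Finset.univ.filter (fun p : Fin n × Fin n => p.1 = p.2), F p =
      ∑ a : Fin n, traceless a a ⊗ₜ[ℂ] traceless a a := by
    symm
    refine Finset.sum_bij (fun a _ => (a, a)) ?_ ?_ ?_ ?_ <;> simp [F]
  have h3 : ∑ p ∈ Finset.univ.filter (fun p : Fin n × Fin n => p.2 < p.1), F p =
      ∑ p ∈ Finset.univ.filter (fun p : Fin n × Fin n => p.1 < p.2),
        traceless p.2 p.1 ⊗ₜ[ℂ] traceless p.1 p.2 := by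
    refine Finset.sum_bij (fun p _ => (p.2, p.1)) ?_ ?_ ?_ ?_ <;> simp [F]
    aesop
  rw [casimir, casimir_diag, h1, Finset.sum_add_distrib, ← h3, ← h2]
  have h4 : ∀ p : Fin n × Fin n, F p = (if p.1 = p.2 then F p else 0) +
      ((if p.1 < p.2 then F p else 0) + (if p.2 < p.1 then F p else 0)) := by
    intro p
    rcases lt_trichotomy p.1 p.2 with h | h | h
    · simp [h, h.ne, h.not_gt]
    · simp [h]
    · simp [h, h.ne', h.not_gt]
  have h5 : ∑ p, F p = ∑ p, ((if p.1 = p.2 then F p else 0) +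
      ((if p.1 < p.2 then F p else 0) + (if p.2 < p.1 then F p else 0))) :=
    Finset.sum_congr rfl (fun p _ => h4 p)
  rw [h5, Finset.sum_add_distrib, Finset.sum_add_distrib]
  simp only [Finset.sum_filter]
  rfl

theorem lie_traceless (y : SL n) (a b : Fin n) :
    ⁅y, traceless a b⁆ = ∑ c, (y.1 c a • traceless c b - y.1 b c • traceless a c) := by
  apply Subtype.ext
  have h1 : (∑ c, (y.1 c a • traceless c b - y.1 b c • traceless a c)).1 =
      ∑ c, (y.1 c a • (traceless c b).1 - y.1 b c • (traceless a c).1) :=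
    map_sum (SL n).toSubmodule.subtype _ _
  have h2 : (⁅y, traceless a b⁆ : SL n).1 =
      y.1 * Matrix.single a b 1 - Matrix.single a b 1 * y.1 := by
    rw [LieAlgebra.SpecialLinear.sl_bracket]
    simp [traceless, mul_sub, sub_mul]
  rw [h1, h2]
  ext i j
  rw [Matrix.sum_apply]
  simp only [Matrix.sub_apply, Matrix.smul_apply, traceless_apply, smul_eq_mul, mul_sub,
    Finset.sum_sub_distrib, Matrix.mul_apply, Matrix.single_apply]
  simp only [ite_and, mul_ite, ite_mul, mul_one, mul_zero, one_mul, zero_mul, Finset.sum_ite_eq,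
    Finset.sum_ite_eq', Finset.mem_univ, if_true]
  have e1 : ∀ (p : Prop) [Decidable p] (f : Fin n → ℂ),
      (∑ x, if p then f x else 0) = if p then ∑ x, f x else 0 := by
    intro p _ f; split_ifs <;> simp
  simp only [e1, Finset.sum_ite_eq, Finset.sum_ite_eq', Finset.mem_univ, if_true]
  ring

variable {A : Type*} [Ring A] [Algebra ℂ A]

/-- `(f ⊗ g)(Ω)`, multiplied out in the algebra `A`. -/
def casimirOp (f g : SL n →ₗ[ℂ] A) : A :=
  TensorProduct.lift ((LinearMap.mul ℂ A).compl₁₂ f g) (casimir n)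

theorem casimirOp_eq (f g : SL n →ₗ[ℂ] A) :
    casimirOp f g = ∑ a, ∑ b, f (traceless a b) * g (traceless b a) := by
  simp [casimirOp, casimir_eq]

theorem commute_casimirOp (f g : SL n →ₗ[ℂ] A)
    (hf : ∀ x y, f ⁅x, y⁆ = f x * f y - f y * f x) (hg : ∀ x y, g ⁅x, y⁆ = g x * g y - g y * g x)
    (hfg : ∀ x y, f x * g y = g y * f x) (y : SL n) :
    Commute (casimirOp f g) (f y + g y) := by
  have key : (f y + g y) * casimirOp f g - casimirOp f g * (f y + g y) =
      ∑ a, ∑ b, (f ⁅y, traceless a b⁆ * g (traceless b a) +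
        f (traceless a b) * g ⁅y, traceless b a⁆) := by
    rw [casimirOp_eq]
    simp only [Finset.mul_sum, Finset.sum_mul, ← Finset.sum_sub_distrib]
    refine Finset.sum_congr rfl fun a _ => Finset.sum_congr rfl fun b _ => ?_
    rw [hf, hg]
    have e1 := hfg (traceless a b) y
    have e2 := hfg y (traceless b a)
    simp only [add_mul, mul_add, mul_sub, sub_mul, mul_assoc]
    rw [e2]
    simp only [← mul_assoc]
    rw [e1]
    abel
  have h0 : ∑ a, ∑ b, (f ⁅y, traceless a b⁆ * g (traceless b a) +
        f (traceless a b) * g ⁅y, traceless b a⁆) = 0 := by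
    simp only [lie_traceless, map_sum, map_sub, map_smul, Finset.sum_mul, Finset.mul_sum, sub_mul,
      mul_sub, smul_mul_assoc, mul_smul_comm, Finset.sum_add_distrib, Finset.sum_sub_distrib]
    have e1 : ∑ x : Fin n, ∑ x_1 : Fin n, ∑ x_2 : Fin n,
        y.1 x_2 x • (f (traceless x_2 x_1) * g (traceless x_1 x)) =
        ∑ x : Fin n, ∑ x_1 : Fin n, ∑ x_2 : Fin n,
        y.1 x x_2 • (f (traceless x x_1) * g (traceless x_1 x_2)) := by
      rw [Finset.sum_congr rfl fun x _ => Finset.sum_comm, Finset.sum_comm]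
      exact Finset.sum_congr rfl fun x _ => Finset.sum_comm
    have e2 : ∑ x : Fin n, ∑ x_1 : Fin n, ∑ x_2 : Fin n,
        y.1 x_1 x_2 • (f (traceless x x_2) * g (traceless x_1 x)) =
        ∑ x : Fin n, ∑ x_1 : Fin n, ∑ x_2 : Fin n,
        y.1 x_2 x_1 • (f (traceless x x_1) * g (traceless x_2 x)) :=
      Finset.sum_congr rfl fun x _ => Finset.sum_comm
    rw [e1, e2]
    abel
  rw [h0] at key
  exact (sub_eq_zero.mp key).symm

end Casimir


/-! ### The tensor product `X ⊗ V_n^{⊗ l}` and its operators -/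

section Operators

/-- `V_n^{⊗ l}`, where `V_n = ℂ^n`. -/
abbrev TensorPow (n l : ℕ) : Type := ⨂[ℂ] _ : Fin l, (Fin n → ℂ)

variable {n l : ℕ}

/-- The operator on `V_n^{⊗ l}` acting by `A` on the `i`-th component. -/
def slot (i : Fin l) : Module.End ℂ (Fin n → ℂ) →ₗ[ℂ] Module.End ℂ (TensorPow n l) :=
  (PiTensorProduct.mapMultilinear ℂ (fun _ : Fin l => (Fin n → ℂ))
    (fun _ : Fin l => (Fin n → ℂ))).toLinearMap (fun _ => LinearMap.id) i

theorem slot_tprod (i : Fin l) (A : Module.End ℂ (Fin n → ℂ)) (v : Fin l → Fin n → ℂ) :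
    slot i A (PiTensorProduct.tprod ℂ v) =
      PiTensorProduct.tprod ℂ (Function.update v i (A (v i))) := by
  change PiTensorProduct.map (Function.update (fun _ => LinearMap.id) i A)
    (PiTensorProduct.tprod ℂ v) = _
  rw [PiTensorProduct.map_tprod]
  congr 1
  ext1 j
  by_cases h : j = i
  · subst h; simp
  · simp [h]

theorem pow_ext {f g : Module.End ℂ (TensorPow n l)}
    (h : ∀ v, f (PiTensorProduct.tprod ℂ v) = g (PiTensorProduct.tprod ℂ v)) : f = g := by
  refine LinearMap.ext fun t => ?_
  induction t using PiTensorProduct.induction_on with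
  | smul_tprod r v => rw [map_smul, map_smul, h]
  | add a b ha hb => rw [map_add, map_add, ha, hb]

theorem slot_one (i : Fin l) : slot i (1 : Module.End ℂ (Fin n → ℂ)) = 1 := by
  apply pow_ext
  intro v
  simp [slot_tprod]

theorem slot_mul (i : Fin l) (A B : Module.End ℂ (Fin n → ℂ)) :
    slot i (A * B) = slot i A * slot i B := by
  apply pow_ext
  intro v
  simp [slot_tprod]

theorem slot_comm {i j : Fin l} (h : i ≠ j) (A B : Module.End ℂ (Fin n → ℂ)) :
    slot i A * slot j B = slot j B * slot i A := by
  apply pow_ext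
  intro v
  simp [slot_tprod, h, h.symm, Function.update_comm h]

theorem sum_mul_sub_sum_mul {R : Type*} [Ring R] {ι : Type*} [Fintype ι] (a b : ι → R)
    (h : ∀ i j, i ≠ j → a i * b j = b j * a i) :
    (∑ i, a i) * (∑ j, b j) - (∑ j, b j) * (∑ i, a i) = ∑ i, (a i * b i - b i * a i) := by
  classical
  rw [Finset.sum_mul_sum, Finset.sum_mul_sum, Finset.sum_comm (f := fun j i => b j * a i),
    ← Finset.sum_sub_distrib]
  refine Finset.sum_congr rfl fun i _ => ?_
  rw [← Finset.sum_sub_distrib, Finset.sum_eq_single i]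
  · intro j _ hj; rw [h i j hj.symm, sub_self]
  · simp

/-- `sl_n` acts on `V_n^{⊗ l}` by `x (v_1 ⊗ ⋯ ⊗ v_l) = ∑_i v_1 ⊗ ⋯ ⊗ x v_i ⊗ ⋯ ⊗ v_l`. -/
instance : LieRingModule (SL n) (TensorPow n l) where
  bracket x t := (∑ i, slot i (LieModule.toEnd ℂ (SL n) (Fin n → ℂ) x)) t
  add_lie x y t := by simp [Finset.sum_add_distrib]
  lie_add x t t' := map_add _ t t'
  leibniz_lie x y t := by
    have h := sum_mul_sub_sum_mul
      (fun i : Fin l => slot i (LieModule.toEnd ℂ (SL n) (Fin n → ℂ) x))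
      (fun i : Fin l => slot i (LieModule.toEnd ℂ (SL n) (Fin n → ℂ) y))
      (fun i j hij => slot_comm hij _ _)
    have h' : ∑ i : Fin l, slot i (LieModule.toEnd ℂ (SL n) (Fin n → ℂ) ⁅x, y⁆) =
        ∑ i : Fin l, (slot i (LieModule.toEnd ℂ (SL n) (Fin n → ℂ) x) *
          slot i (LieModule.toEnd ℂ (SL n) (Fin n → ℂ) y) -
          slot i (LieModule.toEnd ℂ (SL n) (Fin n → ℂ) y) *
          slot i (LieModule.toEnd ℂ (SL n) (Fin n → ℂ) x)) := by
      refine Finset.sum_congr rfl fun i _ => ?_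
      rw [LieHom.map_lie, LieRing.of_associative_ring_bracket, map_sub, slot_mul, slot_mul]
    rw [h', ← h]
    simp only [LinearMap.sub_apply, Module.End.mul_apply, sub_add_cancel]

theorem lie_tensorPow (x : SL n) (t : TensorPow n l) :
    ⁅x, t⁆ = (∑ i, slot i (LieModule.toEnd ℂ (SL n) (Fin n → ℂ) x)) t := rfl

instance : LieModule ℂ (SL n) (TensorPow n l) where
  smul_lie c x t := by
    simp only [lie_tensorPow, map_smul, ← Finset.smul_sum, LinearMap.smul_apply]
  lie_smul c x t := by simp only [lie_tensorPow, map_smul]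

variable (X : Type*) [AddCommGroup X] [Module ℂ X]

/-- The operator on `X ⊗ V_n^{⊗ l}` acting by `A` on the `i`-th component of `V_n^{⊗ l}`. -/
def slotX (i : Fin l) : Module.End ℂ (Fin n → ℂ) →ₗ[ℂ] Module.End ℂ (X ⊗[ℂ] TensorPow n l) :=
  (LinearMap.lTensorHom X).comp (slot i)

/-- `π_i(x)` for `i = 1, …, l`: the action of `x ∈ sl_n` on the `i`-th component of
`V_n^{⊗ l}`. -/
def actV (i : Fin l) : SL n →ₗ[ℂ] Module.End ℂ (X ⊗[ℂ] TensorPow n l) :=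
  (slotX X i).comp (LieModule.toEnd ℂ (SL n) (Fin n → ℂ) : SL n →ₗ[ℂ] _)

/-- The action of `w ∈ W_l` on `X ⊗ V_n^{⊗ l}` by permutation of the components of
`V_n^{⊗ l}`. -/
def permAct : Equiv.Perm (Fin l) →* Module.End ℂ (X ⊗[ℂ] TensorPow n l) where
  toFun σ := LinearMap.lTensor X
    (PiTensorProduct.reindex ℂ (fun _ : Fin l => (Fin n → ℂ)) σ).toLinearMap
  map_one' := by
    apply TensorProduct.ext'
    intro x t
    induction t using PiTensorProduct.induction_on with
    | smul_tprod r v =>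
      simp [PiTensorProduct.reindex_tprod]
      rfl
    | add a b ha hb => rw [TensorProduct.tmul_add, map_add, map_add, ha, hb]
  map_mul' σ τ := by
    apply TensorProduct.ext'
    intro x t
    induction t using PiTensorProduct.induction_on with
    | smul_tprod r v =>
      simp [PiTensorProduct.reindex_tprod]
      rfl
    | add a b ha hb => rw [TensorProduct.tmul_add, map_add, map_add, ha, hb]

theorem op_ext {f g : Module.End ℂ (X ⊗[ℂ] TensorPow n l)}
    (h : ∀ x v, f (x ⊗ₜ[ℂ] PiTensorProduct.tprod ℂ v) = g (x ⊗ₜ[ℂ] PiTensorProduct.tprod ℂ v)) :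
    f = g := by
  apply TensorProduct.ext'
  intro x t
  induction t using PiTensorProduct.induction_on with
  | smul_tprod r v => rw [TensorProduct.tmul_smul, map_smul, map_smul, h]
  | add a b ha hb => rw [TensorProduct.tmul_add, map_add, map_add, ha, hb]

theorem slotX_tmul (i : Fin l) (A : Module.End ℂ (Fin n → ℂ)) (x : X) (v : Fin l → Fin n → ℂ) :
    slotX X i A (x ⊗ₜ[ℂ] PiTensorProduct.tprod ℂ v) =
      x ⊗ₜ[ℂ] PiTensorProduct.tprod ℂ (Function.update v i (A (v i))) := by
  change x ⊗ₜ[ℂ] (slot i A (PiTensorProduct.tprod ℂ v)) = _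
  rw [slot_tprod]

theorem permAct_tmul (σ : Equiv.Perm (Fin l)) (x : X) (v : Fin l → Fin n → ℂ) :
    permAct X σ (x ⊗ₜ[ℂ] PiTensorProduct.tprod ℂ v) =
      x ⊗ₜ[ℂ] PiTensorProduct.tprod ℂ (fun i => v (σ.symm i)) := by
  change x ⊗ₜ[ℂ] (PiTensorProduct.reindex ℂ (fun _ : Fin l => (Fin n → ℂ)) σ
    (PiTensorProduct.tprod ℂ v)) = _
  rw [PiTensorProduct.reindex_tprod]

theorem slotX_comm {i j : Fin l} (h : i ≠ j) (A B : Module.End ℂ (Fin n → ℂ)) :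
    slotX X i A * slotX X j B = slotX X j B * slotX X i A := by
  apply op_ext
  intro x v
  simp [slotX_tmul, h, h.symm, Function.update_comm h]

theorem permAct_slotX (σ : Equiv.Perm (Fin l)) (i : Fin l) (A : Module.End ℂ (Fin n → ℂ)) :
    permAct X σ * slotX X i A = slotX X (σ i) A * permAct X σ := by
  apply op_ext
  intro x v
  simp only [Module.End.mul_apply, slotX_tmul, permAct_tmul, Equiv.symm_apply_apply]
  congr 2
  ext1 j
  by_cases h : j = σ i
  · subst h; simp
  · have h' : σ.symm j ≠ i := by rintro rfl; simp at h
    simp [h, h']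

theorem actV_comm {i j : Fin l} (h : i ≠ j) (x y : SL n) :
    actV X i x * actV X j y = actV X j y * actV X i x := slotX_comm X h _ _

theorem permAct_actV (σ : Equiv.Perm (Fin l)) (i : Fin l) (x : SL n) :
    permAct X σ * actV X i x = actV X (σ i) x * permAct X σ := permAct_slotX X σ i _

theorem actV_lie (i : Fin l) (x y : SL n) :
    actV X i ⁅x, y⁆ = actV X i x * actV X i y - actV X i y * actV X i x := by
  change slotX X i (LieModule.toEnd ℂ (SL n) (Fin n → ℂ) ⁅x, y⁆) = _
  rw [LieHom.map_lie, LieRing.of_associative_ring_bracket, map_sub]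
  congr 1 <;>
  · apply op_ext
    intro x v
    simp [slotX_tmul, actV]

/-- `Ω_{ij} + 1/n` acts on `X ⊗ V_n^{⊗ l}` as the transposition of the components `i` and `j`. -/
theorem casimirOp_actV [NeZero n] {i j : Fin l} (h : i ≠ j) :
    casimirOp (actV X i) (actV X j) + algebraMap ℂ (Module.End ℂ (X ⊗[ℂ] TensorPow n l)) (1 / n) =
      permAct X (Equiv.swap i j) := by
  have hn : (n : ℂ) ≠ 0 := by exact_mod_cast NeZero.ne n
  let E : Fin n → Fin n → Module.End ℂ (Fin n → ℂ) := fun a b => Matrix.toLin' (Matrix.single a b 1)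
  have hT : ∀ k : Fin l, ∀ a b : Fin n, actV X k (traceless a b) =
      slotX X k (E a b) - (if a = b then (1 / n : ℂ) else 0) • 1 := by
    intro k a b
    apply op_ext
    intro x v
    have : LieModule.toEnd ℂ (SL n) (Fin n → ℂ) (traceless a b) (v k) =
        E a b (v k) - (if a = b then (1 / n : ℂ) else 0) • v k := by
      change (traceless a b).1.mulVec (v k) = _
      simp only [traceless, Matrix.sub_mulVec, Matrix.smul_mulVec, Matrix.one_mulVec, E,
        Matrix.toLin'_apply]
    simp only [actV, LinearMap.comp_apply, LieHom.coe_toLinearMap, slotX_tmul, this,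
      LinearMap.sub_apply, LinearMap.smul_apply, Module.End.one_apply,
      MultilinearMap.map_update_sub, MultilinearMap.map_update_smul, Function.update_eq_self,
      TensorProduct.tmul_sub, TensorProduct.tmul_smul]
  have hE : ∀ k : Fin l, ∑ a : Fin n, slotX X k (E a a) = 1 := by
    intro k
    rw [← map_sum]
    have : ∑ a, E a a = 1 := by
      have h1 : ∑ a : Fin n, Matrix.single a a (1 : ℂ) = (1 : Matrix (Fin n) (Fin n) ℂ) := by
        ext p q
        rw [Matrix.sum_apply]
        simp only [Matrix.single_apply, Matrix.one_apply]
        by_cases h : p = q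
        · subst h; simp
        · have : ∀ a, ¬ (a = p ∧ a = q) := by rintro a ⟨rfl, rfl⟩; exact h rfl
          simp [h, this]
      simp only [E]
      rw [← map_sum, h1, Matrix.toLin'_one]
      rfl
    rw [this]
    apply op_ext
    intro x v
    simp [slotX_tmul]
  have hS : ∑ a : Fin n, ∑ b : Fin n, slotX X i (E a b) * slotX X j (E b a) =
      permAct X (Equiv.swap i j) := by
    apply op_ext
    intro x v
    have hEv : ∀ (a b : Fin n) (u : Fin n → ℂ), E a b u = u b • Pi.single a (1 : ℂ) := by
      intro a b u
      ext c
      simp only [E, Matrix.toLin'_apply, Matrix.mulVec, dotProduct, Matrix.single_apply,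
        Pi.smul_apply, smul_eq_mul, Pi.single_apply]
      by_cases hc : c = a
      · subst hc; simp
      · simp [hc, Ne.symm hc]
    have hu : ∀ u : Fin n → ℂ, ∑ a, u a • Pi.single a (1 : ℂ) = u := by
      intro u
      ext c
      simp [Finset.sum_apply, Pi.single_apply]
    let M : (Fin n → ℂ) →ₗ[ℂ] (Fin n → ℂ) →ₗ[ℂ] (X ⊗[ℂ] TensorPow n l) :=
      LinearMap.mk₂ ℂ (fun p q => x ⊗ₜ[ℂ] PiTensorProduct.tprod ℂ
          (Function.update (Function.update v j q) i p))
        (fun p p' q => by rw [MultilinearMap.map_update_add, TensorProduct.tmul_add])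
        (fun c p q => by rw [MultilinearMap.map_update_smul, TensorProduct.tmul_smul])
        (fun p q q' => by
          simp only [Function.update_comm h.symm]
          rw [MultilinearMap.map_update_add, TensorProduct.tmul_add])
        (fun c p q => by
          simp only [Function.update_comm h.symm]
          rw [MultilinearMap.map_update_smul, TensorProduct.tmul_smul])
    have hM : ∀ a b, (slotX X i (E a b) * slotX X j (E b a)) (x ⊗ₜ[ℂ] PiTensorProduct.tprod ℂ v) =
        M (v j a • Pi.single a (1 : ℂ)) (v i b • Pi.single b (1 : ℂ)) := by
      intro a b
      have h0 : (slotX X i (E a b) * slotX X j (E b a)) (x ⊗ₜ[ℂ] PiTensorProduct.tprod ℂ v) =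
          M (v i b • Pi.single a (1 : ℂ)) (v j a • Pi.single b (1 : ℂ)) := by
        rw [Module.End.mul_apply, slotX_tmul, slotX_tmul, Function.update_of_ne h, hEv, hEv]
        rfl
      rw [h0]
      simp only [map_smul, LinearMap.smul_apply]
      rw [smul_comm]
    have hsw : permAct X (Equiv.swap i j) (x ⊗ₜ[ℂ] PiTensorProduct.tprod ℂ v) =
        M (v j) (v i) := by
      rw [permAct_tmul]
      change _ = x ⊗ₜ[ℂ] PiTensorProduct.tprod ℂ
          (Function.update (Function.update v j (v i)) i (v j))
      congr 2
      ext1 k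
      rw [Equiv.symm_swap]
      by_cases hk : k = i
      · subst hk; simp
      · by_cases hk' : k = j
        · subst hk'; simp [h.symm]
        · simp [hk, hk', Equiv.swap_apply_of_ne_of_ne hk hk']
    simp only [LinearMap.sum_apply]
    have h5 : M (v j) (v i) = ∑ a, ∑ b, M (v j a • Pi.single a 1) (v i b • Pi.single b 1) := by
      have h6 : M (v j) = ∑ a, M (v j a • Pi.single a 1) := by rw [← map_sum, hu]
      rw [h6, LinearMap.sum_apply]
      refine Finset.sum_congr rfl fun a _ => ?_
      rw [← map_sum, hu]
    rw [hsw, h5]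
    exact Finset.sum_congr rfl fun a _ => Finset.sum_congr rfl fun b _ => hM a b
  rw [casimirOp_eq]
  have hexp : ∀ a b : Fin n, actV X i (traceless a b) * actV X j (traceless b a) =
      slotX X i (E a b) * slotX X j (E b a) -
        (if a = b then (1 / n : ℂ) • (slotX X i (E a a) + slotX X j (E a a)) else 0) +
        (if a = b then ((1 / n : ℂ) * (1 / n)) • 1 else 0) := by
    intro a b
    rw [hT, hT]
    by_cases hab : a = b
    · subst hab
      simp only [if_true, sub_mul, mul_sub, smul_mul_assoc, mul_smul_comm, one_mul, mul_one,
        smul_add]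
      module
    · simp [hab, Ne.symm hab]
  simp only [hexp, Finset.sum_add_distrib, Finset.sum_sub_distrib, Finset.sum_ite_eq,
    Finset.mem_univ, if_true, ← Finset.smul_sum, hE, hS]
  rw [Algebra.algebraMap_eq_smul_one, Finset.sum_const, Finset.card_univ, Fintype.card_fin,
    ← Nat.cast_smul_eq_nsmul ℂ, smul_smul]
  have e : (1 / n * (1 / n)) * (n : ℂ) = 1 / n := by field_simp
  rw [e]
  module

/-- The image of `ε_i^∨` under the evaluation homomorphism, acting on `X ⊗ V_n^{⊗ l}`. -/
def jmOp (i : Fin l) : Module.End ℂ (X ⊗[ℂ] TensorPow n l) :=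
  ∑ j ∈ Finset.univ.filter (fun j : Fin l => j < i), permAct X (Equiv.swap j i)

theorem permAct_jmOp (σ : Equiv.Perm (Fin l)) (i : Fin l) :
    permAct X σ * (jmOp X i : Module.End ℂ (X ⊗[ℂ] TensorPow n l)) =
      (∑ j ∈ Finset.univ.filter (fun j : Fin l => j < i), permAct X (Equiv.swap (σ j) (σ i))) *
        permAct X σ := by
  simp only [jmOp, Finset.mul_sum, Finset.sum_mul]
  refine Finset.sum_congr rfl fun j _ => ?_
  rw [← map_mul, ← map_mul, Equiv.mul_swap_eq_swap_mul]

theorem jmOp_comm_of_lt {i j : Fin l} (h : i < j) :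
    Commute (jmOp X i : Module.End ℂ (X ⊗[ℂ] TensorPow n l)) (jmOp X j) := by
  refine Commute.sum_left _ _ _ fun k hk => ?_
  have hk' := (Finset.mem_filter.mp hk).2
  have h1 := permAct_jmOp X (n := n) (Equiv.swap k i) j
  rw [Equiv.swap_apply_of_ne_of_ne (hk'.trans h).ne' h.ne'] at h1
  refine h1.trans ?_
  congr 1
  rw [jmOp]
  refine Finset.sum_equiv (Equiv.swap k i) ?_ ?_
  · intro x
    simp only [Finset.mem_filter, Finset.mem_univ, true_and]
    by_cases e1 : x = k
    · subst e1; simp [h, hk'.trans h]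
    · by_cases e2 : x = i
      · subst e2; simp [h, hk'.trans h]
      · rw [Equiv.swap_apply_of_ne_of_ne e1 e2]
  · intro x _; rfl

theorem jmOp_succ {i i' : Fin l} (h : (i' : ℕ) = i + 1) :
    (jmOp X i' : Module.End ℂ (X ⊗[ℂ] TensorPow n l)) =
      (∑ j ∈ Finset.univ.filter (fun j : Fin l => j < i), permAct X (Equiv.swap j i')) +
        permAct X (Equiv.swap i i') := by
  have hs : Finset.univ.filter (fun j : Fin l => j < i') =
      insert i (Finset.univ.filter (fun j : Fin l => j < i)) := by
    ext x
    simp only [Finset.mem_filter, Finset.mem_univ, true_and, Finset.mem_insert, Fin.lt_def,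
      Fin.ext_iff]
    omega
  rw [jmOp, hs, Finset.sum_insert (by simp), add_comm]

variable [LieRingModule (SL n) X] [LieModule ℂ (SL n) X]

/-- `π_0(x)`: the action of `x ∈ sl_n` on the factor `X` of `X ⊗ V_n^{⊗ l}`. -/
def actX : SL n →ₗ[ℂ] Module.End ℂ (X ⊗[ℂ] TensorPow n l) :=
  (LinearMap.rTensorHom (TensorPow n l)).comp (LieModule.toEnd ℂ (SL n) X : SL n →ₗ[ℂ] _)

theorem actX_lie (x y : SL n) :
    (actX X ⁅x, y⁆ : Module.End ℂ (X ⊗[ℂ] TensorPow n l)) =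
      actX X x * actX X y - actX X y * actX X x := by
  apply op_ext
  intro x v
  simp [actX, TensorProduct.sub_tmul]

theorem actX_actV (i : Fin l) (x y : SL n) :
    actX X x * actV X i y = actV X i y * actX X x := by
  apply op_ext
  intro x v
  simp [actX, actV, slotX_tmul]

theorem permAct_actX (σ : Equiv.Perm (Fin l)) (x : SL n) :
    permAct X σ * actX X x = actX X x * permAct X σ := by
  apply op_ext
  intro x v
  simp [actX, permAct_tmul]

theorem toEnd_eq (x : SL n) :
    LieModule.toEnd ℂ (SL n) (X ⊗[ℂ] TensorPow n l) x = actX X x + ∑ i, actV X i x := by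
  apply op_ext
  intro y v
  simp only [LieModule.toEnd_apply_apply, TensorProduct.LieModule.lie_tmul_right, lie_tensorPow,
    LinearMap.add_apply, LinearMap.sum_apply, actX, actV, LinearMap.comp_apply,
    LieHom.coe_toLinearMap, slotX_tmul, slot_tprod, TensorProduct.tmul_sum,
    LinearMap.coe_rTensorHom, LinearMap.rTensor_tmul]

/-- `Ω_{0i}` on `X ⊗ V_n^{⊗ l}`. -/
def omegaX (i : Fin l) : Module.End ℂ (X ⊗[ℂ] TensorPow n l) := casimirOp (actX X) (actV X i)

/-- The operator `y_i = Ω_{0i} + ∑_{j < i} (Ω_{ji} + 1/n) + (n-1)/2` on `X ⊗ V_n^{⊗ l}`. -/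
def yOp (i : Fin l) : Module.End ℂ (X ⊗[ℂ] TensorPow n l) :=
  omegaX X i +
    ∑ j ∈ Finset.univ.filter (fun j : Fin l => j < i),
      (casimirOp (actV X j) (actV X i) + algebraMap ℂ _ (1 / n)) +
    algebraMap ℂ _ ((n - 1) / 2)

theorem yOp_eq [NeZero n] (i : Fin l) :
    yOp X i = omegaX X i + jmOp X i +
      algebraMap ℂ (Module.End ℂ (X ⊗[ℂ] TensorPow n l)) ((n - 1) / 2) := by
  rw [yOp, jmOp]
  congr 2
  refine Finset.sum_congr rfl fun j hj => ?_
  rw [casimirOp_actV X (Finset.mem_filter.mp hj).2.ne]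

theorem permAct_omegaX (σ : Equiv.Perm (Fin l)) (i : Fin l) :
    permAct X σ * (omegaX X i : Module.End ℂ (X ⊗[ℂ] TensorPow n l)) =
      omegaX X (σ i) * permAct X σ := by
  simp only [omegaX, casimirOp_eq, Finset.mul_sum, Finset.sum_mul]
  refine Finset.sum_congr rfl fun a _ => Finset.sum_congr rfl fun b _ => ?_
  rw [← mul_assoc, permAct_actX, mul_assoc, permAct_actV, mul_assoc]

/-- Infinitesimal braid relation. -/
theorem omegaX_comm [NeZero n] {i j : Fin l} (h : i ≠ j) :
    Commute (omegaX X i : Module.End ℂ (X ⊗[ℂ] TensorPow n l))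
      (omegaX X j + permAct X (Equiv.swap i j)) := by
  rw [← casimirOp_actV X h, ← add_assoc]
  refine Commute.add_right ?_ (Algebra.commutes _ _).symm
  have h1 : (omegaX X j + casimirOp (actV X i) (actV X j) :
      Module.End ℂ (X ⊗[ℂ] TensorPow n l)) =
      ∑ a, ∑ b, (actX X (traceless a b) + actV X i (traceless a b)) * actV X j (traceless b a) := by
    simp only [omegaX, casimirOp_eq, ← Finset.sum_add_distrib, add_mul]
  rw [h1]
  refine Commute.sum_right _ _ _ fun a _ => Commute.sum_right _ _ _ fun b _ => ?_
  refine Commute.mul_right (commute_casimirOp _ _ (actX_lie X) (actV_lie X i) (actX_actV X i) _) ?_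
  rw [omegaX, casimirOp_eq]
  refine Commute.sum_left _ _ _ fun a' _ => Commute.sum_left _ _ _ fun b' _ => ?_
  exact Commute.mul_left (actX_actV X j _ _) (actV_comm X h _ _)

theorem omegaX_jmOp_of_lt {i j : Fin l} (h : i < j) :
    Commute (omegaX X j : Module.End ℂ (X ⊗[ℂ] TensorPow n l)) (jmOp X i) := by
  refine Commute.sum_right _ _ _ fun k hk => ?_
  have hk' := (Finset.mem_filter.mp hk).2
  have := permAct_omegaX X (n := n) (Equiv.swap k i) j
  rw [Equiv.swap_apply_of_ne_of_ne (hk'.trans h).ne' h.ne'] at this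
  exact this.symm

theorem yOp_comm_of_lt [NeZero n] {i j : Fin l} (h : i < j) :
    Commute (yOp X i : Module.End ℂ (X ⊗[ℂ] TensorPow n l)) (yOp X j) := by
  rw [yOp_eq, yOp_eq]
  refine Commute.add_left (Commute.add_right ?_ (Algebra.commutes _ _).symm) (Algebra.commutes _ _)
  refine Commute.add_left ?_ ?_
  · have hi : i ∈ Finset.univ.filter (fun k : Fin l => k < j) := by simp [h]
    rw [jmOp, ← Finset.add_sum_erase _ _ hi, ← add_assoc]
    refine Commute.add_right (omegaX_comm X h.ne) ?_
    refine Commute.sum_right _ _ _ fun k hk => ?_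
    have hk1 := Finset.ne_of_mem_erase hk
    have := permAct_omegaX X (n := n) (Equiv.swap k j) i
    rw [Equiv.swap_apply_of_ne_of_ne hk1.symm h.ne] at this
    exact this.symm
  · exact Commute.add_right (omegaX_jmOp_of_lt X h).symm (jmOp_comm_of_lt X h)

theorem yOp_comm [NeZero n] (i j : Fin l) :
    (yOp X i * yOp X j : Module.End ℂ (X ⊗[ℂ] TensorPow n l)) = yOp X j * yOp X i := by
  rcases lt_trichotomy i j with h | h | h
  · exact yOp_comm_of_lt X h
  · rw [h]
  · exact (yOp_comm_of_lt X h).symm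

theorem yOp_cross [NeZero n] (i i' : Fin l) (h : (i' : ℕ) = i + 1) (j : Fin l) :
    permAct X (Equiv.swap i i') * yOp X j - yOp X (Equiv.swap i i' j) * permAct X (Equiv.swap i i') =
      algebraMap ℂ (Module.End ℂ (X ⊗[ℂ] TensorPow n l)) (-rootCoeff i i' j) := by
  have hlt : i < i' := by rw [Fin.lt_def]; omega
  set s := Equiv.swap i i' with hs
  have hss : permAct X s * permAct X s = (1 : Module.End ℂ (X ⊗[ℂ] TensorPow n l)) := by
    rw [← map_mul, hs, Equiv.swap_mul_self, map_one]
  have hred : permAct X s * yOp X j - yOp X (s j) * permAct X s =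
      permAct X s * jmOp X j - jmOp X (s j) * (permAct X s : Module.End ℂ (X ⊗[ℂ] TensorPow n l)) := by
    rw [yOp_eq, yOp_eq]
    simp only [mul_add, add_mul]
    rw [permAct_omegaX, Algebra.commutes]
    abel
  have hfix : ∀ x : Fin l, x < i → s x = x := fun x hx =>
    Equiv.swap_apply_of_ne_of_ne hx.ne (hx.trans hlt).ne
  have hA : permAct X s * jmOp X i =
      (jmOp X i' - permAct X s) * (permAct X s : Module.End ℂ (X ⊗[ℂ] TensorPow n l)) := by
    rw [permAct_jmOp, jmOp_succ X h, add_sub_cancel_right]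
    congr 1
    refine Finset.sum_congr rfl fun x hx => ?_
    rw [hfix x (Finset.mem_filter.mp hx).2, hs, Equiv.swap_apply_left]
  rw [hred]
  by_cases h1 : j = i
  · subst h1
    have e : s j = i' := Equiv.swap_apply_left _ _
    rw [e, hA, sub_mul, hss]
    simp [rootCoeff, hlt.ne]
  · by_cases h2 : j = i'
    · subst h2
      have e : s j = i := Equiv.swap_apply_right _ _
      have hB : jmOp X i * permAct X s =
          permAct X s * (jmOp X j - permAct X s : Module.End ℂ (X ⊗[ℂ] TensorPow n l)) := by
        calc jmOp X i * permAct X s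
            = permAct X s * (permAct X s * jmOp X i) * permAct X s := by
              rw [← mul_assoc, hss, one_mul]
          _ = permAct X s * (jmOp X j - permAct X s) * (permAct X s * permAct X s) := by
              rw [hA]; simp only [mul_assoc]
          _ = _ := by rw [hss, mul_one]
      rw [e, hB, mul_sub, hss]
      simp [rootCoeff, h1]
    · have e : s j = j := Equiv.swap_apply_of_ne_of_ne h1 h2
      rw [permAct_jmOp, e]
      have : (∑ k ∈ Finset.univ.filter (fun k : Fin l => k < j), permAct X (Equiv.swap (s k) j) :
          Module.End ℂ (X ⊗[ℂ] TensorPow n l)) = jmOp X j := by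
        rw [jmOp]
        refine Finset.sum_equiv s ?_ fun _ _ => rfl
        intro x
        simp only [Finset.mem_filter, Finset.mem_univ, true_and]
        have hj1 : (j : ℕ) ≠ i := fun e => h1 (Fin.ext e)
        have hj2 : (j : ℕ) ≠ i' := fun e => h2 (Fin.ext e)
        by_cases e1 : x = i
        · rw [e1, hs, Equiv.swap_apply_left, Fin.lt_def, Fin.lt_def]; omega
        · by_cases e2 : x = i'
          · rw [e2, hs, Equiv.swap_apply_right, Fin.lt_def, Fin.lt_def]; omega
          · rw [hs, Equiv.swap_apply_of_ne_of_ne e1 e2]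
      rw [this, sub_self]
      simp [rootCoeff, h1, h2]

/-- The homomorphism `H_l → End(X ⊗ V_n^{⊗ l})` with `ε_i^∨ ↦ y_i` and `w ↦ w`. -/
def heckeRep [NeZero n] : Hecke l →ₐ[ℂ] Module.End ℂ (X ⊗[ℂ] TensorPow n l) :=
  Hecke.lift (permAct X) (yOp X) (yOp_comm X) (yOp_cross X)

theorem permAct_comm_toEnd (σ : Equiv.Perm (Fin l)) (x : SL n) :
    Commute (permAct X σ) (LieModule.toEnd ℂ (SL n) (X ⊗[ℂ] TensorPow n l) x) := by
  rw [toEnd_eq]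
  refine Commute.add_right (permAct_actX X σ x) ?_
  rw [commute_iff_eq, Finset.mul_sum, Finset.sum_mul]
  exact Finset.sum_equiv σ (by simp) (fun i _ => permAct_actV X σ i x)

theorem omegaX_comm_toEnd (i : Fin l) (x : SL n) :
    Commute (omegaX X i) (LieModule.toEnd ℂ (SL n) (X ⊗[ℂ] TensorPow n l) x) := by
  rw [toEnd_eq, ← Finset.add_sum_erase _ _ (Finset.mem_univ i), ← add_assoc]
  refine Commute.add_right
    (commute_casimirOp _ _ (actX_lie X) (actV_lie X i) (actX_actV X i) _) ?_
  refine Commute.sum_right _ _ _ fun j hj => ?_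
  have hj' := Finset.ne_of_mem_erase hj
  rw [omegaX, casimirOp_eq]
  refine Commute.sum_left _ _ _ fun a' _ => Commute.sum_left _ _ _ fun b' _ => ?_
  exact Commute.mul_left (actX_actV X j _ _) (actV_comm X hj'.symm _ _)

/-- The action of `H_l` commutes with that of `sl_n`. -/
theorem heckeRep_comm_toEnd [NeZero n] (a : Hecke l) (x : SL n) :
    Commute (heckeRep X a) (LieModule.toEnd ℂ (SL n) (X ⊗[ℂ] TensorPow n l) x) := by
  have ha : a ∈ Algebra.adjoin ℂ (Set.range (Hecke.w (l := l)) ∪ Set.range (Hecke.eps (l := l))) := by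
    rw [Hecke.adjoin_eq_top]; trivial
  induction ha using Algebra.adjoin_induction with
  | mem a ha =>
    rcases ha with ⟨σ, rfl⟩ | ⟨i, rfl⟩
    · rw [heckeRep, Hecke.lift_w]
      exact permAct_comm_toEnd X σ x
    · rw [heckeRep, Hecke.lift_eps, yOp_eq]
      refine Commute.add_left (Commute.add_left (omegaX_comm_toEnd X i x) ?_) (Algebra.commutes _ _)
      exact Commute.sum_left _ _ _ fun j _ => permAct_comm_toEnd X _ x
  | algebraMap r => rw [AlgHom.commutes]; exact Algebra.commutes _ _
  | add a b _ _ ha hb => rw [map_add]; exact ha.add_left hb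
  | mul a b _ _ ha hb => rw [map_mul]; exact ha.mul_left hb

end Operators

/-! ### The functor `F_lam` -/

theorem lie_cartan_nMinus {n : ℕ} {h x : SL n} (hh : h ∈ cartan n) (hx : x ∈ nMinus n) :
    ⁅h, x⁆ ∈ nMinus n := by
  intro i j hij
  rw [LieAlgebra.SpecialLinear.sl_bracket, Matrix.sub_apply, Matrix.mul_apply, Matrix.mul_apply]
  rw [Finset.sum_eq_zero, Finset.sum_eq_zero, sub_zero]
  · intro k _
    by_cases hk : k = j
    · subst hk; rw [hx i k hij, zero_mul]
    · rw [hh k j hk, mul_zero]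
  · intro k _
    by_cases hk : i = k
    · subst hk; rw [hx i j hij, mul_zero]
    · rw [hh i k hk, zero_mul]

/-- `X ⊗ V_n^{⊗ l}`, as an `sl_n`-module and as an `H_l`-module. -/
def MixedTensor (n l : ℕ) (X : Type*) [AddCommGroup X] [Module ℂ X] : Type _ :=
  X ⊗[ℂ] TensorPow n l

section MixedTensor

variable {n l : ℕ} (X : Type*) [AddCommGroup X] [Module ℂ X] [LieRingModule (SL n) X]
  [LieModule ℂ (SL n) X]

instance : AddCommGroup (MixedTensor n l X) := inferInstanceAs (AddCommGroup (X ⊗[ℂ] TensorPow n l))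

instance : Module ℂ (MixedTensor n l X) := inferInstanceAs (Module ℂ (X ⊗[ℂ] TensorPow n l))

instance : LieRingModule (SL n) (MixedTensor n l X) :=
  inferInstanceAs (LieRingModule (SL n) (X ⊗[ℂ] TensorPow n l))

instance : LieModule ℂ (SL n) (MixedTensor n l X) :=
  inferInstanceAs (LieModule ℂ (SL n) (X ⊗[ℂ] TensorPow n l))

variable [NeZero n]

instance : Module (Hecke l) (MixedTensor n l X) :=
  Module.compHom (X ⊗[ℂ] TensorPow n l) (heckeRep (n := n) (l := l) X).toRingHom

theorem hecke_smul_def (a : Hecke l) (t : X ⊗[ℂ] TensorPow n l) :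
    (a • (show MixedTensor n l X from t) : MixedTensor n l X) = heckeRep (n := n) (l := l) X a t := rfl

instance : IsScalarTower ℂ (Hecke l) (MixedTensor n l X) where
  smul_assoc c a t := by
    change heckeRep (n := n) (l := l) X (c • a) t = c • heckeRep (n := n) (l := l) X a t
    rw [map_smul]; rfl

theorem lie_hecke_smul (x : SL n) (a : Hecke l) (t : MixedTensor n l X) :
    ⁅x, a • t⁆ = a • ⁅x, t⁆ :=
  (LinearMap.congr_fun (heckeRep_comm_toEnd X a x).eq t).symm

/-- The subspace `n_- (X ⊗ V_n^{⊗ l})`. -/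
def nMinusSpan (n l : ℕ) [NeZero n] (X : Type*) [AddCommGroup X] [Module ℂ X]
    [LieRingModule (SL n) X] [LieModule ℂ (SL n) X] : Submodule (Hecke l) (MixedTensor n l X) where
  carrier := Submodule.span ℂ {t : MixedTensor n l X | ∃ x ∈ nMinus n, ∃ t', t = ⁅x, t'⁆}
  add_mem' := add_mem
  zero_mem' := zero_mem _
  smul_mem' a t ht := by
    refine Submodule.span_induction (p := fun t _ => a • t ∈
      Submodule.span ℂ {t : MixedTensor n l X | ∃ x ∈ nMinus n, ∃ t', t = ⁅x, t'⁆}) ?_ ?_ ?_ ?_ ht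
    · rintro _ ⟨x, hx, t', rfl⟩
      rw [← lie_hecke_smul]
      exact Submodule.subset_span ⟨x, hx, _, rfl⟩
    · rw [smul_zero]; exact zero_mem _
    · intro x y _ _ hx hy; rw [smul_add]; exact add_mem hx hy
    · intro c x _ hx; rw [smul_algebra_smul_comm]; exact Submodule.smul_mem _ c hx

/-- `H_0(n_-, X ⊗ V_n^{⊗ l})`. -/
abbrev H0 (n l : ℕ) [NeZero n] (X : Type*) [AddCommGroup X] [Module ℂ X]
    [LieRingModule (SL n) X] [LieModule ℂ (SL n) X] : Type _ :=
  MixedTensor n l X ⧸ nMinusSpan n l X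

/-- The action of an element `h` of the Cartan subalgebra on `H_0(n_-, X ⊗ V_n^{⊗ l})`. -/
def cartanAct (h : cartan n) : H0 n l X →ₗ[Hecke l] H0 n l X :=
  (nMinusSpan n l X).mapQ (nMinusSpan n l X)
    { toFun := fun t => ⁅(h : SL n), t⁆
      map_add' := lie_add _
      map_smul' := fun a t => lie_hecke_smul X _ a t } (by
      intro t ht
      change ⁅(h : SL n), t⁆ ∈
        Submodule.span ℂ {t : MixedTensor n l X | ∃ x ∈ nMinus n, ∃ t', t = ⁅x, t'⁆}
      refine Submodule.span_induction (p := fun t _ => ⁅(h : SL n), t⁆ ∈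
        Submodule.span ℂ {t : MixedTensor n l X | ∃ x ∈ nMinus n, ∃ t', t = ⁅x, t'⁆})
        ?_ ?_ ?_ ?_ ht
      · rintro _ ⟨x, hx, t', rfl⟩
        rw [leibniz_lie]
        exact add_mem (Submodule.subset_span ⟨_, lie_cartan_nMinus h.2 hx, _, rfl⟩)
          (Submodule.subset_span ⟨_, hx, _, rfl⟩)
      · rw [lie_zero]; exact zero_mem _
      · intro x y _ _ hx hy; rw [lie_add]; exact add_mem hx hy
      · intro c x _ hx; rw [lie_smul]; exact Submodule.smul_mem _ c hx)

/-- `F_lam(X) = H_0(n_-, X ⊗ V_n^{⊗ l})_lam`, the weight space of weight `lam`, as an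
`H_l`-module. -/
def FunctorF (l : ℕ) (lam : CartanDual n) (X : Type*) [AddCommGroup X] [Module ℂ X]
    [LieRingModule (SL n) X] [LieModule ℂ (SL n) X] : Submodule (Hecke l) (H0 n l X) where
  carrier := {q | ∀ h : cartan n, cartanAct X h q = pairing lam h.1 • q}
  add_mem' hp hq h := by rw [map_add, hp h, hq h, smul_add]
  zero_mem' h := by rw [map_zero, smul_zero]
  smul_mem' a q hq h := by rw [map_smul, hq h, smul_algebra_smul_comm]

end MixedTensor


/-! ### The modules `M(lam, mu)` -/

section StandardModule

variable {n l : ℕ}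

theorem lie_basis (h : SL n) (hh : h ∈ cartan n) (p : Fin l → Fin n) :
    ⁅h, (PiTensorProduct.tprod ℂ (fun i => Pi.single (p i) (1 : ℂ)) : TensorPow n l)⁆ =
      (∑ i, h.1 (p i) (p i)) •
        (PiTensorProduct.tprod ℂ (fun i => Pi.single (p i) (1 : ℂ)) : TensorPow n l) := by
  rw [lie_tensorPow, LinearMap.sum_apply, Finset.sum_smul]
  refine Finset.sum_congr rfl fun i _ => ?_
  have h1 : LieModule.toEnd ℂ (SL n) (Fin n → ℂ) h (Pi.single (p i) (1 : ℂ)) =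
      h.1 (p i) (p i) • Pi.single (p i) (1 : ℂ) := by
    change h.1.mulVec (Pi.single (p i) (1 : ℂ)) = _
    ext c
    rw [Matrix.mulVec_single_one, Pi.smul_apply, smul_eq_mul, Pi.single_apply]
    by_cases hc : c = p i
    · subst hc; simp
    · simp [hc, hh c (p i) hc]
  rw [slot_tprod, h1, MultilinearMap.map_update_smul, Function.update_eq_self]

theorem exists_lengths [NeZero n] {nu : CartanDual n} (h : nu ∈ weights (TensorPow n l)) :
    ∃ L : Fin n → ℕ, ∑ i, L i = l ∧ ∃ c : ℂ, ∀ i, nu.1 i = L i + c := by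
  obtain ⟨v, hv, hw⟩ := h
  let B := Basis.piTensorProduct (fun _ : Fin l => Pi.basisFun ℂ (Fin n))
  have hB : ∀ p, B p = PiTensorProduct.tprod ℂ (fun i => Pi.single (p i) (1 : ℂ)) := by
    intro p
    simp [B, Basis.piTensorProduct_apply]
  obtain ⟨p, hp⟩ : ∃ p, B.repr v p ≠ 0 := by
    by_contra! hc
    apply hv
    apply B.repr.injective
    rw [map_zero]
    ext p
    exact hc p
  have key : ∀ x ∈ cartan n, ∑ i, x.1 (p i) (p i) = pairing nu x := by
    intro x hx
    have h1 : B.repr ⁅x, v⁆ p = (∑ i, x.1 (p i) (p i)) * B.repr v p := by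
      have h2 : (Finsupp.lapply p ∘ₗ B.repr.toLinearMap) ∘ₗ
          (LieModule.toEnd ℂ (SL n) (TensorPow n l) x) =
          (∑ i, x.1 (p i) (p i)) • (Finsupp.lapply p ∘ₗ B.repr.toLinearMap) := by
        apply B.ext
        intro q
        simp only [LinearMap.comp_apply, LieModule.toEnd_apply_apply, LinearMap.smul_apply]
        rw [hB q, lie_basis x hx q, ← hB q]
        by_cases hq : q = p
        · subst hq; simp
        · simp [hq]
      exact LinearMap.congr_fun h2 v
    rw [hw x hx, map_smul, Finsupp.smul_apply, smul_eq_mul] at h1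
    exact (mul_right_cancel₀ hp h1).symm
  let L : Fin n → ℕ := fun a => (Finset.univ.filter fun i => p i = a).card
  have hL : ∀ f : Fin n → ℂ, ∑ i, f (p i) = ∑ a, (L a : ℂ) * f a := by
    intro f
    rw [← Finset.sum_fiberwise Finset.univ p (fun i => f (p i))]
    refine Finset.sum_congr rfl fun a _ => ?_
    rw [Finset.sum_congr rfl (g := fun _ => f a) (by
      intro i hi; rw [(Finset.mem_filter.mp hi).2]), Finset.sum_const, nsmul_eq_mul]
  refine ⟨L, ?_, nu.1 0 - L 0, fun a => ?_⟩
  · have := hL (fun _ => 1)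
    simp only [Finset.sum_const, Finset.card_univ, Fintype.card_fin, nsmul_eq_mul, mul_one] at this
    exact_mod_cast this.symm
  · let x : SL n := traceless a a - traceless 0 0
    have hx' : ∀ i j, x.1 i j = (if a = i ∧ a = j then 1 else 0) -
        (if (0 : Fin n) = i ∧ (0 : Fin n) = j then 1 else 0) := by
      intro i j
      change (traceless a a).1 i j - (traceless 0 0).1 i j = _
      simp only [traceless_apply, true_and]
      ring
    have hx : x ∈ cartan n := by
      intro i j hij
      rw [hx', if_neg, if_neg, sub_zero]
      · rintro ⟨rfl, h⟩; exact hij h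
      · rintro ⟨rfl, h⟩; exact hij h
    have h3 := key x hx
    rw [hL (fun b => x.1 b b), pairing] at h3
    simp only [hx', and_self, mul_sub, mul_ite, mul_one, mul_zero, Finset.sum_sub_distrib,
      Finset.sum_ite_eq, Finset.mem_univ, if_true] at h3
    linear_combination -h3

/-- For `lam - mu ∈ P(V_n^{⊗ l})`, the nonnegative integers `(l_1, …, l_n)` with
`l = l_1 + ⋯ + l_n` and `lam - mu ≡ ∑_i l_i ε_i mod ℂ(ε_1 + ⋯ + ε_n)`. -/
def lengths [NeZero n] {lam mu : CartanDual n} (h : lam - mu ∈ weights (TensorPow n l)) :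
    Fin n → ℕ := (exists_lengths h).choose

theorem lengths_sum [NeZero n] {lam mu : CartanDual n}
    (h : lam - mu ∈ weights (TensorPow n l)) : ∑ i, lengths h i = l :=
  (exists_lengths h).choose_spec.1

theorem lengths_spec [NeZero n] {lam mu : CartanDual n}
    (h : lam - mu ∈ weights (TensorPow n l)) :
    ∃ c : ℂ, ∀ i, lam.1 i - mu.1 i = lengths h i + c :=
  (exists_lengths h).choose_spec.2

theorem lengths_unique [NeZero n] {lam mu : CartanDual n}
    (h : lam - mu ∈ weights (TensorPow n l)) (L : Fin n → ℕ) (hL : ∑ i, L i = l)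
    (hc : ∃ c : ℂ, ∀ i, lam.1 i - mu.1 i = L i + c) : L = lengths h := by
  obtain ⟨c, hc⟩ := hc
  obtain ⟨d, hd⟩ := lengths_spec h
  have hn : (n : ℂ) ≠ 0 := by exact_mod_cast NeZero.ne n
  have h1 : ∀ i, (L i : ℂ) + c = lengths h i + d := fun i => (hc i).symm.trans (hd i)
  have h2 : ∑ i, ((L i : ℂ) + c) = ∑ i, ((lengths h i : ℂ) + d) :=
    Finset.sum_congr rfl fun i _ => h1 i
  rw [Finset.sum_add_distrib, Finset.sum_add_distrib, ← Nat.cast_sum, ← Nat.cast_sum, hL,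
    lengths_sum] at h2
  simp only [Finset.sum_const, Finset.card_univ, Fintype.card_fin, nsmul_eq_mul,
    add_right_inj] at h2
  have hcd := mul_left_cancel₀ hn h2
  ext i
  have := h1 i
  rw [hcd] at this
  exact_mod_cast add_right_cancel this

/-- The sequence of segments `Δ_{lam,mu} = ([mu_1', mu_1' + l_1 - 1], …, [mu_n', mu_n' + l_n - 1])`
with `mu_i' = ⟨mu + rho, ε_i^∨⟩`. -/
def segments [NeZero n] {lam mu : CartanDual n} (h : lam - mu ∈ weights (TensorPow n l)) :
    Fin n → Segment :=
  fun i => ⟨(mu + rho n).1 i, lengths h i⟩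

/-- The `H_l`-module `M(lam, mu) = M(Δ_{lam,mu})`. -/
abbrev StandardModule [NeZero n] {lam mu : CartanDual n}
    (h : lam - mu ∈ weights (TensorPow n l)) : Type :=
  SegmentModule (segments h) (lengths_sum h)

end StandardModule

end

end ArakawaSuzuki

open ArakawaSuzuki

/-! Write v for the highest weight vector of M(mu). Since M(mu) is generated freely by v over
U(n_-), the n_- -coinvariants of M(mu) ⊗ T are a copy of T, through t ↦ [v ⊗ t]. Only two
consequences of freeness are used: M(mu) = U(n_-) v, which makes this map surjective, and the
existence of an n_- -equivariant map M(mu) → U(n_-) with v ↦ 1, which makes it injective. Both come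
from an explicit action of sl_n on U(n_-) (`Verma.indRep`). Comparing weights, F_lam(M(mu)) is the
weight space of weight lam - mu of V_n^{⊗ l} (`weightEquiv`); it vanishes if lam - mu is not a
weight, which is part 2.

On this model H_l acts on words: permutations permute the letters, and ε_i^∨ acts by `wordOp`
(`eps_smul_hwv`), a diagonal term from mu + rho plus two sums of transpositions. On the sorted word
1^{l_1} 2^{l_2} ⋯ the two sums cancel except for transpositions of equal letters, so this word is a
joint eigenvector. Its eigenvalues are those of the segments, and it is fixed by the Young subgroup.
It therefore defines a homomorphism from the induced module. The homomorphism is onto because all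
words of the same content are permutations of the sorted one, and injective because the induced
module is spanned by the classes of w, which depend only on the coset of w modulo the Young
subgroup. This is part 1 (`nonempty_functorF_equiv`).

Part 3 rests on a general principle (`existsUnique_isSimpleModule_quotient`): if a cyclic joint
eigenvector u is the only one of its character up to scalars, then no proper submodule meets the
generalized eigenspace of u, so a sum of two proper submodules is still proper. Uniqueness of the
eigenvector is `coeff_eq_zero_of_eigen`, an induction on the length of words. Its hypothesis
concerns the right ends (mu + rho)_a + l_a, which equal (lam + rho)_a up to a common constant: they
must decrease by nonnegative integers, which is dominance of lam + rho, and where two of them agree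
the lengths must increase.

The condition on lengths is arranged by replacing mu with a weight in its dot-orbit under the
stabilizer of lam + rho. A singular vector gives a homomorphism M(mu) → M(s_α · mu); on coinvariants
it becomes, up to sign, a power of f_α between two weight spaces of V_n^{⊗ l} exchanged by s_α, and
sl_2-theory makes it bijective (`nonempty_functorF_equiv_reflect`). -/

namespace ArakawaSuzuki

noncomputable section

/-! ### A triangular decomposition without the Poincaré–Birkhoff–Witt theorem -/

section Envelope

variable {R L : Type*} [CommRing R] [LieRing L] [LieAlgebra R L]

/-- Only left multiplication by single elements of L has to be treated, which suits operators on
U(L) that are known through their commutation with left multiplications. -/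
theorem envelope_induction {P : UniversalEnvelopingAlgebra R L → Prop}
    (one : P 1) (add : ∀ a b, P a → P b → P (a + b)) (smul : ∀ (r : R) a, P a → P (r • a))
    (mul : ∀ x a, P a → P (UniversalEnvelopingAlgebra.ι R x * a))
    (u : UniversalEnvelopingAlgebra R L) : P u := by
  have hs : Function.Surjective (UniversalEnvelopingAlgebra.mkAlgHom R L) := by
    intro u
    obtain ⟨t, rfl⟩ := RingCon.mk'_surjective (c := UniversalEnvelopingAlgebra.ringCon R L) u
    exact ⟨t, rfl⟩
  have key : ∀ (t : TensorAlgebra R L) (a : UniversalEnvelopingAlgebra R L), P a →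
      P (UniversalEnvelopingAlgebra.mkAlgHom R L t * a) := by
    intro t
    induction t using TensorAlgebra.induction with
    | algebraMap r =>
      intro a ha
      rw [AlgHom.commutes, ← Algebra.smul_def]
      exact smul r a ha
    | ι x => exact fun a ha => mul x a ha
    | mul s t hs ht =>
      intro a ha
      rw [map_mul, mul_assoc]
      exact hs _ (ht _ ha)
    | add s t hs ht =>
      intro a ha
      rw [map_add, add_mul]
      exact add _ _ (hs _ ha) (ht _ ha)
  obtain ⟨t, rfl⟩ := hs u
  simpa using key t 1 one

variable (N : LieSubalgebra R L)

/-- The action of `N` on `Hom(L, U(N))`. -/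
def homAct : N →ₗ⁅R⁆ Module.End R (L →ₗ[R] UniversalEnvelopingAlgebra R N) where
  toFun y :=
    { toFun := fun f => (LinearMap.mulLeft R (UniversalEnvelopingAlgebra.ι R y)).comp f -
        f.comp (LieAlgebra.ad R L y : L →ₗ[R] L)
      map_add' := fun f g => by ext x; simp [mul_add]; abel
      map_smul' := fun c f => by ext x; simp [smul_sub] }
  map_add' y z := by ext f x; simp [add_mul]; abel
  map_smul' c y := by ext f x; simp [smul_sub]
  map_lie' {y z} := by
    ext f x
    simp [LieRing.of_associative_ring_bracket, mul_sub, sub_mul, mul_assoc]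
    abel

variable (f₀ : L →ₗ[R] UniversalEnvelopingAlgebra R N)

/-- The operator by which `x` acts on `U(N)`, when `f₀ x` is the image of `1`. -/
def indOp (x : L) : Module.End R (UniversalEnvelopingAlgebra R N) :=
  (LinearMap.applyₗ x) ∘ₗ (LinearMap.applyₗ f₀) ∘ₗ
    (UniversalEnvelopingAlgebra.lift R (homAct N)).toLinearMap

theorem indOp_one (x : L) : indOp N f₀ x 1 = f₀ x := by
  simp [indOp]

/-- This is the rule x y = y x + [x, y]. It is built in by letting U(N) act on Hom(L, U(N)) and
defining x · u as the value at x of u · f₀. -/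
theorem indOp_mul (x : L) (y : N) (u : UniversalEnvelopingAlgebra R N) :
    indOp N f₀ x (UniversalEnvelopingAlgebra.ι R y * u) =
      UniversalEnvelopingAlgebra.ι R y * indOp N f₀ x u + indOp N f₀ ⁅x, (y : L)⁆ u := by
  have h : UniversalEnvelopingAlgebra.lift R (homAct N) (UniversalEnvelopingAlgebra.ι R y) =
    homAct N y := UniversalEnvelopingAlgebra.lift_ι_apply R _ y
  simp only [indOp, LinearMap.comp_apply, AlgHom.toLinearMap_apply, map_mul, h]
  have e : ⁅x, (y : L)⁆ = -⁅(y : L), x⁆ := (lie_skew _ _).symm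
  rw [e, map_neg, LinearMap.neg_apply, ← sub_eq_add_neg]
  rfl

theorem indOp_add (x y : L) : indOp N f₀ (x + y) = indOp N f₀ x + indOp N f₀ y := by
  ext u; simp [indOp]

theorem indOp_sub (x y : L) : indOp N f₀ (x - y) = indOp N f₀ x - indOp N f₀ y := by
  ext u; simp [indOp]

theorem indOp_smul (c : R) (x : L) : indOp N f₀ (c • x) = c • indOp N f₀ x := by
  ext u; simp [indOp]

/-- Both sides satisfy the same recursion for u ↦ z u and agree at 1, so N acts by left
multiplication. -/
theorem indOp_sub_algebra (h₀ : ∀ y : N, f₀ y = UniversalEnvelopingAlgebra.ι R y) (y : N)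
    (u : UniversalEnvelopingAlgebra R N) :
    indOp N f₀ y u = UniversalEnvelopingAlgebra.ι R y * u := by
  induction u using envelope_induction generalizing y with
  | one => rw [indOp_one, h₀, mul_one]
  | add a b ha hb => rw [map_add, ha, hb, mul_add]
  | smul r a ha => rw [map_smul, ha, mul_smul_comm]
  | mul z a ha =>
    have : (⁅(y : L), (z : L)⁆) = ((⁅y, z⁆ : N) : L) := rfl
    rw [indOp_mul, ha, this, ha, LieHom.map_lie, LieRing.of_associative_ring_bracket]
    noncomm_ring

/-- The operators form the representation of L induced from the character chi of B. The recursion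
`indOp_mul` and the Jacobi identity carry the bracket relation from u to y u, so only u = 1 is left.
There B acts by scalars, which commute, and chi vanishes on brackets. -/
theorem indOp_lie (B : Submodule R L) (chi : L → R)
    (hB : ∀ x ∈ B, ∀ y ∈ B, ⁅x, y⁆ ∈ B ∧ chi ⁅x, y⁆ = 0)
    (hNB : ∀ x : L, ∃ y : N, ∃ b ∈ B, x = y + b)
    (h₀ : ∀ y : N, f₀ y = UniversalEnvelopingAlgebra.ι R y)
    (h₁ : ∀ b ∈ B, f₀ b = algebraMap R _ (chi b)) (x x' : L)
    (u : UniversalEnvelopingAlgebra R N) :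
    indOp N f₀ ⁅x, x'⁆ u = indOp N f₀ x (indOp N f₀ x' u) - indOp N f₀ x' (indOp N f₀ x u) := by
  have hN := indOp_sub_algebra N f₀ h₀
  have hmix : ∀ (x : L) (y : N) (u : UniversalEnvelopingAlgebra R N),
      indOp N f₀ ⁅x, (y : L)⁆ u =
        indOp N f₀ x (indOp N f₀ y u) - indOp N f₀ y (indOp N f₀ x u) := by
    intro x y u
    rw [hN, hN, indOp_mul]
    abel
  -- Since L = N + B and brackets with N are covered by `hmix`, it suffices to treat pairs from B.
  have red : ∀ u : UniversalEnvelopingAlgebra R N, (∀ b ∈ B, ∀ b' ∈ B, indOp N f₀ ⁅b, b'⁆ u =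
      indOp N f₀ b (indOp N f₀ b' u) - indOp N f₀ b' (indOp N f₀ b u)) →
      ∀ x x', indOp N f₀ ⁅x, x'⁆ u =
        indOp N f₀ x (indOp N f₀ x' u) - indOp N f₀ x' (indOp N f₀ x u) := by
    intro u h x x'
    obtain ⟨y, b, hb, rfl⟩ := hNB x
    obtain ⟨y', b', hb', rfl⟩ := hNB x'
    have e : ⁅(y : L), b'⁆ = -⁅b', (y : L)⁆ := (lie_skew _ _).symm
    have e0 : (⁅(y : L) + b, (y' : L) + b'⁆) =
        ⁅(y : L), (y' : L)⁆ - ⁅b', (y : L)⁆ + ⁅b, (y' : L)⁆ + ⁅b, b'⁆ := by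
      rw [add_lie, lie_add, lie_add, e]; abel
    rw [e0]
    simp only [indOp_add, indOp_sub, LinearMap.add_apply, LinearMap.sub_apply, map_add, hmix,
      h b hb b' hb']
    abel
  induction u using envelope_induction generalizing x x' with
  | one =>
    apply red
    intro b hb b' hb'
    have hs : ∀ (c : L) (r : R), indOp N f₀ c (algebraMap R _ r) = r • f₀ c := by
      intro c r
      rw [Algebra.algebraMap_eq_smul_one, map_smul, indOp_one]
    rw [indOp_one, indOp_one, indOp_one, h₁ _ (hB b hb b' hb').1, (hB b hb b' hb').2, h₁ b hb,
      h₁ b' hb', hs, hs, h₁ b hb, h₁ b' hb', Algebra.smul_def, Algebra.smul_def, ← map_mul,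
      ← map_mul, mul_comm, sub_self, map_zero]
  | add a b ha hb => simp only [map_add, ha, hb]; abel
  | smul r a ha => simp only [map_smul, ha, smul_sub]
  | mul y a ha =>
    have jac : ⁅⁅x, x'⁆, (y : L)⁆ = ⁅x, ⁅x', (y : L)⁆⁆ - ⁅x', ⁅x, (y : L)⁆⁆ := lie_lie _ _ _
    simp only [indOp_mul, map_add, jac, indOp_sub, LinearMap.sub_apply, ha, mul_sub]
    abel

end Envelope

/-! ### The triangular decomposition of `sl_n` -/

section Triangular

variable {n : ℕ}

theorem SL_lie_apply (x y : SL n) (i j : Fin n) :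
    (⁅x, y⁆ : SL n).1 i j = ∑ k, x.1 i k * y.1 k j - ∑ k, y.1 i k * x.1 k j := by
  rw [LieAlgebra.SpecialLinear.sl_bracket, Matrix.sub_apply, Matrix.mul_apply, Matrix.mul_apply]

/-- The Lie subalgebra of strictly lower triangular matrices. -/
def nMinusLie (n : ℕ) : LieSubalgebra ℂ (SL n) where
  __ := nMinus n
  lie_mem' {x y} hx hy := by
    intro i j hij
    rw [SL_lie_apply, Finset.sum_eq_zero, Finset.sum_eq_zero, sub_zero]
    · intro k _
      rcases le_or_gt i k with h | h
      · rw [hy i k h, zero_mul]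
      · rw [hx k j (h.le.trans hij), mul_zero]
    · intro k _
      rcases le_or_gt i k with h | h
      · rw [hx i k h, zero_mul]
      · rw [hy k j (h.le.trans hij), mul_zero]

/-- The upper triangular matrices. -/
def borel (n : ℕ) : Submodule ℂ (SL n) where
  carrier := {x | ∀ i j, j < i → x.1 i j = 0}
  add_mem' hx hy i j h := by simp [hx i j h, hy i j h]
  zero_mem' := by simp
  smul_mem' c x hx i j h := by simp [hx i j h]

/-- The projection of `sl_n` onto `n_-` along the upper triangular matrices. -/
def lowerPart : SL n →ₗ[ℂ] nMinusLie n where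
  toFun x := ⟨⟨Matrix.of fun i j => if j < i then x.1 i j else 0, by
    rw [mem_SL, Matrix.trace]; simp⟩, by
    intro i j h
    simp [h.not_gt]⟩
  map_add' x y := by
    apply Subtype.ext; apply Subtype.ext; ext i j
    change (if j < i then x.1 i j + y.1 i j else 0) =
      (if j < i then x.1 i j else 0) + (if j < i then y.1 i j else 0)
    split_ifs <;> simp
  map_smul' c x := by
    apply Subtype.ext; apply Subtype.ext; ext i j
    change (if j < i then c * x.1 i j else 0) = c * (if j < i then x.1 i j else 0)
    split_ifs <;> simp

theorem lowerPart_apply (x : SL n) (i j : Fin n) :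
    (lowerPart x : SL n).1 i j = if j < i then x.1 i j else 0 := rfl

theorem lowerPart_nMinus (y : nMinusLie n) : lowerPart (y : SL n) = y := by
  apply Subtype.ext; apply Subtype.ext; ext i j
  rw [lowerPart_apply]
  split_ifs with h
  · rfl
  · exact (y.2 i j (not_lt.mp h)).symm

theorem lowerPart_borel {b : SL n} (hb : b ∈ borel n) : lowerPart b = 0 := by
  apply Subtype.ext; apply Subtype.ext; ext i j
  rw [lowerPart_apply]
  split_ifs with h
  · exact hb i j h
  · rfl

theorem sub_lowerPart_mem (x : SL n) : x - (lowerPart x : SL n) ∈ borel n := by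
  intro i j h
  change x.1 i j - (lowerPart x : SL n).1 i j = 0
  rw [lowerPart_apply, if_pos h, sub_self]

theorem exists_nMinus_add_borel (x : SL n) : ∃ y : nMinusLie n, ∃ b ∈ borel n, x = y + b :=
  ⟨lowerPart x, _, sub_lowerPart_mem x, by abel⟩

/-- The pairing with a weight, as a linear form on all of `sl_n`. -/
def pairingHom (mu : CartanDual n) : SL n →ₗ[ℂ] ℂ where
  toFun := pairing mu
  map_add' x y := by
    change ∑ i, mu.1 i * (x.1 i i + y.1 i i) = _
    simp only [pairing, mul_add, Finset.sum_add_distrib]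
  map_smul' c x := by
    change ∑ i, mu.1 i * (c * x.1 i i) = c * ∑ i, mu.1 i * x.1 i i
    rw [Finset.mul_sum]
    exact Finset.sum_congr rfl fun i _ => by ring

theorem pairing_nMinus (mu : CartanDual n) (y : nMinusLie n) : pairing mu (y : SL n) = 0 :=
  Finset.sum_eq_zero fun i _ => by rw [y.2 i i le_rfl, mul_zero]

theorem pairing_nPlus (mu : CartanDual n) {x : SL n} (hx : x ∈ nPlus n) : pairing mu x = 0 :=
  Finset.sum_eq_zero fun i _ => by rw [hx i i le_rfl, mul_zero]

theorem cartan_le_borel : cartan n ≤ borel n := fun _ hx i j h => hx i j h.ne'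

theorem nPlus_le_borel : nPlus n ≤ borel n := fun _ hx i j h => hx i j h.le

/-- The diagonal of a product of upper triangular matrices is the product of the diagonals, so
commutators have zero diagonal and mu extends to a character of the Borel subalgebra. -/
theorem lie_borel (mu : CartanDual n) {x y : SL n} (hx : x ∈ borel n) (hy : y ∈ borel n) :
    ⁅x, y⁆ ∈ borel n ∧ pairing mu ⁅x, y⁆ = 0 := by
  constructor
  · intro i j hij
    rw [SL_lie_apply, Finset.sum_eq_zero, Finset.sum_eq_zero, sub_zero]
    · intro k _
      rcases lt_or_ge k i with h | h
      · rw [hy i k h, zero_mul]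
      · rw [hx k j (hij.trans_le h), mul_zero]
    · intro k _
      rcases lt_or_ge k i with h | h
      · rw [hx i k h, zero_mul]
      · rw [hy k j (hij.trans_le h), mul_zero]
  · refine Finset.sum_eq_zero fun i _ => ?_
    rw [SL_lie_apply, Finset.sum_eq_single i, Finset.sum_eq_single i, mul_comm (x.1 i i), sub_self,
      mul_zero]
    · intro k _ hk
      rcases lt_or_gt_of_ne hk with h | h
      · rw [hy i k h, zero_mul]
      · rw [hx k i h, mul_zero]
    · simp
    · intro k _ hk
      rcases lt_or_gt_of_ne hk with h | h
      · rw [hx i k h, zero_mul]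
      · rw [hy k i h, mul_zero]
    · simp

/-- Taking the diagonal part of an upper triangular matrix preserves the trace, so the splitting
into diagonal and strictly upper parts stays inside sl_n. Highest weight vectors can then be
described by a single condition on `borel n`. -/
theorem borel_lie_of_nPlus_of_cartan {n : ℕ} {X : Type*} [AddCommGroup X] [Module ℂ X]
    [LieRingModule (SL n) X] {mu : CartanDual n} {x : X} (hplus : ∀ y ∈ nPlus n, ⁅y, x⁆ = 0)
    (hcartan : ∀ h ∈ cartan n, ⁅h, x⁆ = pairing mu h • x) {b : SL n} (hb : b ∈ borel n) :
    ⁅b, x⁆ = pairing mu b • x := by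
  let h : SL n := ⟨Matrix.of fun i j => if i = j then b.1 i j else 0, by
    have := b.2
    rw [mem_SL, Matrix.trace] at this ⊢
    simpa using this⟩
  have h_apply : ∀ i j, h.1 i j = if i = j then b.1 i j else 0 := fun _ _ => rfl
  have hh : h ∈ cartan n := fun i j hij => by rw [h_apply, if_neg hij]
  have hx : b - h ∈ nPlus n := by
    intro i j hij
    change b.1 i j - h.1 i j = 0
    rw [h_apply]
    split_ifs with e
    · exact sub_self _
    · rw [hb i j (lt_of_le_of_ne hij (Ne.symm e)), sub_zero]
  have hp : pairing mu b = pairing mu h :=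
    Finset.sum_congr rfl fun i _ => by rw [h_apply, if_pos rfl]
  calc ⁅b, x⁆ = ⁅b - h, x⁆ + ⁅h, x⁆ := by rw [sub_lie, sub_add_cancel]
    _ = _ := by rw [hplus _ hx, hcartan h hh, zero_add, hp]

end Triangular

/-! ### Highest weight vectors and Verma modules -/

namespace Verma

variable {n : ℕ} (mu : CartanDual n)

/-- The canonical generator of `M(mu)`. -/
def hwv : Verma mu :=
  Submodule.Quotient.mk (p := vermaIdeal mu) (1 : UniversalEnvelopingAlgebra ℂ (SL n))

theorem smul_hwv (u : UniversalEnvelopingAlgebra ℂ (SL n)) :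
    u • hwv mu = Submodule.Quotient.mk (p := vermaIdeal mu) u := by
  change Submodule.Quotient.mk (p := vermaIdeal mu) (u • 1) = _
  rw [smul_eq_mul, mul_one]

theorem ι_smul (x : SL n) (m : Verma mu) : UniversalEnvelopingAlgebra.ι ℂ x • m = ⁅x, m⁆ := rfl

theorem induction {P : Verma mu → Prop} (one : P (hwv mu)) (add : ∀ a b, P a → P b → P (a + b))
    (smul : ∀ (r : ℂ) a, P a → P (r • a)) (lie : ∀ (x : SL n) a, P a → P ⁅x, a⁆)
    (m : Verma mu) : P m := by
  obtain ⟨u, rfl⟩ := Submodule.Quotient.mk_surjective (vermaIdeal mu) m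
  rw [← smul_hwv]
  induction u using envelope_induction with
  | one => rwa [one_smul]
  | add a b ha hb => rw [add_smul]; exact add _ _ ha hb
  | smul r a ha => rw [smul_assoc]; exact smul _ _ ha
  | mul x a ha => rw [mul_smul]; exact lie _ _ ha

theorem nPlus_lie_hwv {x : SL n} (hx : x ∈ nPlus n) : ⁅x, hwv mu⁆ = 0 := by
  rw [← ι_smul, smul_hwv]
  exact (Submodule.Quotient.mk_eq_zero _).mpr (Submodule.subset_span (Or.inl ⟨x, hx, rfl⟩))

theorem cartan_lie_hwv {h : SL n} (hh : h ∈ cartan n) :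
    ⁅h, hwv mu⁆ = pairing mu h • hwv mu := by
  rw [← sub_eq_zero, ← ι_smul, ← algebraMap_smul (UniversalEnvelopingAlgebra ℂ (SL n)), ← sub_smul,
    smul_hwv]
  exact (Submodule.Quotient.mk_eq_zero _).mpr (Submodule.subset_span (Or.inr ⟨h, hh, rfl⟩))

theorem borel_lie_hwv {b : SL n} (hb : b ∈ borel n) : ⁅b, hwv mu⁆ = pairing mu b • hwv mu :=
  borel_lie_of_nPlus_of_cartan (fun _ => nPlus_lie_hwv mu) (fun _ => cartan_lie_hwv mu) hb

variable {X : Type*} [AddCommGroup X] [Module ℂ X]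

/-- The universal property of `M(mu)`, for a representation given by a homomorphism. -/
def liftRep (ρ : SL n →ₗ⁅ℂ⁆ Module.End ℂ X) (x : X)
    (hx : ∀ b ∈ borel n, ρ b x = pairing mu b • x) : Verma mu →ₗ[ℂ] X :=
  ((vermaIdeal mu).restrictScalars ℂ).liftQ
    ((LinearMap.applyₗ x) ∘ₗ (UniversalEnvelopingAlgebra.lift ℂ ρ).toLinearMap) (by
      intro u hu
      change UniversalEnvelopingAlgebra.lift ℂ ρ u x = 0
      refine Submodule.span_induction (p := fun u _ => UniversalEnvelopingAlgebra.lift ℂ ρ u x = 0)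
        ?_ ?_ ?_ ?_ hu
      · rintro _ (⟨y, hy, rfl⟩ | ⟨h, hh, rfl⟩)
        · rw [UniversalEnvelopingAlgebra.lift_ι_apply, hx y (nPlus_le_borel hy),
            pairing_nPlus mu hy, zero_smul]
        · rw [map_sub, UniversalEnvelopingAlgebra.lift_ι_apply, AlgHom.commutes,
            LinearMap.sub_apply, hx h (cartan_le_borel hh), Module.algebraMap_end_apply, sub_self]
      · rw [map_zero, LinearMap.zero_apply]
      · intro a b _ _ ha hb; rw [map_add, LinearMap.add_apply, ha, hb, add_zero]
      · intro a b _ hb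
        rw [smul_eq_mul, map_mul, Module.End.mul_apply, hb, map_zero])

section liftRep

variable (ρ : SL n →ₗ⁅ℂ⁆ Module.End ℂ X) (x : X) (hx : ∀ b ∈ borel n, ρ b x = pairing mu b • x)

theorem liftRep_mk (u : UniversalEnvelopingAlgebra ℂ (SL n)) :
    liftRep mu ρ x hx (Submodule.Quotient.mk (p := vermaIdeal mu) u) =
      UniversalEnvelopingAlgebra.lift ℂ ρ u x := rfl

theorem liftRep_hwv : liftRep mu ρ x hx (hwv mu) = x := by
  rw [hwv, liftRep_mk, map_one, Module.End.one_apply]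

theorem liftRep_lie (y : SL n) (m : Verma mu) :
    liftRep mu ρ x hx ⁅y, m⁆ = ρ y (liftRep mu ρ x hx m) := by
  obtain ⟨u, rfl⟩ := Submodule.Quotient.mk_surjective (vermaIdeal mu) m
  change liftRep mu ρ x hx (Submodule.Quotient.mk (p := vermaIdeal mu)
    (UniversalEnvelopingAlgebra.ι ℂ y * u)) = _
  rw [liftRep_mk, liftRep_mk, map_mul, UniversalEnvelopingAlgebra.lift_ι_apply,
    Module.End.mul_apply]

end liftRep

/-- The value on `1` of the action of `sl_n` on `U(n_-)`. -/
def indStart : SL n →ₗ[ℂ] UniversalEnvelopingAlgebra ℂ (nMinusLie n) :=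
  (UniversalEnvelopingAlgebra.ι ℂ :
    nMinusLie n →ₗ⁅ℂ⁆ UniversalEnvelopingAlgebra ℂ (nMinusLie n)).toLinearMap.comp lowerPart +
    (Algebra.linearMap ℂ _).comp (pairingHom mu)

theorem indStart_apply (x : SL n) : indStart mu x =
    UniversalEnvelopingAlgebra.ι ℂ (lowerPart x) + algebraMap ℂ _ (pairing mu x) := rfl

theorem indStart_nMinus (y : nMinusLie n) :
    indStart mu y = UniversalEnvelopingAlgebra.ι ℂ y := by
  rw [indStart_apply, lowerPart_nMinus, pairing_nMinus, map_zero, add_zero]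

theorem indStart_borel {b : SL n} (hb : b ∈ borel n) :
    indStart mu b = algebraMap ℂ _ (pairing mu b) := by
  rw [indStart_apply, lowerPart_borel hb, map_zero, zero_add]

/-- The action of `sl_n` on `U(n_-)` for which `1` is a highest weight vector of weight `mu`. -/
def indRep : SL n →ₗ⁅ℂ⁆ Module.End ℂ (UniversalEnvelopingAlgebra ℂ (nMinusLie n)) where
  toFun := indOp (nMinusLie n) (indStart mu)
  map_add' := indOp_add _ _
  map_smul' := indOp_smul _ _
  map_lie' {x y} := by
    ext u
    rw [LieRing.of_associative_ring_bracket]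
    exact indOp_lie _ _ (borel n) (pairing mu) (fun x hx y hy => lie_borel mu hx hy)
      exists_nMinus_add_borel (indStart_nMinus mu) (fun b hb => indStart_borel mu hb) x y u

/-- The isomorphism `M(mu) ≃ U(n_-)`, as a linear map. -/
def toLower : Verma mu →ₗ[ℂ] UniversalEnvelopingAlgebra ℂ (nMinusLie n) :=
  liftRep mu (indRep mu) 1 (by
    intro b hb
    change indOp _ _ b 1 = _
    rw [indOp_one, indStart_borel mu hb, Algebra.algebraMap_eq_smul_one])

theorem toLower_hwv : toLower mu (hwv mu) = 1 := liftRep_hwv _ _ _ _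

theorem toLower_lie (y : nMinusLie n) (m : Verma mu) :
    toLower mu ⁅(y : SL n), m⁆ = UniversalEnvelopingAlgebra.ι ℂ y * toLower mu m := by
  rw [toLower, liftRep_lie]
  exact indOp_sub_algebra _ _ (indStart_nMinus mu) y _

/-- `M(mu) = U(n_-) v`. -/
theorem lower_induction {P : Verma mu → Prop} (one : P (hwv mu))
    (add : ∀ a b, P a → P b → P (a + b)) (smul : ∀ (r : ℂ) a, P a → P (r • a))
    (lie : ∀ y ∈ nMinus n, ∀ a, P a → P ⁅y, a⁆) (m : Verma mu) : P m := by
  -- The map u ↦ u v. Its image contains v and is visibly stable under n_-; the point is stability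
  -- under all of sl_n.
  let η : UniversalEnvelopingAlgebra ℂ (nMinusLie n) →ₗ[ℂ] Verma mu :=
    (LinearMap.applyₗ (hwv mu)) ∘ₗ (UniversalEnvelopingAlgebra.lift ℂ
      ((LieModule.toEnd ℂ (SL n) (Verma mu)).comp (nMinusLie n).incl)).toLinearMap
  have η_one : η 1 = hwv mu := by simp [η]
  have η_mul : ∀ (y : nMinusLie n) u, η (UniversalEnvelopingAlgebra.ι ℂ y * u) =
      ⁅(y : SL n), η u⁆ := by
    intro y u
    simp only [η, LinearMap.comp_apply, AlgHom.toLinearMap_apply]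
    rw [map_mul, UniversalEnvelopingAlgebra.lift_ι_apply]
    rfl
  -- The action on U(n_-) obeys the same rules as the action on U(n_-) v, so η intertwines them and
  -- its image is an sl_n-submodule containing the generator.
  have η_lie : ∀ u x, η (indRep mu x u) = ⁅x, η u⁆ := by
    intro u
    change ∀ x, η (indOp _ _ x u) = _
    induction u using envelope_induction with
    | one =>
      intro x
      have h1 := η_mul (lowerPart x) 1
      rw [mul_one, η_one] at h1
      have h2 : pairing mu (x - (lowerPart x : SL n)) = pairing mu x := by
        have := map_sub (pairingHom mu) x (lowerPart x)
        change pairing mu _ = pairing mu x - pairing mu _ at this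
        rw [this, pairing_nMinus, sub_zero]
      have h3 := borel_lie_hwv mu (sub_lowerPart_mem x)
      rw [h2, sub_lie, sub_eq_iff_eq_add'] at h3
      rw [indOp_one, indStart_apply, map_add, h1, η_one, h3, Algebra.algebraMap_eq_smul_one,
        map_smul, η_one]
    | add a b ha hb => intro x; rw [map_add, map_add, ha, hb, map_add, lie_add]
    | smul r a ha => intro x; rw [map_smul, map_smul, ha, map_smul, lie_smul]
    | mul y a ha =>
      intro x
      rw [indOp_mul, map_add, η_mul, ha, ha, η_mul, leibniz_lie x, add_comm]
  obtain ⟨u, rfl⟩ : ∃ u, η u = m := by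
    induction m using Verma.induction with
    | one => exact ⟨1, η_one⟩
    | add a b ha hb =>
      obtain ⟨u, rfl⟩ := ha; obtain ⟨v, rfl⟩ := hb
      exact ⟨u + v, map_add _ _ _⟩
    | smul r a ha => obtain ⟨u, rfl⟩ := ha; exact ⟨r • u, map_smul _ _ _⟩
    | lie x a ha => obtain ⟨u, rfl⟩ := ha; exact ⟨_, η_lie u x⟩
  induction u using envelope_induction with
  | one => rwa [η_one]
  | add a b ha hb => rw [map_add]; exact add _ _ ha hb
  | smul r a ha => rw [map_smul]; exact smul _ _ ha
  | mul y a ha => rw [η_mul]; exact lie _ y.2 _ ha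

/-! ### Coinvariants of `M(mu) ⊗ T` -/

variable (T : Type*) [AddCommGroup T] [Module ℂ T] [LieRingModule (SL n) T] [LieModule ℂ (SL n) T]

/-- The antipode of `U(n_-)`, followed by its action on `T`. -/
def antipodeAct : UniversalEnvelopingAlgebra ℂ (nMinusLie n) →ₐ[ℂ] (Module.End ℂ T)ᵐᵒᵖ :=
  UniversalEnvelopingAlgebra.lift ℂ
    { toFun := fun y => MulOpposite.op (-LieModule.toEnd ℂ (SL n) T (y : SL n))
      map_add' := fun x y => by
        rw [← MulOpposite.op_add]; congr 1; ext t; simp; abel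
      map_smul' := fun c y => by
        rw [RingHom.id_apply, ← MulOpposite.op_smul]; congr 1; ext t; simp
      map_lie' := fun {x y} => by
        rw [LieRing.of_associative_ring_bracket, ← MulOpposite.op_mul, ← MulOpposite.op_mul,
          ← MulOpposite.op_sub]
        congr 1
        ext t
        simp }

/-- The projection of `M(mu) ⊗ T` to its `n_-`-coinvariants, identified with `T`. -/
def coinvMap : Verma mu ⊗[ℂ] T →ₗ[ℂ] T :=
  TensorProduct.lift ((MulOpposite.opLinearEquiv ℂ).symm.toLinearMap ∘ₗ
    (antipodeAct T).toLinearMap ∘ₗ toLower mu)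

theorem coinvMap_tmul (m : Verma mu) (t : T) :
    coinvMap mu T (m ⊗ₜ t) = (antipodeAct T (toLower mu m)).unop t := rfl

theorem coinvMap_hwv (t : T) : coinvMap mu T (hwv mu ⊗ₜ t) = t := by
  rw [coinvMap_tmul, toLower_hwv, map_one]; rfl

/-- With S the antipode, S(y u) = -S(u) y, so the image of y m ⊗ t cancels that of m ⊗ y t. -/
theorem coinvMap_lie {y : SL n} (hy : y ∈ nMinus n) (z : Verma mu ⊗[ℂ] T) :
    coinvMap mu T ⁅y, z⁆ = 0 := by
  induction z using TensorProduct.induction_on with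
  | zero => rw [lie_zero, map_zero]
  | add a b ha hb => rw [lie_add, map_add, ha, hb, add_zero]
  | tmul m t =>
    rw [TensorProduct.LieModule.lie_tmul_right, map_add, coinvMap_tmul, coinvMap_tmul]
    have h := toLower_lie mu ⟨y, hy⟩ m
    change toLower mu ⁅y, m⁆ = _ at h
    have h2 : antipodeAct T (UniversalEnvelopingAlgebra.ι ℂ (⟨y, hy⟩ : nMinusLie n)) =
        MulOpposite.op (-LieModule.toEnd ℂ (SL n) T y) :=
      UniversalEnvelopingAlgebra.lift_ι_apply ℂ _ _
    rw [h, map_mul, h2, MulOpposite.unop_mul, MulOpposite.unop_op, Module.End.mul_apply]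
    simp

end Verma

/-! ### The basis of words of `V_n^{⊗ l}` -/

section Words

variable {n l : ℕ}

/-- The basis of `V_n^{⊗ l}` indexed by words. -/
def wordBasis (n l : ℕ) : Module.Basis (Fin l → Fin n) ℂ (TensorPow n l) :=
  Basis.piTensorProduct fun _ : Fin l => Pi.basisFun ℂ (Fin n)

theorem wordBasis_apply (p : Fin l → Fin n) :
    wordBasis n l p = PiTensorProduct.tprod ℂ (fun i => Pi.single (p i) (1 : ℂ)) := by
  simp [wordBasis, Basis.piTensorProduct_apply]

theorem cartan_lie_wordBasis {h : SL n} (hh : h ∈ cartan n) (p : Fin l → Fin n) :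
    ⁅h, wordBasis n l p⁆ = (∑ i, h.1 (p i) (p i)) • wordBasis n l p := by
  rw [wordBasis_apply]
  exact lie_basis h hh p

theorem reindex_wordBasis (σ : Equiv.Perm (Fin l)) (p : Fin l → Fin n) :
    PiTensorProduct.reindex ℂ (fun _ : Fin l => (Fin n → ℂ)) σ (wordBasis n l p) =
      wordBasis n l (p ∘ σ.symm) := by
  rw [wordBasis_apply, wordBasis_apply, PiTensorProduct.reindex_tprod]
  rfl

theorem slot_traceless_of_ne (i : Fin l) {a b : Fin n} (hab : a ≠ b) (p : Fin l → Fin n) :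
    slot i (LieModule.toEnd ℂ (SL n) (Fin n → ℂ) (traceless a b)) (wordBasis n l p) =
      if p i = b then wordBasis n l (Function.update p i a) else 0 := by
  have h1 : LieModule.toEnd ℂ (SL n) (Fin n → ℂ) (traceless a b) (Pi.single (p i) (1 : ℂ)) =
      if p i = b then Pi.single a (1 : ℂ) else 0 := by
    change (traceless a b).1.mulVec (Pi.single (p i) (1 : ℂ)) = _
    ext c
    rw [Matrix.mulVec_single_one, Matrix.col_apply, traceless_apply]
    by_cases h : p i = b
    · subst h
      by_cases hc : c = a
      · subst hc; simp [hab]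
      · simp [hab, hc, Ne.symm hc]
    · simp [hab, h, Ne.symm h]
  rw [wordBasis_apply, slot_tprod, h1]
  split_ifs with h
  · rw [wordBasis_apply]
    congr 1
    ext1 j
    by_cases hj : j = i
    · subst hj; simp
    · simp [hj]
  · exact MultilinearMap.map_update_zero _ _ _

theorem slot_traceless_self (i : Fin l) (a : Fin n) (p : Fin l → Fin n) :
    slot i (LieModule.toEnd ℂ (SL n) (Fin n → ℂ) (traceless a a)) (wordBasis n l p) =
      ((if a = p i then 1 else 0) - 1 / n : ℂ) • wordBasis n l p := by
  have h1 : LieModule.toEnd ℂ (SL n) (Fin n → ℂ) (traceless a a) (Pi.single (p i) (1 : ℂ)) =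
      ((if a = p i then 1 else 0) - 1 / n : ℂ) • Pi.single (p i) (1 : ℂ) := by
    change (traceless a a).1.mulVec (Pi.single (p i) (1 : ℂ)) = _
    ext c
    rw [Matrix.mulVec_single_one, Matrix.col_apply, traceless_apply, Pi.smul_apply, smul_eq_mul]
    by_cases h : c = p i
    · subst h; simp
    · have : ¬ (a = c ∧ a = p i) := by rintro ⟨rfl, h'⟩; exact h h'
      simp [h, this]
  rw [wordBasis_apply, slot_tprod, h1, MultilinearMap.map_update_smul, Function.update_eq_self]

theorem lie_traceless_wordBasis {a b : Fin n} (hab : a ≠ b) (p : Fin l → Fin n) :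
    ⁅traceless a b, wordBasis n l p⁆ =
      ∑ j, if p j = b then wordBasis n l (Function.update p j a) else 0 := by
  rw [lie_tensorPow, LinearMap.sum_apply]
  exact Finset.sum_congr rfl fun j _ => slot_traceless_of_ne j hab p

/-- The transpose of `lie_traceless_wordBasis`. It recognizes the sums of coefficients in the
eigenvector equations as coefficients of E_ab t. -/
theorem repr_lie_traceless {a b : Fin n} (hab : a ≠ b) (t : TensorPow n l) (p : Fin l → Fin n) :
    (wordBasis n l).repr ⁅traceless a b, t⁆ p =
      ∑ j, if p j = a then (wordBasis n l).repr t (Function.update p j b) else 0 := by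
  have h : Finsupp.lapply p ∘ₗ (wordBasis n l).repr.toLinearMap ∘ₗ
        LieModule.toEnd ℂ (SL n) (TensorPow n l) (traceless a b) =
      ∑ j, if p j = a then Finsupp.lapply (Function.update p j b) ∘ₗ
        (wordBasis n l).repr.toLinearMap else 0 := by
    refine (wordBasis n l).ext fun q => ?_
    simp only [LinearMap.comp_apply, LieModule.toEnd_apply_apply, LinearMap.sum_apply,
      lie_traceless_wordBasis hab, map_sum]
    refine Finset.sum_congr rfl fun j _ => ?_
    by_cases h1 : q j = b
    · rw [if_pos h1]
      by_cases h2 : p j = a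
      · rw [if_pos h2]
        have e : Function.update q j a = p ↔ q = Function.update p j b := by
          constructor
          · rintro rfl; rw [← h1]; simp
          · rintro rfl; rw [← h2]; simp
        simp [Finsupp.single_apply, e]
      · have e : Function.update q j a ≠ p := by rintro rfl; simp at h2
        rw [if_neg h2]
        simp [e]
    · rw [if_neg h1]
      by_cases h2 : p j = a
      · have e : q ≠ Function.update p j b := by rintro rfl; simp at h1
        rw [if_pos h2]
        simp [e]
      · simp [h2]
  have h' := LinearMap.congr_fun h t
  simp only [LinearMap.comp_apply, LinearMap.sum_apply, LieModule.toEnd_apply_apply] at h'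
  refine h'.trans (Finset.sum_congr rfl fun j _ => ?_)
  split_ifs <;> rfl

theorem update_update_eq_comp_swap (p : Fin l → Fin n) {i j : Fin l} (h : i ≠ j) :
    Function.update (Function.update p i (p j)) j (p i) = p ∘ Equiv.swap i j := by
  ext1 k
  by_cases h1 : k = j
  · subst h1; simp
  · by_cases h2 : k = i
    · subst h2; simp [h1]
    · simp [h1, h2, Equiv.swap_apply_of_ne_of_ne h2 h1]

/-- The action of `ε_i^∨` on `V_n^{⊗ l}`, identified with the `n_-`-coinvariants of
`M(mu) ⊗ V_n^{⊗ l}`, where `m = mu + rho`. -/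
def wordOp (m : Fin n → ℂ) (i : Fin l) : Module.End ℂ (TensorPow n l) :=
  (wordBasis n l).constr ℂ fun p => m (p i) • wordBasis n l p +
    ∑ j ∈ Finset.univ.filter (fun j => j < i), wordBasis n l (p ∘ Equiv.swap i j) -
    ∑ j ∈ Finset.univ.filter (fun j => p j < p i), wordBasis n l (p ∘ Equiv.swap i j)

theorem wordOp_wordBasis (m : Fin n → ℂ) (i : Fin l) (p : Fin l → Fin n) :
    wordOp m i (wordBasis n l p) = m (p i) • wordBasis n l p +
    ∑ j ∈ Finset.univ.filter (fun j => j < i), wordBasis n l (p ∘ Equiv.swap i j) -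
    ∑ j ∈ Finset.univ.filter (fun j => p j < p i), wordBasis n l (p ∘ Equiv.swap i j) :=
  Module.Basis.constr_basis _ _ _ _

theorem comp_swap_eq_iff (p q : Fin l → Fin n) (i j : Fin l) :
    q ∘ Equiv.swap i j = p ↔ q = p ∘ Equiv.swap i j := by
  constructor <;> rintro rfl <;> ext1 k <;> simp

/-- The operator `wordOp`, in terms of coefficients. -/
def coeffOp (m : Fin n → ℂ) (i : Fin l) (c : (Fin l → Fin n) → ℂ) (p : Fin l → Fin n) : ℂ :=
  m (p i) * c p + ∑ j ∈ Finset.univ.filter (fun j => j < i), c (p ∘ Equiv.swap i j) -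
    ∑ j ∈ Finset.univ.filter (fun j => p i < p j), c (p ∘ Equiv.swap i j)

/-- Passing to coefficients transposes the operator. Each transposition is its own inverse, but it
exchanges the letters at i and j, which is why the condition p j < p i turns into p i < p j. -/
theorem repr_wordOp (m : Fin n → ℂ) (i : Fin l) (t : TensorPow n l) (p : Fin l → Fin n) :
    (wordBasis n l).repr (wordOp m i t) p = coeffOp m i ((wordBasis n l).repr t) p := by
  have h : Finsupp.lapply p ∘ₗ (wordBasis n l).repr.toLinearMap ∘ₗ wordOp m i =
      m (p i) • (Finsupp.lapply p ∘ₗ (wordBasis n l).repr.toLinearMap) +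
      ∑ j ∈ Finset.univ.filter (fun j => j < i),
        Finsupp.lapply (p ∘ Equiv.swap i j) ∘ₗ (wordBasis n l).repr.toLinearMap -
      ∑ j ∈ Finset.univ.filter (fun j => p i < p j),
        Finsupp.lapply (p ∘ Equiv.swap i j) ∘ₗ (wordBasis n l).repr.toLinearMap := by
    refine (wordBasis n l).ext fun q => ?_
    simp only [LinearMap.comp_apply, LinearMap.sub_apply, LinearMap.add_apply,
      LinearMap.smul_apply, LinearMap.sum_apply, wordOp_wordBasis, map_sub, map_add, map_sum,
      map_smul, LinearEquiv.coe_coe, Module.Basis.repr_self, Finsupp.lapply_apply,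
      Finsupp.single_apply, smul_eq_mul, comp_swap_eq_iff]
    congr 1
    · congr 1
      by_cases hq : q = p
      · rw [hq]
      · simp [hq]
    · rw [Finset.sum_filter, Finset.sum_filter]
      refine Finset.sum_congr rfl fun j _ => ?_
      by_cases hq : q = p ∘ Equiv.swap i j
      · subst hq; simp
      · simp [hq]
  have h' := LinearMap.congr_fun h t
  simpa [coeffOp] using h'

end Words

/-- With indices starting at 0, ε_i occurs with sign + in n - 1 - i positive roots and with sign -
in i of them. -/
theorem rho_apply {n : ℕ} (i : Fin n) : (rho n).1 i = ((n : ℂ) - 1) / 2 - (i : ℕ) := by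
  have h1 : (rho n).1 i = (1 / 2 : ℂ) * ∑ p ∈ Finset.univ.filter
      (fun p : Fin n × Fin n => p.1 < p.2), (root p.1 p.2 : CartanDual n).1 i := by
    change (1 / 2 : ℂ) * (((CartanDual n).subtype (∑ p ∈ Finset.univ.filter
      (fun p : Fin n × Fin n => p.1 < p.2), root p.1 p.2)) i) = _
    rw [map_sum, Finset.sum_apply]
    rfl
  have h2 : ∀ a b : Fin n, (root a b : CartanDual n).1 i =
      (if i = a then (1 : ℂ) else 0) - if i = b then 1 else 0 := by
    intro a b
    change (Pi.single a 1 - Pi.single b 1 : Fin n → ℂ) i = _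
    simp [Pi.single_apply]
  have h3 : ∑ p ∈ Finset.univ.filter (fun p : Fin n × Fin n => p.1 < p.2),
      (root p.1 p.2 : CartanDual n).1 i = (n : ℂ) - 1 - 2 * (i : ℕ) := by
    rw [Finset.sum_filter, Fintype.sum_prod_type]
    have e1 : ∀ a b : Fin n, (if a < b then (root a b : CartanDual n).1 i else 0) =
        (if a = i then (if i < b then (1 : ℂ) else 0) else 0) -
          (if b = i then (if a < i then 1 else 0) else 0) := by
      intro a b
      rw [h2]
      by_cases ha : a = i <;> by_cases hb : b = i
      · subst ha; subst hb; simp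
      · subst ha; simp [hb, Ne.symm hb]
      · subst hb; simp [ha, Ne.symm ha]; split_ifs <;> simp
      · simp [ha, hb, Ne.symm ha, Ne.symm hb]
    simp only [e1, Finset.sum_sub_distrib]
    rw [Finset.sum_comm (f := fun a b => if a = i then (if i < b then (1 : ℂ) else 0) else 0)]
    simp only [Finset.sum_ite_eq', Finset.mem_univ, if_true]
    rw [Finset.sum_boole, Finset.sum_boole]
    have e2 : (Finset.univ.filter fun b => i < b) = Finset.Ioi i := by ext; simp
    have e3 : (Finset.univ.filter fun b => b < i) = Finset.Iio i := by ext; simp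
    rw [e2, e3, Fin.card_Ioi, Fin.card_Iio, Nat.sub_sub, Nat.cast_sub (by omega)]
    push_cast
    ring
  rw [h1, h3]
  ring

/-! ### `H_0(n_-, M(mu) ⊗ V_n^{⊗ l})` -/

section Coinvariants

variable {n l : ℕ}

theorem pairing_traceless (mu : CartanDual n) (a : Fin n) : pairing mu (traceless a a) = mu.1 a := by
  have h := mu.2
  change ∑ i, mu.1 i = 0 at h
  simp only [pairing, traceless_apply, if_true, and_self, mul_sub,
    Finset.sum_sub_distrib, ← Finset.sum_mul, h, zero_mul, sub_zero]
  simp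

theorem traceless_mem_nMinus {a b : Fin n} (h : b < a) : traceless a b ∈ nMinus n := by
  intro i j hij
  rw [traceless_apply, if_neg, if_neg, sub_zero]
  · rintro ⟨rfl, _⟩; exact lt_irrefl _ h
  · rintro ⟨rfl, rfl⟩; exact absurd hij (not_le.mpr h)

theorem traceless_mem_nPlus {a b : Fin n} (h : a < b) : traceless a b ∈ nPlus n := by
  intro i j hij
  rw [traceless_apply, if_neg, if_neg, sub_zero]
  · rintro ⟨rfl, _⟩; exact lt_irrefl _ h
  · rintro ⟨rfl, rfl⟩; exact absurd hij (not_le.mpr h)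

theorem traceless_mem_cartan (a : Fin n) : traceless a a ∈ cartan n := by
  intro i j hij
  rw [traceless_apply, if_neg, if_neg, sub_zero]
  · rintro ⟨_, h⟩; exact hij h
  · rintro ⟨rfl, h⟩; exact hij h

variable [NeZero n]

/-- The projection of `X ⊗ V_n^{⊗ l}` to its `n_-`-coinvariants. -/
def coinvProj (X : Type*) [AddCommGroup X] [Module ℂ X] [LieRingModule (SL n) X]
    [LieModule ℂ (SL n) X] : X ⊗[ℂ] TensorPow n l →ₗ[ℂ] H0 n l X :=
  (nMinusSpan n l X).mkQ.restrictScalars ℂ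

/-- The class of `x ⊗ t` in `H_0(n_-, X ⊗ V_n^{⊗ l})`. -/
def coinvClass {X : Type*} [AddCommGroup X] [Module ℂ X] [LieRingModule (SL n) X]
    [LieModule ℂ (SL n) X] (x : X) : TensorPow n l →ₗ[ℂ] H0 n l X :=
  coinvProj X ∘ₗ TensorProduct.mk ℂ X (TensorPow n l) x

section

variable {X : Type*} [AddCommGroup X] [Module ℂ X] [LieRingModule (SL n) X]
    [LieModule ℂ (SL n) X]

theorem coinvClass_apply (x : X) (t : TensorPow n l) :
    coinvClass x t = coinvProj X (x ⊗ₜ[ℂ] t) := rfl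

theorem coinvProj_surjective :
    Function.Surjective (coinvProj X : X ⊗[ℂ] TensorPow n l →ₗ[ℂ] H0 n l X) :=
  Submodule.mkQ_surjective (nMinusSpan n l X)

theorem coinvProj_eq_zero {z : X ⊗[ℂ] TensorPow n l} (hz : coinvProj X z = 0) :
    z ∈ Submodule.span ℂ {z : X ⊗[ℂ] TensorPow n l | ∃ x ∈ nMinus n, ∃ t', z = ⁅x, t'⁆} :=
  (Submodule.Quotient.mk_eq_zero (nMinusSpan n l X)).mp hz

theorem coinvProj_lie {y : SL n} (hy : y ∈ nMinus n) (z : X ⊗[ℂ] TensorPow n l) :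
    coinvProj X ⁅y, z⁆ = 0 :=
  (Submodule.Quotient.mk_eq_zero (nMinusSpan n l X)).mpr (Submodule.subset_span ⟨y, hy, z, rfl⟩)

theorem hecke_smul_coinvProj (a : Hecke l) (z : X ⊗[ℂ] TensorPow n l) :
    a • coinvProj X z = coinvProj X (heckeRep X a z) := rfl

theorem cartanAct_coinvProj (h : cartan n) (z : X ⊗[ℂ] TensorPow n l) :
    cartanAct X h (coinvProj X z) = coinvProj X ⁅(h : SL n), z⁆ := rfl

theorem coinvClass_add (x x' : X) (t : TensorPow n l) :
    coinvClass (x + x') t = coinvClass x t + coinvClass x' t := by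
  rw [coinvClass_apply, TensorProduct.add_tmul, map_add]; rfl

theorem coinvClass_zero (t : TensorPow n l) : coinvClass (0 : X) t = 0 := by
  rw [coinvClass_apply, TensorProduct.zero_tmul, map_zero]

theorem coinvClass_smul (c : ℂ) (x : X) (t : TensorPow n l) :
    coinvClass (c • x) t = c • coinvClass x t := by
  rw [coinvClass_apply, ← TensorProduct.smul_tmul', map_smul]; rfl

/-- Modulo n_-, a lowering operator can be moved from X to the tensor power at the cost of a sign;
this is how Ω_{0i} becomes an operator on V_n^{⊗ l} alone. -/
theorem coinvClass_lie {y : SL n} (hy : y ∈ nMinus n) (x : X) (t : TensorPow n l) :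
    coinvClass ⁅y, x⁆ t = -coinvClass x ⁅y, t⁆ := by
  have h := coinvProj_lie hy (x ⊗ₜ[ℂ] t)
  rw [TensorProduct.LieModule.lie_tmul_right, map_add] at h
  exact eq_neg_of_add_eq_zero_left h

theorem cartanAct_coinvClass (h : cartan n) (x : X) (t : TensorPow n l) :
    cartanAct X h (coinvClass x t) = coinvClass ⁅(h : SL n), x⁆ t + coinvClass x ⁅(h : SL n), t⁆ := by
  rw [coinvClass_apply, cartanAct_coinvProj, TensorProduct.LieModule.lie_tmul_right, map_add]
  rfl

theorem w_smul_coinvClass (σ : Equiv.Perm (Fin l)) (x : X) (t : TensorPow n l) :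
    Hecke.w σ • coinvClass x t =
      coinvClass x (PiTensorProduct.reindex ℂ (fun _ : Fin l => (Fin n → ℂ)) σ t) := by
  have h : heckeRep X (Hecke.w σ) = (permAct X σ : Module.End ℂ (X ⊗[ℂ] TensorPow n l)) :=
    Hecke.lift_w _ _ _ _ σ
  rw [coinvClass_apply, hecke_smul_coinvProj, h]
  rfl

theorem eps_smul_coinvClass (i : Fin l) (x : X) (t : TensorPow n l) :
    Hecke.eps i • coinvClass x t =
      ∑ a, ∑ b, coinvClass ⁅traceless a b, x⁆
        (slot i (LieModule.toEnd ℂ (SL n) (Fin n → ℂ) (traceless b a)) t) +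
      ∑ j ∈ Finset.univ.filter (fun j : Fin l => j < i),
        coinvClass x (PiTensorProduct.reindex ℂ (fun _ : Fin l => (Fin n → ℂ)) (Equiv.swap j i) t) +
      (((n : ℂ) - 1) / 2) • coinvClass x t := by
  have h : heckeRep X (Hecke.eps i) = (yOp X i : Module.End ℂ (X ⊗[ℂ] TensorPow n l)) :=
    Hecke.lift_eps _ _ _ _ i
  have h2 : (yOp X i : Module.End ℂ (X ⊗[ℂ] TensorPow n l)) (x ⊗ₜ[ℂ] t) =
      ∑ a, ∑ b, ⁅traceless a b, x⁆ ⊗ₜ[ℂ]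
        (slot i (LieModule.toEnd ℂ (SL n) (Fin n → ℂ) (traceless b a)) t) +
      ∑ j ∈ Finset.univ.filter (fun j : Fin l => j < i),
        x ⊗ₜ[ℂ] (PiTensorProduct.reindex ℂ (fun _ : Fin l => (Fin n → ℂ)) (Equiv.swap j i) t) +
      (((n : ℂ) - 1) / 2) • x ⊗ₜ[ℂ] t := by
    rw [yOp_eq, omegaX, casimirOp_eq, jmOp]
    simp only [LinearMap.add_apply, LinearMap.sum_apply, Module.algebraMap_end_apply]
    rfl
  rw [coinvClass_apply, hecke_smul_coinvProj, h, h2, map_add, map_add, map_smul, map_sum, map_sum]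
  congr 2
  refine Finset.sum_congr rfl fun a _ => ?_
  rw [map_sum]
  rfl

variable (mu : CartanDual n)

/-- The action of `ε_i^∨` on the classes of `x ⊗ t`, where `x` is a vector of weight `mu` killed by
`n_+`. -/
theorem eps_smul_coinvClass_of_borel {x : X} (hx : ∀ b ∈ borel n, ⁅b, x⁆ = pairing mu b • x)
    (i : Fin l) (t : TensorPow n l) :
    Hecke.eps i • coinvClass x t =
      coinvClass x (wordOp (mu + rho n).1 i t) := by
  have key : ∀ p, Hecke.eps i • coinvClass x (wordBasis n l p) =
      coinvClass x (wordOp (mu + rho n).1 i (wordBasis n l p)) := by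
    intro p
    -- The term E_ab ⊗ E_ba of Ω_{0i}: for a < b it kills x, for a = b it acts on x by mu_a, and for
    -- a > b the factor E_ab is moved across the tensor sign.
    have hterm : ∀ a b, coinvClass ⁅traceless a b, x⁆
        (slot i (LieModule.toEnd ℂ (SL n) (Fin n → ℂ) (traceless b a)) (wordBasis n l p)) =
        (if a = b then (mu.1 a * ((if a = p i then 1 else 0) - 1 / n)) •
          coinvClass x (wordBasis n l p) else 0) -
        if a = p i then (if b < p i then coinvClass x (wordBasis n l p) +
          ∑ j, (if p j = b then coinvClass x (wordBasis n l (p ∘ Equiv.swap i j))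
            else 0) else 0) else 0 := by
      intro a b
      rcases lt_trichotomy a b with h | h | h
      · rw [hx _ (nPlus_le_borel (traceless_mem_nPlus h)), pairing_nPlus mu (traceless_mem_nPlus h),
          zero_smul, coinvClass_zero, if_neg h.ne]
        split_ifs with h1 h2
        · subst h1; exact absurd h2 h.not_gt
        · simp
        · simp
      · subst h
        rw [hx _ (cartan_le_borel (traceless_mem_cartan a)), slot_traceless_self, map_smul,
          coinvClass_smul, pairing_traceless, if_pos rfl, smul_smul, mul_comm]
        split_ifs with h1 h2
        · subst h1; exact absurd h2 (lt_irrefl _)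
        · simp
        · simp
      · rw [coinvClass_lie (traceless_mem_nMinus h), slot_traceless_of_ne i h.ne, if_neg h.ne',
          zero_sub]
        congr 1
        -- Only a = p_i survives: E_ba in slot i turns the letter a into b. Then E_ab on the whole
        -- tensor either restores slot i, giving p back, or turns another letter b into a, giving p
        -- with the letters at i and j exchanged.
        by_cases h1 : a = p i
        · subst h1
          rw [if_pos rfl, if_pos rfl, if_pos h, lie_traceless_wordBasis h.ne', map_sum,
            ← Finset.add_sum_erase _ _ (Finset.mem_univ i),
            ← Finset.add_sum_erase (a := i) _ (fun j => if p j = b then _ else _) (Finset.mem_univ i)]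
          simp only [Function.update_self, if_true, Function.update_idem, Function.update_eq_self,
            if_neg h.ne', zero_add]
          congr 1
          refine Finset.sum_congr rfl fun j hj => ?_
          have hji := Finset.ne_of_mem_erase hj
          rw [Function.update_of_ne hji]
          by_cases h2 : p j = b
          · rw [if_pos h2, if_pos h2, ← h2, update_update_eq_comp_swap p hji.symm]
          · rw [if_neg h2, if_neg h2, map_zero]
        · rw [if_neg h1, if_neg (Ne.symm h1), lie_zero, map_zero]
    rw [eps_smul_coinvClass, wordOp_wordBasis]
    simp only [hterm, reindex_wordBasis, Equiv.symm_swap, map_sub, map_add, map_sum, map_smul,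
      Finset.sum_sub_distrib, Finset.sum_ite_eq, Finset.mem_univ, if_true, ← Finset.sum_smul]
    -- The correction 1/n disappears because the coordinates of mu add up to zero.
    have e1 : ∑ a, mu.1 a * ((if a = p i then 1 else 0) - 1 / n : ℂ) = mu.1 (p i) := by
      have h := mu.2
      change ∑ i, mu.1 i = 0 at h
      simp only [mul_sub, Finset.sum_sub_distrib, ← Finset.sum_mul, h, zero_mul, sub_zero]
      simp
    -- The word p comes back once for every letter b < p_i, that is p_i times when letters are
    -- numbered from 0. Subtracted from (n-1)/2, this number yields the coordinate of rho at p_i,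
    -- hence the shift from mu to mu + rho.
    have e2 : (∑ a, ∑ b, if a = p i then (if b < p i then
          coinvClass x (wordBasis n l p) +
          ∑ j, (if p j = b then coinvClass x (wordBasis n l (p ∘ Equiv.swap i j))
            else 0) else 0) else 0) =
        ((p i : ℕ) : ℂ) • coinvClass x (wordBasis n l p) +
        ∑ j ∈ Finset.univ.filter (fun j => p j < p i),
          coinvClass x (wordBasis n l (p ∘ Equiv.swap i j)) := by
      rw [Finset.sum_comm]
      simp only [Finset.sum_ite_eq', Finset.mem_univ, if_true]
      rw [← Finset.sum_filter, Finset.sum_add_distrib, Finset.sum_const, Finset.sum_comm,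
        Finset.sum_filter]
      congr 1
      · have e3 : (Finset.univ.filter fun b => b < p i) = Finset.Iio (p i) := by ext; simp
        rw [e3, Fin.card_Iio, Nat.cast_smul_eq_nsmul]
      · refine Finset.sum_congr rfl fun j _ => ?_
        rw [Finset.sum_ite_eq]
        simp
    rw [e1, e2]
    have e4 : (mu + rho n).1 (p i) = mu.1 (p i) + (((n : ℂ) - 1) / 2 - (p i : ℕ)) := by
      rw [← rho_apply]; rfl
    rw [e4]
    simp only [Equiv.swap_comm _ i]
    module
  let f : TensorPow n l →ₗ[ℂ] H0 n l X :=
    (Algebra.lsmul ℂ ℂ (H0 n l X) (Hecke.eps i)) ∘ₗ coinvClass x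
  have hf : f = coinvClass x ∘ₗ wordOp (mu + rho n).1 i :=
    (wordBasis n l).ext key
  exact LinearMap.congr_fun hf t

theorem eps_smul_hwv (i : Fin l) (t : TensorPow n l) :
    Hecke.eps i • coinvClass (Verma.hwv mu) t =
      coinvClass (Verma.hwv mu) (wordOp (mu + rho n).1 i t) :=
  eps_smul_coinvClass_of_borel mu (fun _ hb => Verma.borel_lie_hwv mu hb) i t

end

variable (mu : CartanDual n)

/-- The map `Verma.coinvMap` kills n_- (M(mu) ⊗ V_n^{⊗ l}) and is a left inverse of t ↦ v ⊗ t. -/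
theorem coinvClass_hwv_injective :
    Function.Injective (coinvClass (Verma.hwv mu) : TensorPow n l →ₗ[ℂ] H0 n l (Verma mu)) := by
  rw [injective_iff_map_eq_zero]
  intro t ht
  have h : ∀ z ∈ Submodule.span ℂ
      {z : Verma mu ⊗[ℂ] TensorPow n l | ∃ x ∈ nMinus n, ∃ t', z = ⁅x, t'⁆},
      Verma.coinvMap mu (TensorPow n l) z = 0 := by
    intro z hz
    induction hz using Submodule.span_induction with
    | mem z hz => obtain ⟨x, hx, t', rfl⟩ := hz; exact Verma.coinvMap_lie mu _ hx t'
    | zero => exact map_zero _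
    | add a b _ _ ha hb => rw [map_add, ha, hb, add_zero]
    | smul c a _ ha => rw [map_smul, ha, smul_zero]
  rw [← Verma.coinvMap_hwv mu (TensorPow n l) t]
  exact h _ (coinvProj_eq_zero ht)

/-- Since M(mu) = U(n_-) v, all lowering operators can be moved off the first factor by
`coinvClass_lie`. -/
theorem coinvClass_hwv_surjective :
    Function.Surjective (coinvClass (Verma.hwv mu) : TensorPow n l →ₗ[ℂ] H0 n l (Verma mu)) := by
  have h1 : ∀ (m : Verma mu) (t : TensorPow n l), ∃ t', coinvClass (Verma.hwv mu) t' =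
      coinvClass m t := by
    intro m
    induction m using Verma.lower_induction with
    | one => exact fun t => ⟨t, rfl⟩
    | add a b ha hb =>
      intro t
      obtain ⟨s, hs⟩ := ha t
      obtain ⟨s', hs'⟩ := hb t
      exact ⟨s + s', by rw [map_add, hs, hs', coinvClass_add]⟩
    | smul r a ha =>
      intro t
      obtain ⟨s, hs⟩ := ha t
      exact ⟨r • s, by rw [map_smul, hs, coinvClass_smul]⟩
    | lie y hy a ha =>
      intro t
      obtain ⟨s, hs⟩ := ha ⁅y, t⁆
      exact ⟨-s, by rw [map_neg, hs, coinvClass_lie hy]⟩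
  intro q
  obtain ⟨z, rfl⟩ := coinvProj_surjective q
  induction z using TensorProduct.induction_on with
  | zero => exact ⟨0, by rw [map_zero, map_zero]⟩
  | tmul m t => exact h1 m t
  | add a b ha hb =>
    obtain ⟨s, hs⟩ := ha
    obtain ⟨s', hs'⟩ := hb
    exact ⟨s + s', by rw [map_add, hs, hs', map_add]⟩

/-- The weight space of weight `nu` of `V_n^{⊗ l}`. -/
def weightSpace (l : ℕ) (nu : CartanDual n) : Submodule ℂ (TensorPow n l) where
  carrier := {t | ∀ h ∈ cartan n, ⁅h, t⁆ = pairing nu h • t}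
  add_mem' ha hb h hh := by rw [lie_add, ha h hh, hb h hh, smul_add]
  zero_mem' h hh := by rw [lie_zero, smul_zero]
  smul_mem' c t ht h hh := by rw [lie_smul, ht h hh, smul_comm]

/-- The vector v contributes the weight mu, and injectivity of t ↦ [v ⊗ t] lets the remaining weight
lam - mu be read off on t. -/
theorem coinvClass_hwv_mem_iff (lam : CartanDual n) (t : TensorPow n l) :
    coinvClass (Verma.hwv mu) t ∈ FunctorF l lam (Verma mu) ↔ t ∈ weightSpace l (lam - mu) := by
  have h1 : ∀ h : cartan n, cartanAct (Verma mu) h (coinvClass (Verma.hwv mu) t) =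
      pairing lam h.1 • coinvClass (Verma.hwv mu) t ↔ ⁅h.1, t⁆ = pairing (lam - mu) h.1 • t := by
    intro h
    have e : pairing (lam - mu) h.1 = pairing lam h.1 - pairing mu h.1 := by
      simp only [pairing, ← Finset.sum_sub_distrib, ← sub_mul]
      rfl
    rw [cartanAct_coinvClass, Verma.cartan_lie_hwv mu h.2, coinvClass_smul, e, ← eq_sub_iff_add_eq',
      ← sub_smul, ← map_smul, (coinvClass_hwv_injective mu).eq_iff]
  exact ⟨fun H h hh => (h1 ⟨h, hh⟩).mp (H ⟨h, hh⟩), fun H h => (h1 h).mpr (H h.1 h.2)⟩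

/-- `F_lam(M(mu))` is isomorphic to a weight space of `V_n^{⊗ l}`, as a vector space. -/
def weightEquiv (l : ℕ) (lam : CartanDual n) :
    weightSpace l (lam - mu) ≃ₗ[ℂ] FunctorF l lam (Verma mu) :=
  LinearEquiv.ofBijective
    { toFun := fun t => ⟨coinvClass (Verma.hwv mu) t.1, (coinvClass_hwv_mem_iff mu lam _).mpr t.2⟩
      map_add' := fun a b => Subtype.ext (map_add _ _ _)
      map_smul' := fun c a => Subtype.ext (map_smul _ _ _) }
    ⟨fun a b h => Subtype.ext (coinvClass_hwv_injective mu (congrArg Subtype.val h)), fun q => by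
      obtain ⟨t, ht⟩ := coinvClass_hwv_surjective mu q.1
      exact ⟨⟨t, (coinvClass_hwv_mem_iff mu lam _).mp (by rw [ht]; exact q.2)⟩, Subtype.ext ht⟩⟩

theorem weightEquiv_apply (lam : CartanDual n) (t : weightSpace l (lam - mu)) :
    (weightEquiv mu l lam t).1 = coinvClass (Verma.hwv mu) t.1 := rfl

end Coinvariants

/-! ### Words and weights -/

section Content

variable {n l : ℕ}

/-- The number of letters `a` of a word. -/
def content (p : Fin l → Fin n) (a : Fin n) : ℕ := (Finset.univ.filter fun i => p i = a).card

theorem sum_content (p : Fin l → Fin n) : ∑ a, content p a = l := by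
  simp only [content]
  rw [← Finset.card_eq_sum_card_fiberwise (fun _ _ => Finset.mem_coe.mpr (Finset.mem_univ _))]
  simp

theorem sum_comp_eq_content (p : Fin l → Fin n) (f : Fin n → ℂ) :
    ∑ i, f (p i) = ∑ a, (content p a : ℂ) * f a := by
  rw [← Finset.sum_fiberwise Finset.univ p (fun i => f (p i))]
  refine Finset.sum_congr rfl fun a _ => ?_
  rw [Finset.sum_congr rfl (g := fun _ => f a) (by
    intro i hi; rw [(Finset.mem_filter.mp hi).2]), Finset.sum_const, nsmul_eq_mul, content]

theorem exists_perm_of_content_eq {p q : Fin l → Fin n} (h : content p = content q) :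
    ∃ σ : Equiv.Perm (Fin l), p = q ∘ σ := by
  have e : ∀ a, Nonempty ({i // p i = a} ≃ {i // q i = a}) := by
    intro a
    rw [← Fintype.card_eq, Fintype.card_subtype, Fintype.card_subtype]
    exact congrFun h a
  exact ⟨Equiv.ofFiberEquiv fun a => (e a).some,
    funext fun i => (Equiv.ofFiberEquiv_map (fun a => (e a).some) i).symm⟩

variable [NeZero n] {nu : CartanDual n} {L : Fin n → ℕ}

/-- The element E_aa - 1/n acts on a word by its number of letters a minus l/n. Summing the
coordinates of nu forces c = -l/n, so equality of weights is equality of contents, without an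
ambiguity by a constant. -/
theorem mem_weightSpace_iff (hL : ∑ a, L a = l) (hc : ∃ c : ℂ, ∀ a, nu.1 a = L a + c)
    (t : TensorPow n l) :
    t ∈ weightSpace l nu ↔ ∀ p, (wordBasis n l).repr t p ≠ 0 → content p = L := by
  have hn : (n : ℂ) ≠ 0 := by exact_mod_cast NeZero.ne n
  obtain ⟨c, hc⟩ := hc
  constructor
  · intro ht p hp
    have key : ∀ h ∈ cartan n, ∑ i, h.1 (p i) (p i) = pairing nu h := by
      intro h hh
      have h1 : (wordBasis n l).repr ⁅h, t⁆ p =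
          (∑ i, h.1 (p i) (p i)) * (wordBasis n l).repr t p := by
        have h2 : (Finsupp.lapply p ∘ₗ (wordBasis n l).repr.toLinearMap) ∘ₗ
            (LieModule.toEnd ℂ (SL n) (TensorPow n l) h) =
            (∑ i, h.1 (p i) (p i)) • (Finsupp.lapply p ∘ₗ (wordBasis n l).repr.toLinearMap) := by
          apply (wordBasis n l).ext
          intro q
          simp only [LinearMap.comp_apply, LieModule.toEnd_apply_apply, LinearMap.smul_apply]
          rw [cartan_lie_wordBasis hh]
          by_cases hq : q = p
          · subst hq; simp
          · simp [hq]
        exact LinearMap.congr_fun h2 t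
      rw [ht h hh, map_smul, Finsupp.smul_apply, smul_eq_mul] at h1
      exact (mul_right_cancel₀ hp h1).symm
    have h1 : ∀ a, (content p a : ℂ) - l / n = L a + c := by
      intro a
      have := key _ (traceless_mem_cartan a)
      rw [pairing_traceless, hc, sum_comp_eq_content p (fun b => (traceless a a).1 b b)] at this
      simp only [traceless_apply, and_self, if_true, mul_sub, Finset.sum_sub_distrib,
        ← Finset.sum_mul, ← Nat.cast_sum, sum_content] at this
      simp only [mul_ite, mul_one, mul_zero, Finset.sum_ite_eq, Finset.mem_univ, if_true] at this
      rw [← this, mul_one_div]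
    have h2 : (l : ℂ) / n = -c := by
      have h3 : ∑ a, nu.1 a = 0 := nu.2
      simp only [hc, Finset.sum_add_distrib, ← Nat.cast_sum, hL, Finset.sum_const, Finset.card_univ,
        Fintype.card_fin, nsmul_eq_mul] at h3
      field_simp
      linear_combination h3
    ext a
    have h3 := h1 a
    rw [h2, sub_neg_eq_add, add_left_inj] at h3
    exact_mod_cast h3
  · intro H h hh
    have key : ∀ p, content p = L → ⁅h, wordBasis n l p⁆ = pairing nu h • wordBasis n l p := by
      intro p hp
      rw [cartan_lie_wordBasis hh, sum_comp_eq_content p (fun b => h.1 b b), hp]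
      congr 1
      have h3 : ∑ a, h.1 a a = 0 := h.2
      simp only [pairing, hc, add_mul, Finset.sum_add_distrib, ← Finset.mul_sum, h3, mul_zero,
        add_zero]
    rw [← (wordBasis n l).sum_repr t, lie_sum, Finset.smul_sum]
    refine Finset.sum_congr rfl fun p _ => ?_
    rw [lie_smul]
    by_cases hp : (wordBasis n l).repr t p = 0
    · rw [hp, zero_smul, zero_smul, smul_zero]
    · rw [key p (H p hp), smul_comm]

theorem wordBasis_mem_weightSpace (hL : ∑ a, L a = l) (hc : ∃ c : ℂ, ∀ a, nu.1 a = L a + c)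
    {p : Fin l → Fin n} (hp : content p = L) : wordBasis n l p ∈ weightSpace l nu := by
  rw [mem_weightSpace_iff hL hc]
  intro q hq
  rw [Module.Basis.repr_self, Finsupp.single_apply] at hq
  rw [← hp]
  congr 1
  by_contra hne
  exact hq (if_neg fun e => hne e.symm)

end Content

/-! ### Sorted words -/

section Sorted

variable {n l : ℕ}

/-- The eigenvalue of `wordOp m i` on a sorted word. -/
def sortedWeight (m : Fin n → ℂ) (p : Fin l → Fin n) (i : Fin l) : ℂ :=
  m (p i) + (Finset.univ.filter fun j => j < i ∧ p j = p i).card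

theorem comp_swap_of_eq (p : Fin l → Fin n) {i j : Fin l} (h : p j = p i) :
    p ∘ Equiv.swap i j = p := by
  ext1 k
  by_cases h1 : k = i
  · subst h1; simp [h]
  · by_cases h2 : k = j
    · subst h2; simp [h]
    · simp [Equiv.swap_apply_of_ne_of_ne h1 h2]

/-- In a sorted word all letters smaller than p_i stand before position i. The second sum of
transpositions therefore cancels part of the first, and what remains exchanges equal letters and
fixes the word. -/
theorem wordOp_of_monotone (m : Fin n → ℂ) {p : Fin l → Fin n} (hp : Monotone p) (i : Fin l) :
    wordOp m i (wordBasis n l p) = sortedWeight m p i • wordBasis n l p := by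
  rw [wordOp_wordBasis, sortedWeight, add_smul, add_sub_assoc]
  congr 1
  have h1 : Finset.univ.filter (fun j => j < i) =
      Finset.univ.filter (fun j => p j < p i) ∪ Finset.univ.filter (fun j => j < i ∧ p j = p i) := by
    ext j
    simp only [Finset.mem_filter, Finset.mem_univ, true_and, Finset.mem_union]
    constructor
    · intro h
      rcases (hp h.le).lt_or_eq with h' | h'
      · exact Or.inl h'
      · exact Or.inr ⟨h, h'⟩
    · rintro (h | h)
      · exact lt_of_not_ge fun h' => absurd (hp h') (not_le.mpr h)
      · exact h.1
  rw [h1, Finset.sum_union, add_sub_cancel_left, Finset.sum_congr rfl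
    (g := fun _ => wordBasis n l p), Finset.sum_const, Nat.cast_smul_eq_nsmul]
  · intro j hj
    rw [comp_swap_of_eq p (Finset.mem_filter.mp hj).2.2]
  · rw [Finset.disjoint_left]
    intro j hj hj'
    exact absurd (Finset.mem_filter.mp hj').2.2 (Finset.mem_filter.mp hj).2.ne

variable (Δ : Fin n → Segment) (hΔ : ∑ i, (Δ i).len = l)

/-- The word `1^{l_1} 2^{l_2} ⋯`. -/
def blockWord (x : Fin l) : Fin n := (finSigmaFinEquiv.symm (Fin.cast hΔ.symm x)).1

theorem exists_blockIncl (x : Fin l) : ∃ i j, x = blockIncl Δ hΔ i j := by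
  refine ⟨(finSigmaFinEquiv.symm (Fin.cast hΔ.symm x)).1,
    (finSigmaFinEquiv.symm (Fin.cast hΔ.symm x)).2, ?_⟩
  change x = Fin.cast hΔ (finSigmaFinEquiv (finSigmaFinEquiv.symm (Fin.cast hΔ.symm x)))
  rw [Equiv.apply_symm_apply]
  rfl

theorem blockWord_blockIncl (i : Fin n) (j : Fin (Δ i).len) :
    blockWord Δ hΔ (blockIncl Δ hΔ i j) = i := by
  change (finSigmaFinEquiv.symm (Fin.cast hΔ.symm (Fin.cast hΔ (finSigmaFinEquiv ⟨i, j⟩)))).1 = i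
  simp

theorem blockIncl_lt {i i' : Fin n} (h : i < i') (j : Fin (Δ i).len) (j' : Fin (Δ i').len) :
    blockIncl Δ hΔ i j < blockIncl Δ hΔ i' j' := by
  rw [Fin.lt_def, blockIncl_val, blockIncl_val]
  have h1 : ∀ i : Fin n, ∑ a : Fin i, (Δ (Fin.castLE i.2.le a)).len =
      ∑ a ∈ Finset.univ.filter (fun a => a < i), (Δ a).len := by
    intro i
    refine Finset.sum_bij (fun a _ => Fin.castLE i.2.le a) ?_ ?_ ?_ ?_
    · intro a _
      exact Finset.mem_filter.mpr ⟨Finset.mem_univ _, Fin.lt_def.mpr a.2⟩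
    · intro a _ b _ hab
      exact Fin.castLE_injective _ hab
    · intro b hb
      exact ⟨⟨b, (Finset.mem_filter.mp hb).2⟩, Finset.mem_univ _, rfl⟩
    · intro a _; rfl
  have h2 : ∑ a ∈ Finset.univ.filter (fun a => a < i), (Δ a).len + (Δ i).len ≤
      ∑ a ∈ Finset.univ.filter (fun a => a < i'), (Δ a).len := by
    rw [add_comm, ← Finset.sum_insert (f := fun a => (Δ a).len) (a := i) (by simp)]
    refine Finset.sum_le_sum_of_subset ?_
    intro a
    simp only [Finset.mem_insert, Finset.mem_filter, Finset.mem_univ, true_and]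
    rintro (rfl | h')
    · exact h
    · exact h'.trans h
  rw [h1, h1]
  have := j.2
  omega

theorem blockIncl_lt_iff (i : Fin n) (j j' : Fin (Δ i).len) :
    blockIncl Δ hΔ i j < blockIncl Δ hΔ i j' ↔ j < j' := by
  rw [Fin.lt_def, blockIncl_val, blockIncl_val, Fin.lt_def]
  omega

theorem blockWord_monotone : Monotone (blockWord Δ hΔ) := by
  intro x y hxy
  obtain ⟨i, j, rfl⟩ := exists_blockIncl Δ hΔ x
  obtain ⟨i', j', rfl⟩ := exists_blockIncl Δ hΔ y
  rw [blockWord_blockIncl, blockWord_blockIncl]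
  exact le_of_not_gt fun h => absurd (blockIncl_lt Δ hΔ h j' j) (not_lt.mpr hxy)

theorem blockWord_eq_iff (i : Fin n) (x : Fin l) :
    blockWord Δ hΔ x = i ↔ ∃ j, blockIncl Δ hΔ i j = x := by
  constructor
  · rintro rfl
    obtain ⟨i, j, rfl⟩ := exists_blockIncl Δ hΔ x
    rw [blockWord_blockIncl]
    exact ⟨j, rfl⟩
  · rintro ⟨j, rfl⟩
    exact blockWord_blockIncl Δ hΔ i j

theorem content_blockWord : content (blockWord Δ hΔ) = fun i => (Δ i).len := by
  ext i
  have : (Finset.univ.filter fun x => blockWord Δ hΔ x = i) =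
      Finset.univ.map (blockIncl Δ hΔ i) := by
    ext x
    simp [blockWord_eq_iff]
  rw [content, this, Finset.card_map, Finset.card_univ, Fintype.card_fin]

/-- Exactly j equal letters precede position j of a block, counted from 0; the eigenvalues on a
block thus run through a segment starting at m_i. -/
theorem sortedWeight_blockIncl (m : Fin n → ℂ) (i : Fin n) (j : Fin (Δ i).len) :
    sortedWeight m (blockWord Δ hΔ) (blockIncl Δ hΔ i j) = m i + (j : ℕ) := by
  rw [sortedWeight, blockWord_blockIncl]
  have : (Finset.univ.filter fun x => x < blockIncl Δ hΔ i j ∧ blockWord Δ hΔ x = i) =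
      (Finset.Iio j).map (blockIncl Δ hΔ i) := by
    ext x
    simp only [Finset.mem_filter, Finset.mem_univ, true_and, Finset.mem_map, Finset.mem_Iio,
      blockWord_eq_iff]
    constructor
    · rintro ⟨h, j', rfl⟩
      exact ⟨j', (blockIncl_lt_iff Δ hΔ i j' j).mp h, rfl⟩
    · rintro ⟨j', h, rfl⟩
      exact ⟨(blockIncl_lt_iff Δ hΔ i j' j).mpr h, j', rfl⟩
  rw [this, Finset.card_map, Fin.card_Iio]

end Sorted

/-! ### Spanning sets of induced modules -/

section Induced

variable {k l : ℕ} (Δ : Fin k → Segment) (hΔ : ∑ i, (Δ i).len = l)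

theorem Hecke.induction {l : ℕ} {P : Hecke l → Prop} (w : ∀ σ, P (Hecke.w σ))
    (eps : ∀ i, P (Hecke.eps i)) (scalar : ∀ r : ℂ, P (algebraMap ℂ _ r))
    (add : ∀ a b, P a → P b → P (a + b)) (mul : ∀ a b, P a → P b → P (a * b)) (a : Hecke l) :
    P a := by
  have ha : a ∈ Algebra.adjoin ℂ (Set.range (Hecke.w (l := l)) ∪ Set.range (Hecke.eps (l := l))) := by
    rw [Hecke.adjoin_eq_top]; trivial
  induction ha using Algebra.adjoin_induction with
  | mem a ha =>
    rcases ha with ⟨σ, rfl⟩ | ⟨i, rfl⟩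
    · exact w σ
    · exact eps i
  | algebraMap r => exact scalar r
  | add a b _ _ ha hb => exact add a b ha hb
  | mul a b _ _ ha hb => exact mul a b ha hb

theorem list_ofFn_prod_eq_single {A : Type*} [Monoid A] {k : ℕ} (i : Fin k) (f : Fin k → A)
    (h : ∀ j, j ≠ i → f j = 1) : (List.ofFn f).prod = f i := by
  induction k with
  | zero => exact i.elim0
  | succ k ih =>
    rw [List.ofFn_succ, List.prod_cons]
    induction i using Fin.cases with
    | zero =>
      have : (fun j : Fin k => f j.succ) = fun _ => 1 := funext fun j => h _ (Fin.succ_ne_zero j)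
      rw [this]
      simp
    | succ i =>
      rw [h 0 (Fin.succ_ne_zero i).symm, one_mul,
        ih i (fun j => f j.succ) fun j hj => h _ fun e => hj (Fin.succ_injective _ e)]

theorem parabolicHom_tprod (x : ∀ i, Hecke (Δ i).len) :
    parabolicHom Δ hΔ (PiTensorProduct.tprod ℂ x) =
      (List.ofFn fun i => factorHom Δ hΔ i (x i)).prod := by
  change PiTensorProduct.lift _ (PiTensorProduct.tprod ℂ x) = _
  rw [PiTensorProduct.lift.tprod]
  rfl

theorem parabolicChar_tprod (x : ∀ i, Hecke (Δ i).len) :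
    parabolicChar Δ (PiTensorProduct.tprod ℂ x) =
      ∏ i, Hecke.segmentChar (Δ i).len (Δ i).a (x i) := by
  change PiTensorProduct.lift _ (PiTensorProduct.tprod ℂ x) = _
  rw [PiTensorProduct.lift.tprod]
  rfl

/-- The defining generator of the ideal for the pure tensor with a in place i and 1 elsewhere. -/
theorem factorHom_sub_mem (i : Fin k) (a : Hecke (Δ i).len) :
    factorHom Δ hΔ i a - algebraMap ℂ _ (Hecke.segmentChar (Δ i).len (Δ i).a a) ∈
      inductionIdeal (parabolicHom Δ hΔ) (parabolicChar Δ) := by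
  refine Submodule.subset_span ⟨PiTensorProduct.tprod ℂ (Function.update 1 i a), ?_⟩
  simp only [parabolicHom_tprod, parabolicChar_tprod]
  rw [list_ofFn_prod_eq_single i, Finset.prod_eq_single i]
  · simp
  · intro j _ hj; rw [Function.update_of_ne hj, Pi.one_apply, map_one]
  · simp
  · intro j hj; rw [Function.update_of_ne hj, Pi.one_apply, map_one]

/-- A vector that transforms under each factor by the given character defines a homomorphism from
the induced module. -/
theorem inductionIdeal_smul_eq_zero {M : Type*} [AddCommGroup M] [Module ℂ M] [Module (Hecke l) M]
    [IsScalarTower ℂ (Hecke l) M] (v : M)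
    (hw : ∀ i (σ : Equiv.Perm (Fin (Δ i).len)), factorHom Δ hΔ i (Hecke.w σ) • v = v)
    (he : ∀ i (j : Fin (Δ i).len), factorHom Δ hΔ i (Hecke.eps j) • v = ((Δ i).a + (j : ℕ)) • v)
    (a : Hecke l) (ha : a ∈ inductionIdeal (parabolicHom Δ hΔ) (parabolicChar Δ)) : a • v = 0 := by
  have h1 : ∀ i (b : Hecke (Δ i).len), factorHom Δ hΔ i b • v =
      Hecke.segmentChar (Δ i).len (Δ i).a b • v := by
    intro i b
    induction b using Hecke.induction with
    | w σ => rw [hw, Hecke.segmentChar, Hecke.lift_w, MonoidHom.one_apply, one_smul]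
    | eps j => rw [he, Hecke.segmentChar, Hecke.lift_eps]
    | scalar r => rw [AlgHom.commutes, AlgHom.commutes, algebraMap_smul]; rfl
    | add a b ha hb => rw [map_add, map_add, add_smul, add_smul, ha, hb]
    | mul a b ha hb =>
      rw [map_mul, map_mul, mul_smul, hb, smul_algebra_smul_comm, ha, smul_smul, mul_comm]
  have h2 : ∀ {k : ℕ} (f : Fin k → Hecke l) (c : Fin k → ℂ) (_ : ∀ i, f i • v = c i • v),
      (List.ofFn f).prod • v = (∏ i, c i) • v := by
    intro k
    induction k with
    | zero => intro f c _; simp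
    | succ k ih =>
      intro f c h
      rw [List.ofFn_succ, List.prod_cons, mul_smul, ih (fun i => f i.succ) (fun i => c i.succ)
        (fun i => h i.succ), smul_algebra_smul_comm, h 0, Fin.prod_univ_succ, smul_smul, mul_comm]
  refine Submodule.span_induction (p := fun a _ => a • v = 0) ?_ ?_ ?_ ?_ ha
  · rintro _ ⟨x, rfl⟩
    simp only [sub_smul, algebraMap_smul, sub_eq_zero]
    induction x using PiTensorProduct.induction_on with
    | smul_tprod r x =>
      rw [map_smul, map_smul, smul_assoc, smul_assoc, parabolicHom_tprod, parabolicChar_tprod,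
        h2 _ _ fun i => h1 i (x i)]
    | add x y hx hy => rw [map_add, map_add, add_smul, add_smul, hx, hy]
  · exact zero_smul _ _
  · intro a b _ _ ha hb; rw [add_smul, ha, hb, add_zero]
  · intro a b _ hb; rw [smul_eq_mul, mul_smul, hb, smul_zero]

/-- Moving `ε_j^∨` past a permutation. -/
theorem eps_mul_w_sub_mem {l : ℕ} (σ : Equiv.Perm (Fin l)) (j : Fin l) :
    Hecke.eps j * Hecke.w σ - Hecke.w σ * Hecke.eps (σ⁻¹ j) ∈
      Algebra.adjoin ℂ (Set.range (Hecke.w (l := l))) := by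
  have hmem : ∀ σ, Hecke.w σ ∈ Algebra.adjoin ℂ (Set.range (Hecke.w (l := l))) :=
    fun σ => Algebra.subset_adjoin ⟨σ, rfl⟩
  cases l with
  | zero => exact j.elim0
  | succ m =>
    have hσ : σ ∈ Submonoid.closure
        (Set.range fun i : Fin m => Equiv.swap i.castSucc i.succ) := by
      rw [Equiv.Perm.mclosure_swap_castSucc_succ]; trivial
    induction hσ using Submonoid.closure_induction generalizing j with
    | mem y hy =>
      obtain ⟨i, rfl⟩ := hy
      have h := Hecke.cross i.castSucc i.succ (by simp) (Equiv.swap i.castSucc i.succ j)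
      rw [Equiv.swap_apply_self] at h
      simp only [Equiv.swap_inv]
      rw [← neg_sub, h]
      exact neg_mem (Subalgebra.algebraMap_mem _ _)
    | one => simp [Hecke.w_one]
    | mul y z _ _ hy hz =>
      have e : Hecke.eps j * Hecke.w (y * z) - Hecke.w (y * z) * Hecke.eps ((y * z)⁻¹ j) =
          (Hecke.eps j * Hecke.w y - Hecke.w y * Hecke.eps (y⁻¹ j)) * Hecke.w z +
          Hecke.w y * (Hecke.eps (y⁻¹ j) * Hecke.w z - Hecke.w z * Hecke.eps (z⁻¹ (y⁻¹ j))) := by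
        rw [Hecke.w_mul, mul_inv_rev, Equiv.Perm.mul_apply]
        noncomm_ring
      rw [e]
      exact add_mem (mul_mem (hy j) (hmem z)) (mul_mem (hmem y) (hz _))

theorem adjoin_w_eq_span (l : ℕ) : (Algebra.adjoin ℂ (Set.range (Hecke.w (l := l)))).toSubmodule =
    Submodule.span ℂ (Set.range (Hecke.w (l := l))) := by
  rw [Algebra.adjoin_eq_span]
  congr 1
  apply subset_antisymm
  · intro x hx
    induction hx using Submonoid.closure_induction with
    | mem x hx => exact hx
    | one => exact ⟨1, Hecke.w_one⟩
    | mul x y _ _ hx hy =>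
      obtain ⟨σ, rfl⟩ := hx
      obtain ⟨τ, rfl⟩ := hy
      exact ⟨σ * τ, Hecke.w_mul σ τ⟩
  · exact Submonoid.subset_closure

/-- The spanning half of a Poincaré–Birkhoff–Witt statement for the induced module: ε_j^∨ moves past
w modulo the group algebra, and on the generator it acts by a scalar. Independence of the coset
classes is not needed here; it is detected later by the action on words. -/
theorem span_mk_w_eq_top :
    Submodule.span ℂ (Set.range fun σ => (inductionIdeal (parabolicHom Δ hΔ)
      (parabolicChar Δ)).mkQ (Hecke.w σ)) = ⊤ := by
  set I := inductionIdeal (parabolicHom Δ hΔ) (parabolicChar Δ)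
  set S := Submodule.span ℂ (Set.range fun σ => I.mkQ (Hecke.w σ))
  have hS : ∀ z ∈ Algebra.adjoin ℂ (Set.range (Hecke.w (l := l))), I.mkQ z ∈ S := by
    intro z hz
    rw [← Subalgebra.mem_toSubmodule, adjoin_w_eq_span] at hz
    induction hz using Submodule.span_induction with
    | mem x hx => obtain ⟨σ, rfl⟩ := hx; exact Submodule.subset_span ⟨σ, rfl⟩
    | zero => rw [map_zero]; exact zero_mem _
    | add x y _ _ hx hy => rw [map_add]; exact add_mem hx hy
    | smul c x _ hx =>
      have : I.mkQ (c • x) = c • I.mkQ x := (I.mkQ.restrictScalars ℂ).map_smul c x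
      rw [this]; exact Submodule.smul_mem _ _ hx
  have hstab : ∀ (a : Hecke l), ∀ x ∈ S, a • x ∈ S := by
    intro a
    induction a using Hecke.induction with
    | scalar r => intro x hx; rw [algebraMap_smul]; exact Submodule.smul_mem _ _ hx
    | add a b ha hb => intro x hx; rw [add_smul]; exact add_mem (ha x hx) (hb x hx)
    | mul a b ha hb => intro x hx; rw [mul_smul]; exact ha _ (hb x hx)
    | w τ =>
      intro x hx
      induction hx using Submodule.span_induction with
      | mem x hx =>
        obtain ⟨σ, rfl⟩ := hx
        exact Submodule.subset_span ⟨τ * σ, by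
          change I.mkQ _ = _ • I.mkQ _
          rw [Hecke.w_mul, ← smul_eq_mul, map_smul]⟩
      | zero => rw [smul_zero]; exact zero_mem _
      | add x y _ _ hx hy => rw [smul_add]; exact add_mem hx hy
      | smul c x _ hx => rw [smul_algebra_smul_comm]; exact Submodule.smul_mem _ _ hx
    | eps j =>
      intro x hx
      induction hx using Submodule.span_induction with
      | mem x hx =>
        obtain ⟨σ, rfl⟩ := hx
        obtain ⟨i, i', hi⟩ := exists_blockIncl Δ hΔ (σ⁻¹ j)
        have h1 := factorHom_sub_mem Δ hΔ i (Hecke.eps i')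
        rw [factorHom_eps, ← hi] at h1
        set c := Hecke.segmentChar (Δ i).len (Δ i).a (Hecke.eps i')
        -- Split ε_j^∨ w into a commutator term in the group algebra, a multiple of ε^∨ - c that
        -- dies in the quotient, and the scalar multiple c w.
        have h2 : Hecke.eps j • I.mkQ (Hecke.w σ) =
            I.mkQ (Hecke.eps j * Hecke.w σ - Hecke.w σ * Hecke.eps (σ⁻¹ j)) +
            Hecke.w σ • I.mkQ (Hecke.eps (σ⁻¹ j) - algebraMap ℂ _ c) + c • I.mkQ (Hecke.w σ) := by
          have h3 : c • I.mkQ (Hecke.w σ) = I.mkQ (Hecke.w σ * algebraMap ℂ _ c) := by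
            rw [← Algebra.commutes, ← Algebra.smul_def]
            exact ((I.mkQ.restrictScalars ℂ).map_smul c _).symm
          rw [h3, ← map_smul, ← map_smul, ← map_add, ← map_add, smul_eq_mul, smul_eq_mul, mul_sub]
          congr 1
          abel
        have h4 : I.mkQ (Hecke.eps (σ⁻¹ j) - algebraMap ℂ _ c) = 0 :=
          (Submodule.Quotient.mk_eq_zero _).mpr h1
        change Hecke.eps j • I.mkQ (Hecke.w σ) ∈ S
        rw [h2, h4, smul_zero, add_zero]
        exact add_mem (hS _ (eps_mul_w_sub_mem σ j))
          (Submodule.smul_mem _ _ (Submodule.subset_span ⟨σ, rfl⟩))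
      | zero => rw [smul_zero]; exact zero_mem _
      | add x y _ _ hx hy => rw [smul_add]; exact add_mem hx hy
      | smul c x _ hx => rw [smul_algebra_smul_comm]; exact Submodule.smul_mem _ _ hx
  rw [eq_top_iff]
  rintro x -
  obtain ⟨a, rfl⟩ := Submodule.mkQ_surjective I x
  have h1 : I.mkQ a = a • I.mkQ (Hecke.w 1) := by
    rw [← map_smul, Hecke.w_one, smul_eq_mul, mul_one]
  rw [h1]
  exact hstab a _ (Submodule.subset_span ⟨1, rfl⟩)

end Induced

/-! ### `F_lam(M(mu))` as an induced module -/

section Standard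

variable {n l : ℕ} (Δ : Fin n → Segment) (hΔ : ∑ i, (Δ i).len = l)

/-- A permutation preserving the blocks is a product of transpositions inside blocks, and each of
these comes from one factor H_{l_i}, where the symmetric group acts trivially on the generator. -/
theorem mkQ_w_of_stabilizer {ρ : Equiv.Perm (Fin l)} (hρ : blockWord Δ hΔ ∘ ρ = blockWord Δ hΔ) :
    (inductionIdeal (parabolicHom Δ hΔ) (parabolicChar Δ)).mkQ (Hecke.w ρ) =
      (inductionIdeal (parabolicHom Δ hΔ) (parabolicChar Δ)).mkQ 1 := by
  set I := inductionIdeal (parabolicHom Δ hΔ) (parabolicChar Δ)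
  set S : Set (Equiv.Perm (Fin l)) := {σ | ∃ x y, x ≠ y ∧ blockWord Δ hΔ x = blockWord Δ hΔ y ∧
    σ = Equiv.swap x y}
  have hS : ρ ∈ Subgroup.closure S := by
    rw [mem_closure_isSwap (by rintro _ ⟨x, y, hxy, -, rfl⟩; exact ⟨x, y, hxy, rfl⟩)]
    refine ⟨Set.toFinite _, fun x => ?_⟩
    by_cases hx : ρ x = x
    · rw [hx]; exact MulAction.mem_orbit_self _
    · refine ⟨⟨Equiv.swap x (ρ x), Subgroup.subset_closure
        ⟨x, ρ x, Ne.symm hx, (congrFun hρ x).symm, rfl⟩⟩, ?_⟩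
      exact Equiv.swap_apply_left _ _
  have hmul : ∀ σ τ, I.mkQ (Hecke.w (σ * τ)) = Hecke.w σ • I.mkQ (Hecke.w τ) := by
    intro σ τ
    rw [Hecke.w_mul, ← smul_eq_mul, map_smul]
  have hone : ∀ σ, Hecke.w σ • I.mkQ 1 = I.mkQ (Hecke.w σ) := by
    intro σ
    rw [← map_smul, smul_eq_mul, mul_one]
  clear hρ
  induction hS using Subgroup.closure_induction with
  | mem σ hσ =>
    obtain ⟨x, y, -, hxy, rfl⟩ := hσ
    obtain ⟨j, hj⟩ := (blockWord_eq_iff Δ hΔ _ x).mp rfl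
    obtain ⟨j', hj'⟩ := (blockWord_eq_iff Δ hΔ _ y).mp hxy.symm
    have h := factorHom_sub_mem Δ hΔ (blockWord Δ hΔ x) (Hecke.w (Equiv.swap j j'))
    rw [factorHom_w, Hecke.viaEmbedding_swap, hj, hj', Hecke.segmentChar, Hecke.lift_w,
      MonoidHom.one_apply, map_one] at h
    rw [← sub_eq_zero, ← map_sub]
    exact (Submodule.Quotient.mk_eq_zero _).mpr h
  | one => rw [Hecke.w_one]
  | mul σ τ _ _ hσ hτ => rw [hmul, hτ, hone, hσ]
  | inv σ _ hσ =>
    have h := hmul σ⁻¹ σ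
    rw [inv_mul_cancel, Hecke.w_one, hσ, hone] at h
    exact h.symm

theorem exists_of_content {p : Fin l → Fin n} (hp : content p = fun i => (Δ i).len) :
    ∃ σ : Equiv.Perm (Fin l), blockWord Δ hΔ ∘ σ.symm = p := by
  obtain ⟨σ, hσ⟩ := exists_perm_of_content_eq (hp.trans (content_blockWord Δ hΔ).symm)
  exact ⟨σ.symm, hσ.symm⟩

/-! ### The cyclic vector and the comparison with the induced module. -/

variable [NeZero n] (lam mu : CartanDual n)
  (hc : ∃ c : ℂ, ∀ i, (lam - mu).1 i = (Δ i).len + c)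

/-- The class of `v ⊗ (e_1^{⊗ l_1} ⊗ e_2^{⊗ l_2} ⊗ ⋯)` in `F_lam(M(mu))`. -/
def sortedVector : FunctorF l lam (Verma mu) :=
  weightEquiv mu l lam ⟨wordBasis n l (blockWord Δ hΔ),
    wordBasis_mem_weightSpace hΔ hc (content_blockWord Δ hΔ)⟩

theorem w_smul_sortedVector (σ : Equiv.Perm (Fin l)) :
    (Hecke.w σ • sortedVector Δ hΔ lam mu hc).1 =
      coinvClass (Verma.hwv mu) (wordBasis n l (blockWord Δ hΔ ∘ σ.symm)) := by
  rw [Submodule.coe_smul, sortedVector, weightEquiv_apply, w_smul_coinvClass, reindex_wordBasis]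

theorem eps_smul_sortedVector (i : Fin l) : Hecke.eps i • sortedVector Δ hΔ lam mu hc =
    sortedWeight (mu + rho n).1 (blockWord Δ hΔ) i • sortedVector Δ hΔ lam mu hc := by
  apply Subtype.ext
  change Hecke.eps i • coinvClass (Verma.hwv mu) _ = _ • coinvClass (Verma.hwv mu) _
  rw [eps_smul_hwv, wordOp_of_monotone _ (blockWord_monotone Δ hΔ), map_smul]

/-- Words of the same content differ by a permutation of positions, so the symmetric group alone
already generates the weight space from the sorted word. -/
theorem sortedVector_span :
    Submodule.span (Hecke l) {sortedVector Δ hΔ lam mu hc} = ⊤ := by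
  rw [eq_top_iff]
  rintro q -
  obtain ⟨⟨t, ht⟩, rfl⟩ := (weightEquiv mu l lam).surjective q
  have h : (weightEquiv mu l lam ⟨t, ht⟩) = ∑ p, if hp : content p = fun i => (Δ i).len then
      (wordBasis n l).repr t p • Hecke.w (exists_of_content Δ hΔ hp).choose •
        sortedVector Δ hΔ lam mu hc else 0 := by
    apply Subtype.ext
    have e : coinvClass (Verma.hwv mu) t = ∑ p,
        coinvClass (Verma.hwv mu) ((wordBasis n l).repr t p • wordBasis n l p) := by
      rw [← map_sum, (wordBasis n l).sum_repr t]
    rw [weightEquiv_apply, AddSubmonoidClass.coe_finsetSum, e]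
    refine Finset.sum_congr rfl fun p _ => ?_
    split_ifs with hp
    · have := w_smul_sortedVector Δ hΔ lam mu hc (exists_of_content Δ hΔ hp).choose
      rw [(exists_of_content Δ hΔ hp).choose_spec] at this
      rw [map_smul, ← this]
      rfl
    · have := not_imp_comm.mp ((mem_weightSpace_iff hΔ hc t).mp ht p) hp
      rw [this, zero_smul, map_zero]
      rfl
  rw [h]
  refine Submodule.sum_mem _ fun p _ => ?_
  split_ifs with hp
  · rw [← algebraMap_smul (Hecke l)]
    exact Submodule.smul_mem _ _ (Submodule.smul_mem _ _ (Submodule.mem_span_singleton_self _))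
  · exact zero_mem _

/-- The sorted vector transforms by the inducing character, which gives a homomorphism g from the
induced module, onto by cyclicity. Injectivity needs no dimension count: on the spanning classes of
w, g takes values in a basis of words, and a word determines the class of w. -/
theorem nonempty_functorF_equiv (hc : ∃ c : ℂ, ∀ i, (lam - mu).1 i = (Δ i).len + c)
    (ha : ∀ i, (Δ i).a = (mu + rho n).1 i) :
    Nonempty (FunctorF l lam (Verma mu) ≃ₗ[Hecke l] SegmentModule Δ hΔ) := by
  set I := inductionIdeal (parabolicHom Δ hΔ) (parabolicChar Δ) with hI
  set u := sortedVector Δ hΔ lam mu hc with hu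
  have hker : I ≤ LinearMap.ker (LinearMap.toSpanSingleton (Hecke l) _ u) := by
    intro a haI
    rw [LinearMap.mem_ker, LinearMap.toSpanSingleton_apply]
    refine inductionIdeal_smul_eq_zero Δ hΔ u ?_ ?_ a haI
    · intro i σ
      apply Subtype.ext
      rw [factorHom_w, hu, w_smul_sortedVector, sortedVector, weightEquiv_apply]
      congr 2
      ext1 x
      change blockWord Δ hΔ ((σ.viaEmbedding (blockIncl Δ hΔ i))⁻¹ x) = _
      have h1 : ∀ y, blockWord Δ hΔ (σ.viaEmbedding (blockIncl Δ hΔ i) y) = blockWord Δ hΔ y := by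
        intro y
        by_cases hy : y ∈ Set.range (blockIncl Δ hΔ i)
        · obtain ⟨j, rfl⟩ := hy
          rw [Equiv.Perm.viaEmbedding_apply, blockWord_blockIncl, blockWord_blockIncl]
        · rw [Equiv.Perm.viaEmbedding_apply_of_notMem _ _ _ hy]
      rw [← h1, Equiv.Perm.coe_inv, Equiv.apply_symm_apply]
    · intro i j
      rw [factorHom_eps, hu, eps_smul_sortedVector, sortedWeight_blockIncl, ha]
  let g : SegmentModule Δ hΔ →ₗ[Hecke l] FunctorF l lam (Verma mu) :=
    I.liftQ (LinearMap.toSpanSingleton (Hecke l) _ u) hker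
  have hgw : ∀ σ, (g (I.mkQ (Hecke.w σ))).1 =
      coinvClass (Verma.hwv mu) (wordBasis n l (blockWord Δ hΔ ∘ σ.symm)) :=
    fun σ => w_smul_sortedVector Δ hΔ lam mu hc σ
  -- Permutations giving the same word lie in one coset of the Young subgroup, hence have the same
  -- class.
  have hwd : ∀ σ τ : Equiv.Perm (Fin l), blockWord Δ hΔ ∘ σ.symm = blockWord Δ hΔ ∘ τ.symm →
      I.mkQ (Hecke.w σ) = I.mkQ (Hecke.w τ) := by
    intro σ τ hστ
    have h1 : blockWord Δ hΔ ∘ (σ⁻¹ * τ : Equiv.Perm (Fin l)) = blockWord Δ hΔ := by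
      ext1 x
      have := congrFun hστ (τ x)
      simpa using this
    have h2 : Hecke.w τ = Hecke.w σ • Hecke.w (σ⁻¹ * τ) := by
      rw [smul_eq_mul, ← Hecke.w_mul, mul_inv_cancel_left]
    rw [h2, map_smul, mkQ_w_of_stabilizer Δ hΔ h1, ← map_smul, smul_eq_mul, mul_one]
  -- A left inverse of g in the word model, well behaved by `hwd`; the value 0 on words of other
  -- content is arbitrary.
  let θ : TensorPow n l →ₗ[ℂ] SegmentModule Δ hΔ := (wordBasis n l).constr ℂ fun p =>
    if hp : ∃ σ : Equiv.Perm (Fin l), blockWord Δ hΔ ∘ σ.symm = p then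
      I.mkQ (Hecke.w hp.choose) else 0
  have hθ : ∀ σ : Equiv.Perm (Fin l), θ (wordBasis n l (blockWord Δ hΔ ∘ σ.symm)) =
      I.mkQ (Hecke.w σ) := by
    intro σ
    have hp : ∃ τ : Equiv.Perm (Fin l), blockWord Δ hΔ ∘ τ.symm = blockWord Δ hΔ ∘ σ.symm :=
      ⟨σ, rfl⟩
    simp only [θ, Module.Basis.constr_basis]
    rw [dif_pos hp]
    exact hwd _ _ hp.choose_spec
  refine ⟨(LinearEquiv.ofBijective g ⟨?_, ?_⟩).symm⟩
  · rw [injective_iff_map_eq_zero]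
    intro x hx
    have hx' : x ∈ Submodule.span ℂ (Set.range fun σ => I.mkQ (Hecke.w σ)) := by
      have h := span_mk_w_eq_top Δ hΔ
      exact h ▸ Submodule.mem_top
    obtain ⟨c, rfl⟩ := (Submodule.mem_span_range_iff_exists_fun ℂ).mp hx'
    have h1 : ∑ σ, c σ • wordBasis n l (blockWord Δ hΔ ∘ (σ : Equiv.Perm (Fin l)).symm) = 0 := by
      apply coinvClass_hwv_injective mu
      rw [map_sum, map_zero, ← Submodule.coe_zero (p := FunctorF l lam (Verma mu)), ← hx, map_sum,
        AddSubmonoidClass.coe_finsetSum]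
      refine Finset.sum_congr rfl fun σ _ => ?_
      rw [map_smul, ← hgw]
      exact congrArg Subtype.val ((g.restrictScalars ℂ).map_smul (c σ) _).symm
    have h2 := congrArg θ h1
    rw [map_sum, map_zero] at h2
    rw [← h2]
    refine Finset.sum_congr rfl fun σ _ => ?_
    rw [map_smul, hθ]
  · rw [← LinearMap.range_eq_top, eq_top_iff, ← sortedVector_span Δ hΔ lam mu hc,
      Submodule.span_le, Set.singleton_subset_iff]
    refine ⟨I.mkQ 1, ?_⟩
    change (1 : Hecke l) • u = u
    exact one_smul _ _

theorem subsingleton_functorF {lam mu : CartanDual n} (h : lam - mu ∉ weights (TensorPow n l)) :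
    Subsingleton (FunctorF l lam (Verma mu)) := by
  have h0 : ∀ a : weightSpace l (lam - mu), a = 0 := by
    intro a
    by_contra ha
    exact h ⟨a.1, fun e => ha (Subtype.ext e), a.2⟩
  have : Subsingleton (weightSpace l (lam - mu)) := ⟨fun a b => by rw [h0 a, h0 b]⟩
  exact (weightEquiv mu l lam).symm.injective.subsingleton

end Standard

/-! ### Injectivity of lowering operators -/

section Sl2

variable {V : Type*} [AddCommGroup V] [Module ℂ V] {e f h : Module.End ℂ V}

theorem sl2_h_pow (hhf : h * f - f * h = -((2 : ℂ) • f)) {v : V} {w : ℂ} (hv : h v = w • v) (r : ℕ) :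
    h ((f ^ r) v) = (w - 2 * r) • (f ^ r) v := by
  induction r with
  | zero => simpa using hv
  | succ r ih =>
    have h1 := LinearMap.congr_fun hhf ((f ^ r) v)
    simp only [LinearMap.sub_apply, Module.End.mul_apply, LinearMap.neg_apply,
      LinearMap.smul_apply, ih, map_smul] at h1
    rw [pow_succ', Module.End.mul_apply, eq_add_of_sub_eq h1]
    push_cast
    module

/-- Commuting e past f^{r+1} collects the h-weights w, w - 2, …, w - 2r, whose sum is (r + 1)(w -
r). -/
theorem sl2_e_pow (hef : e * f - f * e = h) (hhf : h * f - f * h = -((2 : ℂ) • f)) {v : V} {w : ℂ}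
    (hv : h v = w • v) (r : ℕ) :
    e ((f ^ (r + 1)) v) = (f ^ (r + 1)) (e v) + ((r + 1) * (w - r)) • (f ^ r) v := by
  induction r with
  | zero =>
    have h1 := LinearMap.congr_fun hef v
    simp only [LinearMap.sub_apply, Module.End.mul_apply, hv] at h1
    simp [eq_add_of_sub_eq' h1]
  | succ r ih =>
    have h1 := LinearMap.congr_fun hef ((f ^ (r + 1)) v)
    simp only [LinearMap.sub_apply, Module.End.mul_apply, sl2_h_pow hhf hv, ih, map_add,
      map_smul] at h1
    rw [pow_succ' f (r + 1), Module.End.mul_apply, Module.End.mul_apply, eq_add_of_sub_eq h1,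
      pow_succ' f r, Module.End.mul_apply, Module.End.mul_apply]
    push_cast
    module

/-- If `e` is locally nilpotent, then `f ^ r` is injective on the vectors of weight at least `r`. -/
theorem sl2_eq_zero (hef : e * f - f * e = h) (hhe : h * e - e * h = (2 : ℂ) • e)
    (hhf : h * f - f * h = -((2 : ℂ) • f)) (N r w : ℕ) (v : V) (hN : (e ^ N) v = 0)
    (hv : h v = (w : ℂ) • v) (hr : (f ^ r) v = 0) (hrw : r ≤ w) : v = 0 := by
  induction N generalizing r w v with
  | zero => simpa using hN
  | succ N ih =>
    -- If f^r v = 0 with r > 0, the commutation formula gives f^{r+1} (e v) = 0. As e v has weight w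
    -- + 2 and a smaller order of nilpotency, the induction on N applies to it.
    have hev : e v = 0 := by
      cases r with
      | zero =>
        have : v = 0 := by simpa using hr
        rw [this, map_zero]
      | succ r =>
        refine ih (r + 2) (w + 2) (e v) ?_ ?_ ?_ (by omega)
        · rw [← Module.End.mul_apply, ← pow_succ]; exact hN
        · have h1 := LinearMap.congr_fun hhe v
          simp only [LinearMap.sub_apply, Module.End.mul_apply, LinearMap.smul_apply, hv,
            map_smul] at h1
          rw [eq_add_of_sub_eq h1]
          push_cast
          module
        · have h1 := sl2_e_pow hef hhf hv (r + 1)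
          have h2 : (f ^ (r + 1 + 1)) v = 0 := by
            rw [pow_succ', Module.End.mul_apply, hr, map_zero]
          rw [h2, hr, map_zero, smul_zero, add_zero] at h1
          exact h1.symm
    clear ih
    -- Once e v = 0, applying e to f^{r+1} v = 0 leaves (r + 1)(w - r) f^r v = 0, and the
    -- coefficient is nonzero because r < w.
    induction r with
    | zero => simpa using hr
    | succ r ihr =>
      have h1 := sl2_e_pow hef hhf hv r
      rw [hr, hev, map_zero, map_zero, zero_add] at h1
      refine ihr ((smul_eq_zero.mp h1.symm).resolve_left ?_) (by omega)
      refine mul_ne_zero (by exact_mod_cast Nat.succ_ne_zero r) (sub_ne_zero.mpr ?_)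
      exact_mod_cast (by omega : w ≠ r)

end Sl2

/-! ### Root vectors and their sl_2-triples on V_n^{⊗ l}. -/

section TensorSl2

variable {n l : ℕ}

theorem lie_traceless_traceless {a b : Fin n} (hab : a ≠ b) :
    ⁅traceless a b, traceless b a⁆ = traceless a a - traceless b b := by
  apply Subtype.ext
  ext i j
  rw [SL_lie_apply]
  change _ = (traceless a a).1 i j - (traceless b b).1 i j
  simp only [traceless_apply, hab, hab.symm, false_and, if_false, sub_zero, true_and, ite_and,
    mul_ite, mul_one, mul_zero]
  by_cases h1 : a = i <;> by_cases h2 : b = i <;> by_cases h3 : a = j <;> by_cases h4 : b = j <;>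
    (simp_all; try ring)

theorem lie_cartan_traceless {h : SL n} (hh : h ∈ cartan n) {a b : Fin n} (hab : a ≠ b) :
    ⁅h, traceless a b⁆ = (h.1 a a - h.1 b b) • traceless a b := by
  apply Subtype.ext
  ext i j
  rw [SL_lie_apply, Finset.sum_eq_single i, Finset.sum_eq_single j]
  · change _ = (h.1 a a - h.1 b b) * (traceless a b).1 i j
    simp only [traceless_apply, hab, false_and, if_false, sub_zero]
    by_cases h1 : a = i ∧ b = j
    · rw [if_pos h1, ← h1.1, ← h1.2]; ring
    · rw [if_neg h1]; ring
  · intro k _ hk; rw [hh k j hk, mul_zero]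
  · simp
  · intro k _ hk; rw [hh i k (Ne.symm hk), zero_mul]
  · simp

theorem cartan_diff_mem (a b : Fin n) : (traceless a a - traceless b b : SL n) ∈ cartan n :=
  sub_mem (traceless_mem_cartan a) (traceless_mem_cartan b)

theorem cartan_diff_apply (a b i : Fin n) : (traceless a a - traceless b b : SL n).1 i i =
    (if a = i then 1 else 0) - (if b = i then 1 else 0) := by
  change (traceless a a).1 i i - (traceless b b).1 i i = _
  simp only [traceless_apply, and_self, if_true]
  ring

variable {X : Type*} [AddCommGroup X] [Module ℂ X] [LieRingModule (SL n) X] [LieModule ℂ (SL n) X]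

theorem toEnd_ef {a b : Fin n} (hab : a ≠ b) :
    LieModule.toEnd ℂ (SL n) X (traceless a b) * LieModule.toEnd ℂ (SL n) X (traceless b a) -
      LieModule.toEnd ℂ (SL n) X (traceless b a) * LieModule.toEnd ℂ (SL n) X (traceless a b) =
      LieModule.toEnd ℂ (SL n) X (traceless a a - traceless b b) := by
  rw [← lie_traceless_traceless hab, LieHom.map_lie, LieRing.of_associative_ring_bracket]

theorem toEnd_he {a b : Fin n} (hab : a ≠ b) :
    LieModule.toEnd ℂ (SL n) X (traceless a a - traceless b b) *
      LieModule.toEnd ℂ (SL n) X (traceless a b) -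
      LieModule.toEnd ℂ (SL n) X (traceless a b) *
      LieModule.toEnd ℂ (SL n) X (traceless a a - traceless b b) =
      (2 : ℂ) • LieModule.toEnd ℂ (SL n) X (traceless a b) := by
  rw [← LieRing.of_associative_ring_bracket, ← LieHom.map_lie,
    lie_cartan_traceless (cartan_diff_mem a b) hab, cartan_diff_apply, cartan_diff_apply, map_smul]
  simp only [if_true, hab, hab.symm, if_false]
  norm_num

theorem toEnd_hf {a b : Fin n} (hab : a ≠ b) :
    LieModule.toEnd ℂ (SL n) X (traceless a a - traceless b b) *
      LieModule.toEnd ℂ (SL n) X (traceless b a) -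
      LieModule.toEnd ℂ (SL n) X (traceless b a) *
      LieModule.toEnd ℂ (SL n) X (traceless a a - traceless b b) =
      -((2 : ℂ) • LieModule.toEnd ℂ (SL n) X (traceless b a)) := by
  rw [← LieRing.of_associative_ring_bracket, ← LieHom.map_lie,
    lie_cartan_traceless (cartan_diff_mem a b) hab.symm, cartan_diff_apply, cartan_diff_apply,
    map_smul, ← neg_smul]
  simp only [if_true, hab, hab.symm, if_false]
  norm_num

/-- The action is a sum of commuting operators, one for each slot, each of square zero. -/
theorem isNilpotent_toEnd_traceless {a b : Fin n} (hab : a ≠ b) :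
    IsNilpotent (LieModule.toEnd ℂ (SL n) (TensorPow n l) (traceless a b)) := by
  have h1 : LieModule.toEnd ℂ (SL n) (TensorPow n l) (traceless a b) =
      ∑ i, slot i (LieModule.toEnd ℂ (SL n) (Fin n → ℂ) (traceless a b)) := by
    ext t; rfl
  rw [h1]
  refine Commute.isNilpotent_sum (fun i _ => ⟨2, ?_⟩) fun i j _ _ => ?_
  swap
  · by_cases hij : i = j
    · rw [hij]; exact Commute.refl _
    · exact slot_comm hij _ _
  refine (wordBasis n l).ext fun p => ?_
  rw [pow_two, Module.End.mul_apply, slot_traceless_of_ne i hab]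
  split_ifs with h
  · rw [slot_traceless_of_ne i hab, if_neg (by simpa using hab)]; rfl
  · rw [map_zero]; rfl

/-- Injectivity of powers of root vectors of `sl_n` on `V_n^{⊗ l}`. -/
theorem toEnd_pow_traceless_injective {a b : Fin n} (hab : a ≠ b) {r w : ℕ} (hrw : r ≤ w)
    {t : TensorPow n l} (ht : ⁅(traceless a a - traceless b b : SL n), t⁆ = (w : ℂ) • t)
    (h0 : (LieModule.toEnd ℂ (SL n) (TensorPow n l) (traceless b a) ^ r) t = 0) : t = 0 := by
  obtain ⟨N, hN⟩ := isNilpotent_toEnd_traceless (l := l) hab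
  exact sl2_eq_zero (toEnd_ef hab) (toEnd_he hab) (toEnd_hf hab) N r w t (by rw [hN]; rfl) ht h0 hrw

theorem lie_cartan_diff_of_content {K : Fin n → ℕ} {t : TensorPow n l}
    (ht : ∀ p, (wordBasis n l).repr t p ≠ 0 → content p = K) (a b : Fin n) :
    ⁅(traceless a a - traceless b b : SL n), t⁆ = ((K a : ℂ) - K b) • t := by
  rw [← (wordBasis n l).sum_repr t, lie_sum, Finset.smul_sum]
  refine Finset.sum_congr rfl fun p _ => ?_
  rw [lie_smul]
  by_cases hp : (wordBasis n l).repr t p = 0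
  · rw [hp, zero_smul, zero_smul, smul_zero]
  · rw [cartan_lie_wordBasis (cartan_diff_mem a b),
      sum_comp_eq_content p (fun i => (traceless a a - traceless b b : SL n).1 i i), ht p hp,
      smul_comm]
    congr 2
    simp only [cartan_diff_apply, mul_sub, mul_ite, mul_one, mul_zero, Finset.sum_sub_distrib,
      Finset.sum_ite_eq, Finset.mem_univ, if_true]

/-- The hypothesis `h0` says E_ab t = 0 for the vector t with coefficients c. For the triple in
which E_ab is the lowering operator, t has weight K_b - K_a > 0, where lowering is injective. -/
theorem coeff_eq_zero_of_raise {a b : Fin n} (hab : a ≠ b) {K : Fin n → ℕ} (hK : K a < K b)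
    {c : (Fin l → Fin n) → ℂ} (hc : ∀ p, c p ≠ 0 → content p = K)
    (h0 : ∀ p : Fin l → Fin n, (∑ j, if p j = a then c (Function.update p j b) else 0) = 0)
    (p : Fin l → Fin n) : c p = 0 := by
  set t : TensorPow n l := (wordBasis n l).equivFun.symm c with ht
  have hrepr : ∀ p, (wordBasis n l).repr t p = c p := fun p =>
    congrFun ((wordBasis n l).equivFun.apply_symm_apply c) p
  have h1 : t = 0 := by
    refine toEnd_pow_traceless_injective (r := 1) (w := K b - K a) hab.symm (by omega) ?_ ?_
    · rw [lie_cartan_diff_of_content (K := K) (fun p hp => hc p (by rwa [← hrepr])),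
        Nat.cast_sub hK.le]
    · rw [pow_one]
      apply (wordBasis n l).repr.injective
      ext q
      rw [LieModule.toEnd_apply_apply, repr_lie_traceless hab, map_zero, Finsupp.zero_apply]
      simp only [hrepr]
      exact h0 q
  rw [← hrepr, h1, map_zero, Finsupp.zero_apply]

end TensorSl2

/-! ### Uniqueness of eigenvectors -/

section Eigen

variable {n l : ℕ}

/-- The word `q a`. -/
def snocWord (q : Fin l → Fin n) (a : Fin n) : Fin (l + 1) → Fin n :=
  Fin.snoc (α := fun _ => Fin n) q a

@[simp]
theorem snocWord_castSucc (q : Fin l → Fin n) (a : Fin n) (j : Fin l) :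
    snocWord q a j.castSucc = q j := Fin.snoc_castSucc (α := fun _ => Fin n) a q j

@[simp]
theorem snocWord_last (q : Fin l → Fin n) (a : Fin n) : snocWord q a (Fin.last l) = a :=
  Fin.snoc_last (α := fun _ => Fin n) a q

theorem eq_snocWord (p : Fin (l + 1) → Fin n) :
    p = snocWord (fun j => p j.castSucc) (p (Fin.last l)) := by
  ext1 j
  induction j using Fin.lastCases with
  | last => simp
  | cast j => simp

theorem content_snocWord (q : Fin l → Fin n) (a b : Fin n) :
    content (snocWord q a) b = content q b + if a = b then 1 else 0 := by
  simp only [content, Finset.card_filter]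
  rw [Fin.sum_univ_castSucc]
  simp

theorem snocWord_comp_swap_last (q : Fin l → Fin n) (a : Fin n) (j : Fin l) :
    snocWord q a ∘ Equiv.swap (Fin.last l) j.castSucc = snocWord (Function.update q j a) (q j) := by
  ext1 k
  induction k using Fin.lastCases with
  | last => simp
  | cast k =>
    by_cases hk : k = j
    · subst hk; simp
    · rw [Function.comp_apply, Equiv.swap_apply_of_ne_of_ne (Fin.castSucc_lt_last k).ne
        (by simpa using hk)]
      simp [hk]

theorem snocWord_comp_swap (q : Fin l → Fin n) (a : Fin n) (i j : Fin l) :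
    snocWord q a ∘ Equiv.swap i.castSucc j.castSucc = snocWord (q ∘ Equiv.swap i j) a := by
  ext1 k
  induction k using Fin.lastCases with
  | last =>
    rw [Function.comp_apply, Equiv.swap_apply_of_ne_of_ne (Fin.castSucc_lt_last _).ne'
      (Fin.castSucc_lt_last _).ne']
    simp
  | cast k =>
    rw [Function.comp_apply, ← (Fin.castSucc_injective l).map_swap]
    simp

/-- Every other position precedes the last one, so the first sum runs over all of them and the
second removes those with a letter larger than a. -/
theorem coeffOp_last (m : Fin n → ℂ) (c : (Fin (l + 1) → Fin n) → ℂ) (q : Fin l → Fin n)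
    (a : Fin n) : coeffOp m (Fin.last l) c (snocWord q a) = m a * c (snocWord q a) +
      ∑ j, if q j ≤ a then c (snocWord (Function.update q j a) (q j)) else 0 := by
  rw [coeffOp, add_sub_assoc, Finset.sum_filter, Finset.sum_filter, ← Finset.sum_sub_distrib,
    Fin.sum_univ_castSucc, snocWord_last]
  congr 1
  simp only [snocWord_castSucc, snocWord_comp_swap_last, Fin.castSucc_lt_last,
    if_true, lt_irrefl, if_false, sub_zero, add_zero]
  refine Finset.sum_congr rfl fun j _ => ?_
  by_cases h : q j ≤ a
  · rw [if_pos h, if_neg (not_lt.mpr h), sub_zero]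
  · rw [if_neg h, if_pos (not_le.mp h), sub_self]

/-- The only extra term on the longer word is the exchange with the last position, made when q_i <
z; it puts a letter other than z at the end, where c vanishes. This permits the induction on length.
-/
theorem coeffOp_castSucc (m : Fin n → ℂ) (c : (Fin (l + 1) → Fin n) → ℂ) (z : Fin n)
    (hz : ∀ q : Fin l → Fin n, ∀ a, a ≠ z → c (snocWord q a) = 0) (i : Fin l) (q : Fin l → Fin n) :
    coeffOp m i.castSucc c (snocWord q z) = coeffOp m i (fun q => c (snocWord q z)) q := by
  rw [coeffOp, coeffOp]
  simp only [Finset.sum_filter, Fin.sum_univ_castSucc, snocWord_castSucc, snocWord_last,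
    snocWord_comp_swap, Fin.castSucc_lt_castSucc_iff, (Fin.castSucc_lt_last _).not_gt, if_false,
    add_zero]
  have h : (if q i < z then c (snocWord q z ∘ Equiv.swap i.castSucc (Fin.last l)) else 0) = 0 := by
    rw [Equiv.swap_comm, snocWord_comp_swap_last]
    split_ifs with h
    · exact hz _ _ h.ne
    · rfl
  rw [h, add_zero]

theorem sortedWeight_last (m : Fin n → ℂ) (q : Fin l → Fin n) (a : Fin n) :
    sortedWeight m (snocWord q a) (Fin.last l) = m a + content q a := by
  simp only [sortedWeight, content, Finset.card_filter, Fin.sum_univ_castSucc, snocWord_castSucc,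
    snocWord_last, Fin.castSucc_lt_last, true_and, lt_irrefl, false_and, if_false, add_zero]

theorem sortedWeight_castSucc (m : Fin n → ℂ) (q : Fin l → Fin n) (a : Fin n) (i : Fin l) :
    sortedWeight m (snocWord q a) i.castSucc = sortedWeight m q i := by
  simp only [sortedWeight, Finset.card_filter, Fin.sum_univ_castSucc, snocWord_castSucc,
    snocWord_last, Fin.castSucc_lt_castSucc_iff, (Fin.castSucc_lt_last _).not_gt, false_and,
    if_false, add_zero]

theorem exists_of_content_pos {p : Fin l → Fin n} {a : Fin n} (h : 0 < content p a) :
    ∃ i, p i = a := by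
  obtain ⟨i, hi⟩ := Finset.card_pos.mp h
  exact ⟨i, (Finset.mem_filter.mp hi).2⟩

/-- For a suitably ordered sequence of segments, the sorted word is the only eigenvector of its
weight. -/
theorem coeff_eq_zero_of_eigen (m : Fin n → ℂ) (p₀ : Fin l → Fin n) (hp₀ : Monotone p₀)
    (hord : ∀ a b, a < b → 0 < content p₀ a → 0 < content p₀ b →
      ∃ d : ℕ, m a + content p₀ a = m b + content p₀ b + d ∧
        (d = 0 → content p₀ a ≤ content p₀ b))
    (c : (Fin l → Fin n) → ℂ) (hc : ∀ p, c p ≠ 0 → content p = content p₀)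
    (heig : ∀ i p, coeffOp m i c p = sortedWeight m p₀ i * c p) (p : Fin l → Fin n) (hp : p ≠ p₀) :
    c p = 0 := by
  induction l with
  | zero => exact absurd (Subsingleton.elim _ _) hp
  | succ l ih =>
    obtain ⟨q₀, z, rfl⟩ : ∃ q z, p₀ = snocWord q z := ⟨_, _, eq_snocWord p₀⟩
    have hle : ∀ a, 0 < content (snocWord q₀ z) a → a ≤ z := by
      intro a ha
      obtain ⟨i, rfl⟩ := exists_of_content_pos ha
      have := hp₀ (Fin.le_last i)
      rwa [snocWord_last] at this
    have hzpos : 0 < content (snocWord q₀ z) z := by rw [content_snocWord]; simp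
    have hpos : ∀ q a, c (snocWord q a) ≠ 0 → 0 < content (snocWord q₀ z) a := by
      intro q a h
      rw [← hc _ h, content_snocWord]
      simp
    -- the equation for the last letter
    have hrow : ∀ q a, (∑ j, if q j < a then c (snocWord (Function.update q j a) (q j)) else 0) =
        (m z + content (snocWord q₀ z) z - (m a + content (snocWord q₀ z) a)) *
          c (snocWord q a) := by
      intro q a
      have h1 := heig (Fin.last l) (snocWord q a)
      rw [coeffOp_last, sortedWeight_last] at h1
      have h2 : (∑ j, if q j ≤ a then c (snocWord (Function.update q j a) (q j)) else 0) =
          (∑ j, if q j < a then c (snocWord (Function.update q j a) (q j)) else 0) +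
            content q a * c (snocWord q a) := by
        rw [content, Finset.card_filter, Nat.cast_sum, Finset.sum_mul, ← Finset.sum_add_distrib]
        refine Finset.sum_congr rfl fun j _ => ?_
        rcases lt_trichotomy (q j) a with h | h | h
        · simp [h, h.le, h.ne]
        · subst h; simp
        · simp [h.not_ge, h.not_gt, h.ne']
      by_cases h3 : c (snocWord q a) = 0
      · rw [h2, h3] at h1
        rw [h3]
        linear_combination h1
      · have h4 := congrFun (hc _ h3) a
        rw [content_snocWord q a, if_pos rfl] at h4
        have h5 := content_snocWord q₀ z z
        rw [if_pos rfl] at h5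
        rw [h2] at h1
        rw [← h4, h5]
        push_cast
        linear_combination h1
    -- Words ending in a letter a < z are excluded by strong induction on a. In `hrow` the left side
    -- only involves words with a smaller last letter, so it vanishes, and a nonzero factor on the
    -- right ends the argument.
    have hlt : ∀ a, a < z → ∀ q, c (snocWord q a) = 0 := by
      intro a
      induction a using WellFoundedLT.induction with
      | ind a iha =>
      intro haz
      have hbelow : ∀ b < a, ∀ q, c (snocWord q b) = 0 := fun b hb => iha b hb (hb.trans haz)
      by_cases ha0 : 0 < content (snocWord q₀ z) a
      swap
      · intro q
        by_contra h
        exact ha0 (hpos q a h)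
      by_cases hr : m a + content (snocWord q₀ z) a = m z + content (snocWord q₀ z) z
      swap
      · intro q
        have h1 := hrow q a
        rw [Finset.sum_eq_zero] at h1
        · exact (mul_eq_zero.mp h1.symm).resolve_left (sub_ne_zero.mpr (Ne.symm hr))
        · intro j _
          split_ifs with h
          · exact hbelow _ h _
          · rfl
      -- In the resonant case the row of a carries no information. The row of the next occurring
      -- letter b is used instead.
      obtain ⟨b, ⟨hab, hb0⟩, hbmin⟩ : ∃ b, (a < b ∧ 0 < content (snocWord q₀ z) b) ∧
          ∀ x, a < x ∧ 0 < content (snocWord q₀ z) x → b ≤ x := by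
        obtain ⟨b, hb, hmin⟩ := WellFounded.has_min (wellFounded_lt (α := Fin n))
          {x | a < x ∧ 0 < content (snocWord q₀ z) x} ⟨z, haz, hzpos⟩
        exact ⟨b, hb, fun x hx => not_lt.mp (hmin x hx)⟩
      obtain ⟨d, hd, hd'⟩ := hord a b hab ha0 hb0
      have hbz : ∃ d' : ℕ, m b + content (snocWord q₀ z) b = m z + content (snocWord q₀ z) z + d' := by
        rcases (hle b hb0).lt_or_eq with h | h
        · obtain ⟨d', h', -⟩ := hord b z h hb0 hzpos
          exact ⟨d', h'⟩
        · exact ⟨0, by rw [h]; simp⟩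
      obtain ⟨d', hd2⟩ := hbz
      -- The right ends descend from a to b to z by d and d', while those of a and z agree. So both
      -- steps are zero, and the hypothesis on lengths applies to a and b.
      have hdd : d' + d = 0 := by
        have : ((d' + d : ℕ) : ℂ) = 0 := by push_cast; linear_combination hr - hd - hd2
        exact_mod_cast this
      have hd0 : d = 0 := by omega
      have hd0' : d' = 0 := by omega
      subst hd0; subst hd0'
      have hLab := hd' rfl
      -- Removing the final a leaves the content with one letter a less, so K_a < K_b follows from
      -- the weak inequality of lengths. The row of b, whose right side is now zero, is the required
      -- equation: smaller letters than a contribute nothing by induction, and no letter strictly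
      -- between a and b occurs.
      refine coeff_eq_zero_of_raise hab.ne (K := fun x => content (snocWord q₀ z) x -
        if a = x then 1 else 0) (by simp only [if_true, hab.ne, if_false]; omega) ?_ ?_
      · intro q hq
        ext x
        rw [← hc _ hq, content_snocWord]
        simp
      · intro q
        have h1 := hrow q b
        rw [hd2, Nat.cast_zero, add_zero, sub_self, zero_mul] at h1
        refine Eq.trans (Finset.sum_congr rfl fun j _ => ?_) h1
        by_cases h : q j = a
        · rw [if_pos h, if_pos (by rw [h]; exact hab), h]
        · rw [if_neg h]
          split_ifs with h2
          · rcases lt_or_gt_of_ne h with h3 | h3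
            · exact (hbelow _ h3 _).symm
            · by_contra h4
              exact absurd (hbmin _ ⟨h3, hpos _ _ (Ne.symm h4)⟩) (not_le.mpr h2)
          · rfl
    have hne : ∀ q a, a ≠ z → c (snocWord q a) = 0 := by
      intro q a ha
      by_contra h
      rcases lt_or_gt_of_ne ha with h1 | h1
      · exact h (hlt a h1 q)
      · exact absurd (hle a (hpos q a h)) (not_le.mpr h1)
    rw [eq_snocWord p]
    by_cases hpz : p (Fin.last l) = z
    swap
    · exact hne _ _ hpz
    rw [hpz]
    -- All words in the support now end in z, so the last letter can be stripped.
    refine ih q₀ ?_ ?_ (fun q => c (snocWord q z)) ?_ ?_ _ ?_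
    · intro i j hij
      have := hp₀ (Fin.castSucc_le_castSucc_iff.mpr hij)
      simpa using this
    · intro a b hab ha hb
      have hbz : b ≤ z := hle b (by rw [content_snocWord]; omega)
      have haz : z ≠ a := (hab.trans_le hbz).ne'
      obtain ⟨d, hd, hd'⟩ := hord a b hab (by rw [content_snocWord]; omega)
        (by rw [content_snocWord]; omega)
      rw [content_snocWord, content_snocWord, if_neg haz] at hd hd'
      by_cases h : z = b
      · rw [if_pos h] at hd
        -- Stripping z lowers its right end by one, so the gap above it becomes positive and the
        -- condition on lengths is void.
        refine ⟨d + 1, ?_, fun h => absurd h (Nat.succ_ne_zero d)⟩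
        push_cast at hd ⊢
        linear_combination hd
      · rw [if_neg h] at hd hd'
        exact ⟨d, hd, hd'⟩
    · intro q hq
      ext x
      have := congrFun (hc _ hq) x
      rw [content_snocWord, content_snocWord] at this
      exact add_right_cancel this
    · intro i q
      rw [← coeffOp_castSucc m c z hne, heig, sortedWeight_castSucc]
    · rintro e
      apply hp
      rw [eq_snocWord p, hpz, e]

end Eigen

/-! ### Modules generated by an eigenvector -/

section UniqueQuotient

variable {H M ι : Type*} [Ring H] [AddCommGroup M] [Module H M]

/-- For one i at a time, replace the vector by its image under the last power of z_i that does not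
kill it. Commutativity preserves what was achieved for the other indices. -/
theorem exists_joint_kernel [Fintype ι] (z : ι → H) (hz : ∀ i j, Commute (z i) (z j))
    (K : Submodule H M) {v : M} (hv : v ∈ K) (hv0 : v ≠ 0) (hk : ∀ i, ∃ k : ℕ, z i ^ k • v = 0) :
    ∃ v' ∈ K, v' ≠ 0 ∧ ∀ i, z i • v' = 0 := by
  classical
  have key : ∀ s : Finset ι, ∃ v' ∈ K, v' ≠ 0 ∧ (∀ i, ∃ k : ℕ, z i ^ k • v' = 0) ∧
      ∀ i ∈ s, z i • v' = 0 := by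
    intro s
    induction s using Finset.induction_on with
    | empty => exact ⟨v, hv, hv0, hk, by simp⟩
    | insert i s _ ih =>
      obtain ⟨x, hxK, hx0, hxk, hxs⟩ := ih
      have hfind := Nat.find_spec (hxk i)
      have hpos : Nat.find (hxk i) ≠ 0 := by
        intro h
        rw [h, pow_zero, one_smul] at hfind
        exact hx0 hfind
      obtain ⟨k, hk'⟩ := Nat.exists_eq_succ_of_ne_zero hpos
      refine ⟨z i ^ k • x, K.smul_mem _ hxK, Nat.find_min (hxk i) (by omega), fun j => ?_, ?_⟩
      · obtain ⟨r, hr⟩ := hxk j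
        refine ⟨r, ?_⟩
        rw [smul_smul, ((hz j i).pow_pow r k).eq, mul_smul, hr, smul_zero]
      · intro j hj
        rcases Finset.mem_insert.mp hj with rfl | hj
        · rw [smul_smul, ← pow_succ', ← Nat.succ_eq_add_one, ← hk', hfind]
        · rw [smul_smul, ((hz j i).pow_right k).eq, mul_smul, hxs j hj, smul_zero]
  obtain ⟨v', h1, h2, -, h3⟩ := key Finset.univ
  exact ⟨v', h1, h2, fun i => h3 i (Finset.mem_univ i)⟩

theorem existsUnique_isSimpleModule_quotient_of_equiv {M' : Type*} [AddCommGroup M'] [Module H M']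
    (e : M ≃ₗ[H] M') (h : ∃! N : Submodule H M', IsSimpleModule H (M' ⧸ N)) :
    ∃! N : Submodule H M, IsSimpleModule H (M ⧸ N) := by
  simp only [isSimpleModule_iff_isCoatom] at h ⊢
  obtain ⟨N, hN, huniq⟩ := h
  let E := Submodule.orderIsoMapComap e
  refine ⟨E.symm N, (OrderIso.isCoatom_iff E.symm N).mpr hN, fun N' hN' => ?_⟩
  rw [OrderIso.eq_symm_apply]
  exact huniq _ ((OrderIso.isCoatom_iff E N').mpr hN')

variable [Algebra ℂ H] [Module ℂ M] [IsScalarTower ℂ H M]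

/-- The joint generalized eigenspace of a family of elements of an algebra. -/
def jointEigenspace (M : Type*) [AddCommGroup M] [Module H M] [Module ℂ M] [IsScalarTower ℂ H M]
    (y : ι → H) (chi : ι → ℂ) : Submodule ℂ M :=
  ⨅ i, (Algebra.lsmul ℂ ℂ M (y i)).maxGenEigenspace (chi i)

theorem mem_jointEigenspace {y : ι → H} {chi : ι → ℂ} {x : M} : x ∈ jointEigenspace M y chi ↔
    ∀ i, ∃ k : ℕ, (y i - algebraMap ℂ H (chi i)) ^ k • x = 0 := by
  rw [jointEigenspace, Submodule.mem_iInf]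
  refine forall_congr' fun i => ?_
  rw [Module.End.mem_maxGenEigenspace]
  have h : Algebra.lsmul ℂ ℂ M (y i) - chi i • (1 : Module.End ℂ M) =
      Algebra.lsmul ℂ ℂ M (y i - algebraMap ℂ H (chi i)) := by
    rw [map_sub, AlgHom.commutes, Algebra.algebraMap_eq_smul_one]
  rw [h]
  simp only [← map_pow]
  rfl

theorem iSup_jointEigenspace [FiniteDimensional ℂ M] (y : ι → H) (hy : ∀ i j, Commute (y i) (y j)) :
    ⨆ chi : ι → ℂ, jointEigenspace M y chi = ⊤ :=
  Module.End.iSup_iInf_maxGenEigenspace_eq_top_of_forall_mapsTo _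
    (fun i j c => Module.End.mapsTo_maxGenEigenspace_of_comm ((hy j i).map (Algebra.lsmul ℂ ℂ M)) c)
    fun _ => Module.End.iSup_maxGenEigenspace_eq_top _

/-- A submodule meeting the generalized eigenspace of zeta contains a true eigenvector, hence u,
hence everything. So all proper submodules lie in one subspace W that omits u, and two different
maximal submodules, whose sum is M, cannot exist. W need not be a submodule. -/
theorem existsUnique_isSimpleModule_quotient [FiniteDimensional ℂ M] [Fintype ι] (y : ι → H)
    (hy : ∀ i j, Commute (y i) (y j)) (zeta : ι → ℂ) (u : M) (hu : u ≠ 0)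
    (hspan : Submodule.span H {u} = ⊤) (heig : ∀ i, y i • u = zeta i • u)
    (huniq : ∀ v : M, (∀ i, y i • v = zeta i • v) → ∃ c : ℂ, v = c • u) :
    ∃! N : Submodule H M, IsSimpleModule H (M ⧸ N) := by
  set z : ι → H := fun i => y i - algebraMap ℂ H (zeta i) with hzdef
  have hz : ∀ i j, Commute (z i) (z j) := fun i j =>
    ((hy i j).sub_left (Algebra.commute_algebraMap_left _ _)).sub_right
      (Algebra.commute_algebraMap_right _ _)
  have hz_iff : ∀ i (v : M), z i • v = 0 ↔ y i • v = zeta i • v := fun i v => by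
    rw [hzdef, sub_smul, algebraMap_smul, sub_eq_zero]
  -- The sum of all joint generalized eigenspaces other than that of u.
  set W : Submodule ℂ M := ⨆ (chi) (_ : chi ≠ zeta), jointEigenspace M y chi with hW
  have hproper : ∀ K : Submodule H M, K ≠ ⊤ → ∀ x ∈ K, x ∈ W := by
    intro K hK x hx
    have : FiniteDimensional ℂ K := inferInstanceAs (FiniteDimensional ℂ (K.restrictScalars ℂ))
    -- The submodule K is stable under the y_i, so it is the sum of its own generalized eigenspaces;
    -- the one for zeta has to be zero.
    have h1 : (⨆ chi : ι → ℂ, jointEigenspace K y chi).map (K.subtype.restrictScalars ℂ) ≤ W := by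
      rw [Submodule.map_iSup]
      refine iSup_le fun chi => ?_
      by_cases hchi : chi = zeta
      · subst hchi
        rintro _ ⟨v, hv, rfl⟩
        by_cases hv0 : v = 0
        · rw [hv0, map_zero]; exact zero_mem _
        · exfalso
          obtain ⟨v', -, hv', hv'z⟩ := exists_joint_kernel z hz (⊤ : Submodule H K) (v := v) trivial
            hv0 (mem_jointEigenspace.mp hv)
          obtain ⟨c, hc⟩ := huniq v'.1 fun i => (hz_iff i _).mp (congrArg Subtype.val (hv'z i))
          have hc0 : c ≠ 0 := by
            rintro rfl
            rw [zero_smul] at hc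
            exact hv' (Subtype.ext hc)
          apply hK
          rw [eq_top_iff, ← hspan, Submodule.span_singleton_le_iff_mem]
          have : u = algebraMap ℂ H c⁻¹ • v'.1 := by
            rw [algebraMap_smul, hc, smul_smul, inv_mul_cancel₀ hc0, one_smul]
          rw [this]
          exact K.smul_mem _ v'.2
      · refine le_trans ?_ (le_iSup₂_of_le chi hchi le_rfl)
        rintro _ ⟨v, hv, rfl⟩
        rw [mem_jointEigenspace]
        intro i
        obtain ⟨k, hk⟩ := mem_jointEigenspace.mp hv i
        exact ⟨k, congrArg Subtype.val hk⟩
    rw [iSup_jointEigenspace y hy] at h1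
    exact h1 ⟨⟨x, hx⟩, trivial, rfl⟩
  have huW : u ∉ W := by
    intro h
    have h1 : iSupIndep (jointEigenspace M y) :=
      Module.End.independent_iInf_maxGenEigenspace_of_forall_mapsTo _
        fun i j c => Module.End.mapsTo_maxGenEigenspace_of_comm
          ((hy j i).map (Algebra.lsmul ℂ ℂ M)) c
    refine hu (Submodule.disjoint_def.mp (h1 zeta) u (mem_jointEigenspace.mpr fun i => ⟨1, ?_⟩) h)
    rw [pow_one]
    exact (hz_iff i u).mpr (heig i)
  have hne : (⊥ : Submodule H M) ≠ ⊤ := by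
    intro h
    exact hu ((Submodule.mem_bot H).mp (h ▸ Submodule.mem_top))
  have : Module.Finite H M := ⟨⟨{u}, by simpa using hspan⟩⟩
  obtain ⟨N, hN, -⟩ := (eq_top_or_exists_le_coatom (⊥ : Submodule H M)).resolve_left hne
  refine ⟨N, isSimpleModule_iff_isCoatom.mpr hN, fun N' hN' => ?_⟩
  have hN'' := isSimpleModule_iff_isCoatom.mp hN'
  by_contra hNN
  have hle : ¬ N ≤ N' := fun h => (hN.le_iff.mp h).elim hN''.1 hNN
  have hmem : u ∈ N' ⊔ N := by rw [hN''.2 _ (left_lt_sup.mpr hle)]; trivial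
  obtain ⟨x, hx, x', hx', rfl⟩ := Submodule.mem_sup.mp hmem
  exact huW (add_mem (hproper _ hN''.1 x hx) (hproper _ hN.1 x' hx'))

end UniqueQuotient

/-! ### Singular vectors and reordering of segments -/

section Singular

variable {n l : ℕ}

theorem pairing_add_smul_root (nu : CartanDual n) (c : ℂ) (a b : Fin n) (h : SL n) :
    pairing (nu + c • root a b) h = pairing nu h + c * (h.1 a a - h.1 b b) := by
  have e : ∀ i, (nu + c • root a b).1 i =
      nu.1 i + c * ((Pi.single a 1 - Pi.single b 1 : Fin n → ℂ) i) := fun _ => rfl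
  simp only [pairing, e, add_mul, Finset.sum_add_distrib, Pi.sub_apply, mul_sub, sub_mul,
    Finset.sum_sub_distrib, Pi.single_apply, mul_ite, mul_one, mul_zero, ite_mul, zero_mul,
    Finset.sum_ite_eq', Finset.mem_univ, if_true]

theorem pairing_cartan_diff (nu : CartanDual n) (a b : Fin n) :
    pairing nu (traceless a a - traceless b b) = nu.1 a - nu.1 b := by
  rw [← pairing_traceless, ← pairing_traceless]
  exact map_sub (pairingHom nu) _ _

variable {X : Type*} [AddCommGroup X] [Module ℂ X] [LieRingModule (SL n) X] [LieModule ℂ (SL n) X]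

theorem cartan_lie_pow_traceless {nu : CartanDual n} {v : X}
    (hv : ∀ h ∈ cartan n, ⁅h, v⁆ = pairing nu h • v) {a b : Fin n} (hab : a ≠ b) (r : ℕ) :
    ∀ h ∈ cartan n, ⁅h, (LieModule.toEnd ℂ (SL n) X (traceless a b) ^ r) v⁆ =
      pairing (nu + (r : ℂ) • root a b) h • (LieModule.toEnd ℂ (SL n) X (traceless a b) ^ r) v := by
  intro h hh
  rw [pairing_add_smul_root]
  induction r with
  | zero => simpa using hv h hh
  | succ r ih =>
    rw [pow_succ', Module.End.mul_apply, LieModule.toEnd_apply_apply, leibniz_lie, ih,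
      lie_cartan_traceless hh hab, smul_lie, lie_smul, ← add_smul]
    congr 1
    push_cast
    ring

/-- For a simple root α, the nilradical of the minimal parabolic subalgebra of α is stable under ad
f_α; it is the part of n_+ without E_ab. -/
theorem lie_traceless_mem {a b : Fin n} (hab : (b : ℕ) = a + 1) {x : SL n} (hx : x ∈ nPlus n)
    (hxab : x.1 a b = 0) :
    ⁅x, traceless b a⁆ ∈ nPlus n ∧ (⁅x, traceless b a⁆ : SL n).1 a b = 0 := by
  have hne : b ≠ a := by rintro rfl; omega
  have key : ∀ i j, (⁅x, traceless b a⁆ : SL n).1 i j =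
      (if a = j then x.1 i b else 0) - (if b = i then x.1 a j else 0) := by
    intro i j
    rw [LieAlgebra.SpecialLinear.sl_bracket, Matrix.sub_apply, Matrix.mul_apply, Matrix.mul_apply]
    simp only [traceless_apply, hne, false_and, if_false, sub_zero, ite_and, mul_ite, mul_one,
      mul_zero, ite_mul, one_mul, zero_mul, Finset.sum_ite_eq, Finset.mem_univ, if_true]
    congr 1
    split_ifs <;> simp
  constructor
  · intro i j hij
    rw [key]
    have h1 : (if a = j then x.1 i b else 0) = 0 := by
      split_ifs with h
      · subst h
        rcases eq_or_lt_of_le hij with h2 | h2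
        · rw [← h2, hxab]
        · exact hx _ _ (by rw [Fin.le_def]; rw [Fin.lt_def] at h2; omega)
      · rfl
    have h2 : (if b = i then x.1 a j else 0) = 0 := by
      split_ifs with h
      · subst h
        rcases eq_or_lt_of_le hij with h2 | h2
        · rw [h2, hxab]
        · exact hx _ _ (by rw [Fin.le_def]; rw [Fin.lt_def] at h2; omega)
      · rfl
    rw [h1, h2, sub_zero]
  · rw [key, if_neg hne.symm, if_neg hne, sub_zero]

/-- If `v` is a highest weight vector of weight `nu` and `α` is a simple root with
`⟨nu, α^∨⟩ = r ∈ ℤ_{≥ 0}`, then `f_α ^ (r + 1) v` is a highest weight vector. -/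
theorem borel_lie_pow_traceless {nu : CartanDual n} {v : X}
    (hv : ∀ y ∈ borel n, ⁅y, v⁆ = pairing nu y • v) {a b : Fin n} (hab : (b : ℕ) = a + 1) {r : ℕ}
    (hr : nu.1 a - nu.1 b = r) {y : SL n} (hy : y ∈ borel n) :
    ⁅y, (LieModule.toEnd ℂ (SL n) X (traceless b a) ^ (r + 1)) v⁆ =
      pairing (nu + ((r + 1 : ℕ) : ℂ) • root b a) y •
        (LieModule.toEnd ℂ (SL n) X (traceless b a) ^ (r + 1)) v := by
  have hne : a ≠ b := by rintro rfl; omega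
  have hlt : a < b := by rw [Fin.lt_def]; omega
  refine borel_lie_of_nPlus_of_cartan (fun x hx => ?_)
    (cartan_lie_pow_traceless (fun h hh => hv h (cartan_le_borel hh)) hne.symm (r + 1)) hy
  have hplus : ∀ x ∈ nPlus n, ⁅x, v⁆ = 0 := fun x hx => by
    rw [hv x (nPlus_le_borel hx), pairing_nPlus nu hx, zero_smul]
  have h1 : ∀ s : ℕ, ∀ x ∈ nPlus n, x.1 a b = 0 →
      ⁅x, (LieModule.toEnd ℂ (SL n) X (traceless b a) ^ s) v⁆ = 0 := by
    intro s
    induction s with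
    | zero => exact fun x hx _ => hplus x hx
    | succ s ih =>
      intro x hx hxab
      obtain ⟨h2, h3⟩ := lie_traceless_mem hab hx hxab
      rw [pow_succ', Module.End.mul_apply, LieModule.toEnd_apply_apply, leibniz_lie, ih _ h2 h3,
        ih x hx hxab, lie_zero, add_zero]
  -- Here the weight equals r, so the coefficient (r + 1)(w - r) of `sl2_e_pow` vanishes.
  have h2 : ⁅traceless a b, (LieModule.toEnd ℂ (SL n) X (traceless b a) ^ (r + 1)) v⁆ = 0 := by
    have h3 := sl2_e_pow (toEnd_ef (X := X) hne) (toEnd_hf hne) (v := v) (w := r) (by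
      rw [LieModule.toEnd_apply_apply, hv _ (cartan_le_borel (cartan_diff_mem a b)),
        pairing_cartan_diff, hr]) r
    rw [sub_self, mul_zero, zero_smul, add_zero, LieModule.toEnd_apply_apply,
      LieModule.toEnd_apply_apply, hplus _ (traceless_mem_nPlus hlt), map_zero] at h3
    exact h3
  have h3 : x - x.1 a b • traceless a b ∈ nPlus n :=
    sub_mem hx (Submodule.smul_mem _ _ (traceless_mem_nPlus hlt))
  have h4 : (x - x.1 a b • traceless a b : SL n).1 a b = 0 := by
    change x.1 a b - x.1 a b * (traceless a b).1 a b = 0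
    simp [traceless_apply, hne]
  have h5 := h1 (r + 1) _ h3 h4
  rwa [sub_lie, smul_lie, h2, smul_zero, sub_zero] at h5

theorem pow_traceless_mem_weightSpace {nu : CartanDual n} {t : TensorPow n l}
    (ht : t ∈ weightSpace l nu) {a b : Fin n} (hab : a ≠ b) (r : ℕ) :
    (LieModule.toEnd ℂ (SL n) (TensorPow n l) (traceless a b) ^ r) t ∈
      weightSpace l (nu + (r : ℂ) • root a b) :=
  cartan_lie_pow_traceless ht hab r

theorem eq_zero_of_pow_traceless {nu : CartanDual n} {a b : Fin n} (hab : a ≠ b) {k : ℕ}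
    (hk : nu.1 a - nu.1 b = k) {t : TensorPow n l} (ht : t ∈ weightSpace l nu)
    (h0 : (LieModule.toEnd ℂ (SL n) (TensorPow n l) (traceless b a) ^ k) t = 0) : t = 0 :=
  toEnd_pow_traceless_injective hab le_rfl
    (by rw [ht _ (cartan_diff_mem a b), pairing_cartan_diff, hk]) h0

theorem root_apply_left {a b : Fin n} (hab : a ≠ b) : (root a b).1 a = 1 := by
  change (Pi.single a 1 - Pi.single b 1 : Fin n → ℂ) a = 1
  simp [hab]

theorem root_apply_right {a b : Fin n} (hab : a ≠ b) : (root a b).1 b = -1 := by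
  change (Pi.single a 1 - Pi.single b 1 : Fin n → ℂ) b = -1
  simp [hab.symm]

theorem root_apply_of_ne {a b i : Fin n} (ha : i ≠ a) (hb : i ≠ b) : (root a b).1 i = 0 := by
  change (Pi.single a 1 - Pi.single b 1 : Fin n → ℂ) i = 0
  simp [ha, hb]

theorem root_swap (a b : Fin n) : root b a = -root a b :=
  Subtype.ext (neg_sub (Pi.single a 1 : Fin n → ℂ) (Pi.single b 1)).symm

theorem add_smul_root_apply (nu : CartanDual n) (c : ℂ) (a b i : Fin n) :
    (nu + c • root a b).1 i = nu.1 i + c * (root a b).1 i := rfl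

/-- `f_α ^ k` maps the weight space of weight `nu` of `V_n^{⊗ l}` onto that of weight `s_α nu`,
if `k = ⟨nu, α^∨⟩ ≥ 0`. -/
theorem exists_pow_traceless_eq {nu : CartanDual n} {a b : Fin n} (hab : a ≠ b) {k : ℕ}
    (hk : nu.1 a - nu.1 b = k) {t : TensorPow n l}
    (ht : t ∈ weightSpace l (nu + (k : ℂ) • root b a)) :
    ∃ t' ∈ weightSpace l nu,
      (LieModule.toEnd ℂ (SL n) (TensorPow n l) (traceless b a) ^ k) t' = t := by
  have : FiniteDimensional ℂ (TensorPow n l) := Module.Basis.finiteDimensional_of_finite (wordBasis n l)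
  let F : weightSpace l nu →ₗ[ℂ] weightSpace l (nu + (k : ℂ) • root b a) :=
    (LieModule.toEnd ℂ (SL n) (TensorPow n l) (traceless b a) ^ k).restrict
      fun t ht => pow_traceless_mem_weightSpace ht hab.symm k
  have e : nu + (k : ℂ) • root b a + (k : ℂ) • root a b = nu := by
    rw [root_swap a b, smul_neg, neg_add_cancel_right]
  let E : weightSpace l (nu + (k : ℂ) • root b a) →ₗ[ℂ] weightSpace l nu :=
    (LieModule.toEnd ℂ (SL n) (TensorPow n l) (traceless a b) ^ k).restrict
      fun t ht => by
        have := pow_traceless_mem_weightSpace ht hab k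
        rwa [e] at this
  have hF : Function.Injective F := by
    rw [injective_iff_map_eq_zero]
    intro t h
    exact Subtype.ext (eq_zero_of_pow_traceless hab hk t.2 (congrArg Subtype.val h))
  -- The power e_α^k goes back between the same two weight spaces and is injective by the same lemma
  -- with a and b exchanged; so the dimensions agree.
  have hE : Function.Injective E := by
    rw [injective_iff_map_eq_zero]
    intro t h
    refine Subtype.ext (eq_zero_of_pow_traceless hab.symm ?_ t.2 (congrArg Subtype.val h))
    rw [add_smul_root_apply, add_smul_root_apply, root_apply_left hab.symm,
      root_apply_right hab.symm]
    linear_combination -hk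
  have hrank : Module.finrank ℂ (weightSpace l nu) =
      Module.finrank ℂ (weightSpace l (nu + (k : ℂ) • root b a)) :=
    (LinearMap.finrank_le_finrank_of_injective hF).antisymm
      (LinearMap.finrank_le_finrank_of_injective hE)
  have hsurj : Function.Surjective F :=
    (LinearMap.injective_iff_surjective_of_finrank_eq_finrank (K := ℂ) (V := weightSpace l nu)
      (V₂ := weightSpace l (nu + (k : ℂ) • root b a)) hrank).mp hF
  obtain ⟨t', ht'⟩ := hsurj ⟨t, ht⟩
  exact ⟨t'.1, t'.2, congrArg Subtype.val ht'⟩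

/-! ### Maps between coinvariants given by singular vectors. -/

variable [NeZero n]

/-- The homomorphism from `H_0(n_-, M(mu) ⊗ V_n^{⊗ l})` defined by a highest weight vector of
weight `mu`. -/
theorem exists_coinvHom {mu : CartanDual n} {x : X}
    (hx : ∀ y ∈ borel n, ⁅y, x⁆ = pairing mu y • x) :
    ∃ φ : H0 n l (Verma mu) →ₗ[Hecke l] H0 n l X,
      ∀ t, φ (coinvClass (Verma.hwv mu) t) = coinvClass x t := by
  let e : TensorPow n l ≃ₗ[ℂ] H0 n l (Verma mu) := LinearEquiv.ofBijective
    (coinvClass (Verma.hwv mu)) ⟨coinvClass_hwv_injective mu, coinvClass_hwv_surjective mu⟩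
  let φ : H0 n l (Verma mu) →ₗ[ℂ] H0 n l X := coinvClass x ∘ₗ e.symm.toLinearMap
  have hφ : ∀ t, φ (coinvClass (Verma.hwv mu) t) = coinvClass x t := fun t =>
    congrArg (coinvClass x) (e.symm_apply_apply t)
  -- The formulas for the generators of H_l on classes of x ⊗ t use only the action of the Borel
  -- subalgebra on x, so they are the same for the highest weight vector and for x.
  have hlin : ∀ (a : Hecke l) q, φ (a • q) = a • φ q := by
    intro a
    induction a using Hecke.induction with
    | w σ =>
      intro q
      obtain ⟨t, rfl⟩ := coinvClass_hwv_surjective mu q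
      rw [w_smul_coinvClass, hφ, hφ, w_smul_coinvClass]
    | eps i =>
      intro q
      obtain ⟨t, rfl⟩ := coinvClass_hwv_surjective mu q
      rw [eps_smul_hwv, hφ, hφ, eps_smul_coinvClass_of_borel mu hx]
    | scalar c =>
      intro q
      rw [algebraMap_smul, algebraMap_smul, map_smul]
    | add a b ha hb =>
      intro q
      rw [add_smul, map_add, ha, hb, add_smul]
    | mul a b ha hb =>
      intro q
      rw [mul_smul, ha, hb, mul_smul]
  exact ⟨{ φ with map_smul' := hlin }, hφ⟩

/-- On coinvariants, passing to a singular vector f_α^k x becomes applying f_α^k to the tensor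
power, up to sign. -/
theorem coinvClass_pow_traceless {a b : Fin n} (hab : a < b) (k : ℕ) (x : X) (t : TensorPow n l) :
    coinvClass ((LieModule.toEnd ℂ (SL n) X (traceless b a) ^ k) x) t = coinvClass x
      ((-1 : ℂ) ^ k • (LieModule.toEnd ℂ (SL n) (TensorPow n l) (traceless b a) ^ k) t) := by
  induction k generalizing t with
  | zero => simp
  | succ k ih =>
    rw [pow_succ', Module.End.mul_apply, LieModule.toEnd_apply_apply,
      coinvClass_lie (traceless_mem_nMinus hab), ih, ← map_neg]
    congr 1
    rw [pow_succ, pow_succ, Module.End.mul_apply, LieModule.toEnd_apply_apply, mul_neg_one]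
    exact (neg_smul _ _).symm

/-- Reflecting `mu` in a simple root does not change `F_lam(M(mu))` if `lam + rho` lies on the
corresponding wall. -/
theorem nonempty_functorF_equiv_reflect {lam mu : CartanDual n} {a b : Fin n}
    (hab : (b : ℕ) = a + 1) {k : ℕ} (hmu : mu.1 a - mu.1 b = -(k + 2))
    (hk : (lam - mu).1 a - (lam - mu).1 b = (k + 1 : ℕ)) :
    Nonempty (FunctorF l lam (Verma mu) ≃ₗ[Hecke l]
      FunctorF l lam (Verma (mu + ((k + 1 : ℕ) : ℂ) • root a b))) := by
  have hne : a ≠ b := by rintro rfl; omega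
  have hlt : a < b := by rw [Fin.lt_def]; omega
  -- This is s_α · mu for the dot action, and ⟨nu, α^∨⟩ = k. Thus f_α^{k+1} applied to the highest
  -- weight vector of M(nu) is singular of weight mu.
  set nu := mu + ((k + 1 : ℕ) : ℂ) • root a b with hnu
  have hnu1 : nu + ((k + 1 : ℕ) : ℂ) • root b a = mu := by
    rw [hnu, root_swap a b, smul_neg, add_neg_cancel_right]
  have hnu2 : lam - mu + ((k + 1 : ℕ) : ℂ) • root b a = lam - nu := by
    rw [hnu, root_swap a b, smul_neg]; abel
  have hnuk : nu.1 a - nu.1 b = k := by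
    rw [hnu, add_smul_root_apply, add_smul_root_apply, root_apply_left hne, root_apply_right hne]
    push_cast
    linear_combination hmu
  obtain ⟨φ, hφ⟩ := exists_coinvHom (l := l) (mu := mu) (fun y hy => by
    have := borel_lie_pow_traceless (X := Verma nu) (fun _ => Verma.borel_lie_hwv nu) hab hnuk hy
    rwa [hnu1] at this)
  have hφ' : ∀ t, φ (coinvClass (Verma.hwv mu) t) = coinvClass (Verma.hwv nu)
      ((-1 : ℂ) ^ (k + 1) •
        (LieModule.toEnd ℂ (SL n) (TensorPow n l) (traceless b a) ^ (k + 1)) t) := fun t => by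
    rw [hφ, coinvClass_pow_traceless hlt]
  have hmem : ∀ q ∈ FunctorF l lam (Verma mu), φ q ∈ FunctorF l lam (Verma nu) := by
    intro q hq
    obtain ⟨t, rfl⟩ := coinvClass_hwv_surjective mu q
    rw [hφ', coinvClass_hwv_mem_iff, ← hnu2]
    exact Submodule.smul_mem _ _
      (pow_traceless_mem_weightSpace ((coinvClass_hwv_mem_iff mu lam t).mp hq) hne.symm _)
  have hunit : (-1 : ℂ) ^ (k + 1) ≠ 0 := pow_ne_zero _ (by norm_num)
  refine ⟨LinearEquiv.ofBijective (φ.restrict hmem) ⟨?_, ?_⟩⟩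
  · rw [injective_iff_map_eq_zero]
    rintro ⟨q, hq⟩ h
    obtain ⟨t, rfl⟩ := coinvClass_hwv_surjective mu q
    have h1 : φ (coinvClass (Verma.hwv mu) t) = 0 := congrArg Subtype.val h
    rw [hφ'] at h1
    have h2 := coinvClass_hwv_injective nu (h1.trans (map_zero _).symm)
    have h3 := eq_zero_of_pow_traceless hne hk ((coinvClass_hwv_mem_iff mu lam t).mp hq)
      ((smul_eq_zero.mp h2).resolve_left hunit)
    refine Subtype.ext ?_
    change coinvClass (Verma.hwv mu) t = 0
    rw [h3, map_zero]
  · rintro ⟨q, hq⟩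
    obtain ⟨t, rfl⟩ := coinvClass_hwv_surjective nu q
    have ht := (coinvClass_hwv_mem_iff nu lam t).mp hq
    rw [← hnu2] at ht
    obtain ⟨t', ht', rfl⟩ := exists_pow_traceless_eq hne hk ht
    refine ⟨⟨coinvClass (Verma.hwv mu) (((-1 : ℂ) ^ (k + 1))⁻¹ • t'),
      (coinvClass_hwv_mem_iff mu lam _).mpr (Submodule.smul_mem _ _ ht')⟩, Subtype.ext ?_⟩
    change φ (coinvClass (Verma.hwv mu) _) = coinvClass (Verma.hwv nu) _
    rw [hφ', map_smul _ (((-1 : ℂ) ^ (k + 1))⁻¹), smul_smul, mul_inv_cancel₀ hunit, one_smul]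

end Singular

/-! ### The simple quotient of `F_lam(M(mu))` -/

section SimpleQuotient

variable {n l : ℕ}

/-- Exchanging adjacent lengths with L a > L b strictly increases the sum of i L_i, the measure for
sorting. -/
theorem sum_mul_swap (L : Fin n → ℕ) {a b : Fin n} (hab : (b : ℕ) = a + 1) :
    (∑ i : Fin n, (i : ℕ) * L (Equiv.swap a b i)) + L b = (∑ i : Fin n, (i : ℕ) * L i) + L a := by
  have hne : a ≠ b := by rintro rfl; omega
  have key : ∀ f : Fin n → ℕ, ∑ i, f i = f a + (f b + ∑ i ∈ (Finset.univ.erase a).erase b, f i) :=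
    fun f => by
      rw [Finset.add_sum_erase _ f (Finset.mem_erase.mpr ⟨hne.symm, Finset.mem_univ _⟩),
        Finset.add_sum_erase _ f (Finset.mem_univ _)]
  rw [key, key (fun i => (i : ℕ) * L i)]
  have h : ∑ i ∈ (Finset.univ.erase a).erase b, (i : ℕ) * L (Equiv.swap a b i) =
      ∑ i ∈ (Finset.univ.erase a).erase b, (i : ℕ) * L i := by
    refine Finset.sum_congr rfl fun i hi => ?_
    rw [Finset.mem_erase, Finset.mem_erase] at hi
    rw [Equiv.swap_apply_of_ne_of_ne hi.2.1 hi.1]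
  rw [h, Equiv.swap_apply_left, Equiv.swap_apply_right, hab]
  ring

variable [NeZero n]

/-- The sorted vector is cyclic, and `coeff_eq_zero_of_eigen` makes it the only eigenvector of its
character up to scalars. -/
theorem existsUnique_functorF_quotient (Δ : Fin n → Segment) (hΔ : ∑ i, (Δ i).len = l)
    (lam mu : CartanDual n) (hc : ∃ c : ℂ, ∀ i, (lam - mu).1 i = (Δ i).len + c)
    (hord : ∀ a b, a < b → ∃ d : ℕ,
      (mu + rho n).1 a + (Δ a).len = (mu + rho n).1 b + (Δ b).len + d ∧
        (d = 0 → (Δ a).len ≤ (Δ b).len)) :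
    ∃! N : Submodule (Hecke l) (FunctorF l lam (Verma mu)),
      IsSimpleModule (Hecke l) (FunctorF l lam (Verma mu) ⧸ N) := by
  have hT : FiniteDimensional ℂ (TensorPow n l) :=
    Module.Basis.finiteDimensional_of_finite (wordBasis n l)
  have : FiniteDimensional ℂ (FunctorF l lam (Verma mu)) :=
    Module.Finite.equiv (weightEquiv mu l lam)
  refine existsUnique_isSimpleModule_quotient Hecke.eps Hecke.eps_comm
    (sortedWeight (mu + rho n).1 (blockWord Δ hΔ)) (sortedVector Δ hΔ lam mu hc) ?_
    (sortedVector_span Δ hΔ lam mu hc) (eps_smul_sortedVector Δ hΔ lam mu hc) ?_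
  · intro h
    have h1 := (weightEquiv mu l lam).map_eq_zero_iff.mp h
    exact (wordBasis n l).ne_zero _ (congrArg Subtype.val h1)
  · intro v hv
    obtain ⟨⟨t, ht⟩, rfl⟩ := (weightEquiv mu l lam).surjective v
    have heig : ∀ i, wordOp (mu + rho n).1 i t =
        sortedWeight (mu + rho n).1 (blockWord Δ hΔ) i • t := by
      intro i
      apply coinvClass_hwv_injective mu
      rw [← eps_smul_hwv, map_smul]
      exact congrArg Subtype.val (hv i)
    have hzero : ∀ p, p ≠ blockWord Δ hΔ → (wordBasis n l).repr t p = 0 := by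
      refine coeff_eq_zero_of_eigen (mu + rho n).1 (blockWord Δ hΔ) (blockWord_monotone Δ hΔ)
        ?_ (fun p => (wordBasis n l).repr t p) ?_ ?_
      · intro a b hab _ _
        rw [content_blockWord]
        exact hord a b hab
      · intro p hp
        rw [content_blockWord]
        exact (mem_weightSpace_iff hΔ hc t).mp ht p hp
      · intro i p
        rw [← repr_wordOp, heig, map_smul]
        rfl
    refine ⟨(wordBasis n l).repr t (blockWord Δ hΔ), ?_⟩
    rw [sortedVector, ← map_smul]
    congr 1
    apply Subtype.ext
    change t = (wordBasis n l).repr t (blockWord Δ hΔ) • wordBasis n l (blockWord Δ hΔ)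
    conv_lhs => rw [← (wordBasis n l).sum_repr t]
    exact Finset.sum_eq_single _ (fun p _ hp => by rw [hzero p hp, zero_smul]) (by simp)

/-- Replacing `mu` by a weight in the orbit of the stabilizer of `lam + rho`, one may assume that
the lengths increase along each wall containing `lam + rho`. -/
theorem exists_sorted_functorF_equiv (lam mu : CartanDual n) (L : Fin n → ℕ) (hL : ∑ i, L i = l)
    (hc : ∃ c : ℂ, ∀ i, (lam - mu).1 i = L i + c) :
    ∃ (nu : CartanDual n) (K : Fin n → ℕ), ∑ i, K i = l ∧
      (∃ c : ℂ, ∀ i, (lam - nu).1 i = K i + c) ∧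
      (∀ a b : Fin n, (b : ℕ) = a + 1 → (lam + rho n).1 a = (lam + rho n).1 b → K a ≤ K b) ∧
      Nonempty (FunctorF l lam (Verma mu) ≃ₗ[Hecke l] FunctorF l lam (Verma nu)) := by
  -- A bubble sort: each reflection exchanges two adjacent lengths in the wrong order. The sum of i
  -- L_i grows and is bounded by n l.
  induction hN : n * l - ∑ i : Fin n, (i : ℕ) * L i using Nat.strong_induction_on generalizing mu L with
  | _ N ih =>
  by_cases hsorted : ∀ a b : Fin n, (b : ℕ) = a + 1 → (lam + rho n).1 a = (lam + rho n).1 b →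
      L a ≤ L b
  · exact ⟨mu, L, hL, hc, hsorted, ⟨LinearEquiv.refl _ _⟩⟩
  push Not at hsorted
  obtain ⟨a, b, hab, hwall, hlt⟩ := hsorted
  obtain ⟨k, hk⟩ : ∃ k, L a = L b + (k + 1) := ⟨L a - L b - 1, by omega⟩
  obtain ⟨c, hc⟩ := hc
  have hne : a ≠ b := by rintro rfl; omega
  have hk' : (lam - mu).1 a - (lam - mu).1 b = (k + 1 : ℕ) := by
    rw [hc, hc, hk]
    push_cast
    ring
  -- On the wall lam_a - lam_b = -1, because rho_a - rho_b = 1; subtracting the difference k + 1 of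
  -- the lengths gives the value.
  have hmu : mu.1 a - mu.1 b = -(k + 2) := by
    have h1 : lam.1 a + (rho n).1 a = lam.1 b + (rho n).1 b := hwall
    have h2 : lam.1 a - mu.1 a - (lam.1 b - mu.1 b) = (k + 1 : ℕ) := hk'
    rw [rho_apply, rho_apply, hab] at h1
    push_cast at h1 h2
    linear_combination h1 - h2
  obtain ⟨e⟩ := nonempty_functorF_equiv_reflect (l := l) hab hmu hk'
  set nu := mu + ((k + 1 : ℕ) : ℂ) • root a b with hnu
  have hsum : ∑ i, L (Equiv.swap a b i) = l := (Equiv.sum_comp (Equiv.swap a b) L).trans hL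
  have hbound : ∀ K : Fin n → ℕ, ∑ i, K i = l → ∑ i : Fin n, (i : ℕ) * K i ≤ n * l := fun K hK => by
    rw [← hK, Finset.mul_sum]
    exact Finset.sum_le_sum fun i _ => Nat.mul_le_mul_right _ i.2.le
  have hswap := sum_mul_swap L hab
  have hbd := hbound _ hsum
  have hc' : ∀ i, (lam - nu).1 i = (L (Equiv.swap a b i) : ℂ) + c := by
    intro i
    have h1 : (lam - nu).1 i = (lam - mu).1 i - (k + 1 : ℕ) * (root a b).1 i := by
      change lam.1 i - (mu.1 i + _) = lam.1 i - mu.1 i - _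
      exact (sub_sub _ _ _).symm
    rw [h1, hc]
    by_cases ha : i = a
    · subst ha
      rw [root_apply_left hne, Equiv.swap_apply_left, hk]
      push_cast
      ring
    · by_cases hb : i = b
      · subst hb
        rw [root_apply_right hne, Equiv.swap_apply_right, hk]
        push_cast
        ring
      · rw [root_apply_of_ne ha hb, Equiv.swap_apply_of_ne_of_ne ha hb]
        ring
  obtain ⟨nu', K, h1, h2, h3, ⟨e'⟩⟩ :=
    ih (n * l - ∑ i : Fin n, (i : ℕ) * L (Equiv.swap a b i)) (by omega)
      nu (fun i => L (Equiv.swap a b i)) hsum ⟨c, hc'⟩ rfl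
  exact ⟨nu', K, h1, h2, h3, ⟨e.trans e'⟩⟩

/-- After sorting, (nu + rho)_a + K_a = (lam + rho)_a - c, so the ordering condition on right ends
is dominance of lam + rho. -/
theorem existsUnique_functorF_quotient_of_dominant {lam mu : CartanDual n}
    (hdom : lam + rho n ∈ dominantIntegralWeights n) {L : Fin n → ℕ} (hL : ∑ i, L i = l)
    (hc : ∃ c : ℂ, ∀ i, (lam - mu).1 i = L i + c) :
    ∃! N : Submodule (Hecke l) (FunctorF l lam (Verma mu)),
      IsSimpleModule (Hecke l) (FunctorF l lam (Verma mu) ⧸ N) := by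
  obtain ⟨nu, K, hK, ⟨c, hc'⟩, hsort, ⟨e⟩⟩ := exists_sorted_functorF_equiv lam mu L hL hc
  -- Dominance and sorting are known for adjacent indices only. The gaps are nonnegative, so a zero
  -- total gap forces each adjacent gap to be zero, and the inequalities of lengths chain.
  have hchain : ∀ (d : ℕ) (a b : Fin n), (b : ℕ) = a + d → ∃ m : ℕ,
      (lam + rho n).1 a - (lam + rho n).1 b = m ∧ (m = 0 → K a ≤ K b) := by
    intro d
    induction d with
    | zero =>
      intro a b hab
      obtain rfl : b = a := Fin.ext hab
      exact ⟨0, by simp, fun _ => le_rfl⟩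
    | succ d ih =>
      intro a b hab
      obtain ⟨m, hm, hm'⟩ := ih a ⟨a + d, by omega⟩ rfl
      obtain ⟨m', hm2⟩ := hdom ⟨a + d, by omega⟩ b hab
      refine ⟨m + m', by push_cast; linear_combination hm + hm2, fun h => (hm' (by omega)).trans ?_⟩
      refine hsort _ b hab (sub_eq_zero.mp ?_)
      rw [hm2, show m' = 0 by omega, Nat.cast_zero]
  refine existsUnique_isSimpleModule_quotient_of_equiv e
    (existsUnique_functorF_quotient (fun i => ⟨(nu + rho n).1 i, K i⟩) hK lam nu ⟨c, hc'⟩ ?_)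
  intro a b hab
  obtain ⟨d, hd, hd'⟩ := hchain (b - a) a b (by rw [Fin.lt_def] at hab; omega)
  refine ⟨d, ?_, hd'⟩
  have h1 : lam.1 a - nu.1 a = K a + c := hc' a
  have h2 : lam.1 b - nu.1 b = K b + c := hc' b
  have h3 : lam.1 a + (rho n).1 a - (lam.1 b + (rho n).1 b) = d := hd
  change nu.1 a + (rho n).1 a + K a = nu.1 b + (rho n).1 b + K b + d
  linear_combination h3 - h1 + h2

end SimpleQuotient

end

end ArakawaSuzuki

/-! ### The theorem. -/

theorem mainTheorem4 (n l : ℕ) [NeZero n] (hl : 1 ≤ l) (lam mu : CartanDual n)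
    (hlam : lam ∈ integralWeights n) (hmu : mu ∈ integralWeights n) :
    (∀ h : lam - mu ∈ weights (TensorPow n l),
      Nonempty (FunctorF l lam (Verma mu) ≃ₗ[Hecke l] StandardModule h)) ∧
    (lam - mu ∉ weights (TensorPow n l) → Subsingleton (FunctorF l lam (Verma mu))) ∧
    (lam + rho n ∈ dominantIntegralWeights n → lam - mu ∈ weights (TensorPow n l) →
      ∃! N : Submodule (Hecke l) (FunctorF l lam (Verma mu)),
        IsSimpleModule (Hecke l) (FunctorF l lam (Verma mu) ⧸ N)) :=
  ⟨fun h => nonempty_functorF_equiv (segments h) (lengths_sum h) lam mu (lengths_spec h)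
      fun _ => rfl,
    subsingleton_functorF,
    fun hdom h => existsUnique_functorF_quotient_of_dominant hdom (lengths_sum h) (lengths_spec h)⟩
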